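/- (Logarithms are to base $2$; the model of computation is the word RAM with words of $\Theta(\log n)$ bits. A circular-arc graph is a finite simple graph whose vertices can be assigned to arcs on a circle so that two distinct vertices are adjacent if and only if their arcs intersect.) Every circular-arc graph $G$ with $n$ vertices has a representation by $n\log n+o(n\log n)$ bits, for a suitable labelling of its vertices by $n$ integers, which supports, for any two vertices $u,v$ of $G$ given by their labels, the query $\mathrm{adjacent}(u,v)$ (whether $u$ and $v$ are adjacent) in $O(1)$ time, the query $\mathrm{neighborhood}(v)$ (report all vertices adjacent to $v$) in $O(1+\deg(v))$ time, and the query $\mathrm{spath}(u,v)$ (report a shortest path from $u$ to $v$) in $O(1+|\mathrm{spath}(u,v)|)$ time, where $|\mathrm{spath}(u,v)|$ is the length of a shortest path; if $u$ and $v$ lie in different components, the last query halts and reports that there is no path, with no time bound claimed. By storing an additional $n\lceil\log n\rceil$ bits, one can also answer the query $\mathrm{degree}(v)$ (the number of vertices adjacent to $v$) in $O(1)$ time. The query algorithms, the constants in the time bounds and the function in the $o(n\log n)$ term do not depend on $G$; the algorithms are given $n$ and the word size. -/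

import Mathlib

open scoped Asymptotics

/-! ## Circular-arc graphs -/

/-- The closed arc of the circle `ℝ / ℤ` that runs from the image of `a` in positive direction
to the image of `b` (the whole circle if `b - a ≥ 1`). -/
def circleArc (a b : ℝ) : Set (AddCircle (1 : ℝ)) :=
  (fun x : ℝ => (x : AddCircle (1 : ℝ))) '' Set.Icc a b

/-- A graph is a circular-arc graph if its vertices can be assigned to arcs on a circle so that
two distinct vertices are adjacent if and only if their arcs intersect. -/
def IsCircularArcGraph {V : Type*} (G : SimpleGraph V) : Prop :=
  ∃ a b : V → ℝ, (∀ v, a v ≤ b v) ∧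
    ∀ u v, G.Adj u v ↔ u ≠ v ∧ (circleArc (a u) (b u) ∩ circleArc (a v) (b v)).Nonempty

/-! ## The word RAM -/

namespace WordRAM

/-- Binary operations on words. -/
inductive BinOp
  | add | sub | mul | div | mod | and | or | xor | shl | shr | lt | eq

/-- The value of a binary operation on `w`-bit words, that is, on numbers below `2 ^ w`.
Addition, subtraction, multiplication and left shift are taken modulo `2 ^ w`;
comparisons return `1` or `0`. -/
def BinOp.eval (w : ℕ) : BinOp → ℕ → ℕ → ℕ
  | .add, x, y => (x + y) % 2 ^ w
  | .sub, x, y => (x + (2 ^ w - y)) % 2 ^ w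
  | .mul, x, y => (x * y) % 2 ^ w
  | .div, x, y => x / y
  | .mod, x, y => x % y
  | .and, x, y => x &&& y
  | .or, x, y => x ||| y
  | .xor, x, y => x ^^^ y
  | .shl, x, y => (x * 2 ^ y) % 2 ^ w
  | .shr, x, y => x / 2 ^ y
  | .lt, x, y => if x < y then 1 else 0
  | .eq, x, y => if x = y then 1 else 0

/-- Programs. Registers are named by natural numbers; a program mentions finitely many. -/
inductive Cmd
  /-- do nothing -/
  | skip
  /-- `r := k` -/
  | const (r k : ℕ)
  /-- `r := x op y` for registers `r`, `x`, `y` -/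
  | bin (op : BinOp) (r x y : ℕ)
  /-- `r :=` the word of the stored data structure at the address in register `x` -/
  | loadData (r x : ℕ)
  /-- `r :=` the word of the working memory at the address in register `x` -/
  | load (r x : ℕ)
  /-- write register `y` to the working memory at the address in register `x` -/
  | store (x y : ℕ)
  /-- append register `x` to the output -/
  | emit (x : ℕ)
  | seq (p q : Cmd)
  /-- run `p` if register `x` is nonzero, and `q` otherwise -/
  | ite (x : ℕ) (p q : Cmd)
  /-- run `p` as long as register `x` is nonzero -/
  | loop (x : ℕ) (p : Cmd)

/-- A configuration: the registers, the working memory, and the words output so far. -/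
structure State where
  reg : ℕ → ℕ
  mem : ℕ → ℕ
  out : List ℕ

/-- `s.set r x` is `s` with the value of register `r` replaced by `x`. -/
def State.set (s : State) (r x : ℕ) : State :=
  { s with reg := Function.update s.reg r x }

/-- The `i`-th word of a bit string cut into `w`-bit words (least significant bit first, and
padded with zeros at the end). -/
def dataWord (w : ℕ) (bits : List Bool) (i : ℕ) : ℕ :=
  ∑ j ∈ Finset.range w, if bits.getD (i * w + j) false then 2 ^ j else 0

/-- `Exec w bits p s s' t`: on a word RAM with word size `w` whose read-only memory holds the
bit string `bits`, the program `p` started in `s` halts in `s'` after exactly `t` steps.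
Every basic instruction and every test takes one step. -/
inductive Exec (w : ℕ) (bits : List Bool) : Cmd → State → State → ℕ → Prop
  | skip (s : State) : Exec w bits .skip s s 1
  | const (r k : ℕ) (s : State) : Exec w bits (.const r k) s (s.set r (k % 2 ^ w)) 1
  | bin (op : BinOp) (r x y : ℕ) (s : State) :
      Exec w bits (.bin op r x y) s (s.set r (op.eval w (s.reg x) (s.reg y))) 1
  | loadData (r x : ℕ) (s : State) :
      Exec w bits (.loadData r x) s (s.set r (dataWord w bits (s.reg x))) 1
  | load (r x : ℕ) (s : State) :
      Exec w bits (.load r x) s (s.set r (s.mem (s.reg x))) 1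
  | store (x y : ℕ) (s : State) :
      Exec w bits (.store x y) s
        { s with mem := Function.update s.mem (s.reg x) (s.reg y) } 1
  | emit (x : ℕ) (s : State) :
      Exec w bits (.emit x) s { s with out := s.out ++ [s.reg x] } 1
  | seq {p q : Cmd} {s s' s'' : State} {t t' : ℕ} :
      Exec w bits p s s' t → Exec w bits q s' s'' t' →
        Exec w bits (.seq p q) s s'' (t + t')
  | iteTrue {x : ℕ} {p q : Cmd} {s s' : State} {t : ℕ} :
      s.reg x ≠ 0 → Exec w bits p s s' t → Exec w bits (.ite x p q) s s' (t + 1)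
  | iteFalse {x : ℕ} {p q : Cmd} {s s' : State} {t : ℕ} :
      s.reg x = 0 → Exec w bits q s s' t → Exec w bits (.ite x p q) s s' (t + 1)
  | loopTrue {x : ℕ} {p : Cmd} {s s' s'' : State} {t t' : ℕ} :
      s.reg x ≠ 0 → Exec w bits p s s' t → Exec w bits (.loop x p) s' s'' t' →
        Exec w bits (.loop x p) s s'' (t + t' + 1)
  | loopFalse {x : ℕ} {p : Cmd} {s : State} :
      s.reg x = 0 → Exec w bits (.loop x p) s s 1

/-- The initial configuration: the arguments are in the first registers, all other registers and
the working memory are zero, and nothing has been output. -/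
def State.init (args : List ℕ) : State where
  reg := fun i => args.getD i 0
  mem := fun _ => 0
  out := []

/-- The query program `p`, run on the data structure `bits` with the given arguments, halts after
`t` steps with output `out`. -/
def Computes (w : ℕ) (bits : List Bool) (p : Cmd) (args out : List ℕ) (t : ℕ) : Prop :=
  ∃ s, Exec w bits p (State.init args) s t ∧ s.out = out

end WordRAM

/-! ## Queries on a represented graph

The bit string `bits` represents the graph `G`, whose vertices are named by the labels
`0, …, n - 1` through `e`. A query gets the number `n` of vertices, the word size `w` and the labels
of the queried vertices, and reports vertices by their labels. -/

section Queries

variable {V : Type*} (G : SimpleGraph V) {n : ℕ} (e : V ≃ Fin n) (w : ℕ) (bits : List Bool)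
  (p : WordRAM.Cmd) (C : ℕ)

/-- `p` answers `adjacent(u, v)` within `C` steps. -/
def AnswersAdjacent : Prop :=
  ∀ u v : V, ∃ (t x : ℕ), WordRAM.Computes w bits p [n, w, e u, e v] [x] t ∧ t ≤ C ∧
    (G.Adj u v → x = 1) ∧ (¬ G.Adj u v → x = 0)

/-- `p` answers `degree(v)` within `C` steps. -/
def AnswersDegree : Prop :=
  ∀ v : V, ∃ t : ℕ,
    WordRAM.Computes w bits p [n, w, e v] [(G.neighborSet v).ncard] t ∧ t ≤ C

/-- `p` answers `neighborhood(v)` within `C * (degree(v) + 1)` steps: it lists every neighbour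
of `v` exactly once. -/
def AnswersNeighborhood : Prop :=
  ∀ v : V, ∃ (t : ℕ) (l : List V),
    WordRAM.Computes w bits p [n, w, e v] (l.map fun x => (e x : ℕ)) t ∧
    t ≤ C * ((G.neighborSet v).ncard + 1) ∧ l.Nodup ∧ ∀ x, x ∈ l ↔ G.Adj v x

/-- `p` answers `spath(u, v)`: if `u` and `v` are connected, it lists the vertices of a shortest path
from `u` to `v` within `C * (|path| + 1)` steps; otherwise it halts with an empty list. -/
def AnswersSpath : Prop :=
  ∀ u v : V,
    (G.Reachable u v → ∃ (t : ℕ) (P : G.Walk u v), P.IsPath ∧ P.length = G.dist u v ∧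
      WordRAM.Computes w bits p [n, w, e u, e v] (P.support.map fun x => (e x : ℕ)) t ∧
      t ≤ C * (P.length + 1)) ∧
    (¬ G.Reachable u v → ∃ t : ℕ, WordRAM.Computes w bits p [n, w, e u, e v] [] t)

end Queries

/-! Two arcs intersect exactly when one of them contains the starting point of the other. Labelling
the vertices in the cyclic order of their starting points therefore reduces the graph to numbers `d
i < n`: the vertex at `i` covers the points `i, …, i + d i` of an `n`-cycle
(`IsCircularArcGraph.exists_isCyclicModel`). Storing `d` takes about `n log n` bits, and adjacency
is decided by at most two comparisons of a cyclic distance with an entry of `d`.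

The other queries use range maxima of `reach d i = i + d i` in constant time (`eval_rangeMaxE`).
Windows of length `2 ^ j` up to `blockLen n` are stored at every point, but only as offsets of
`O(log log n)` bits; longer windows are stored only for whole blocks, and since `blockLen n` is at
least the square of `idxBits n` they cost `O(n)` bits. Altogether the tables need `O(n (log log
n)²)` bits (`redundancy_isLittleO`).

The neighbours of `v` are the points covered by `v` and the uncovered points that cover `v`. In an
interval that avoids `v`, covering `v` means that the reach passes a fixed threshold. So if a vertex
of maximal reach fails, all fail; otherwise it is reported and the interval splits in two
(`stack_spec`). The number of intervals inspected is linear in the output.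

For shortest paths the cycle is unrolled to a line. A greedy sequence always proceeds to the vertex
of largest reach that it can touch, and no lifted walk gets further in as many steps
(`Greedy.liftReach_le`). A walk from `u` to `v` lifts either to a sequence ending to the right of
its start or, reversed, to one that ascends from `v` to `u`. Hence the two greedy sequences from `u`
and from `v`, run in parallel, give the distance as soon as one of them reaches its target
(`lt_walk_length`, `Greedy.exists_walk`). If neither does within `n` steps, there is no path.

The machine has no logarithm instruction: logarithms are tabulated, and the parameters of the layout
are decoded from a header by means of its lowest set bit (`eval_markerE`). -/

/-! ## A combinatorial normal form of circular-arc graphs -/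

/-- The number of steps from `i` to `j` in positive direction on the cycle `0, …, n - 1`. -/
def cycDist (n i j : ℕ) : ℕ := (j + n - i) % n

/-- The vertices are placed on a cycle of `n` points by `e`, and the vertex at `i` covers the
points `i, i + 1, …, i + d i`; distinct vertices are adjacent if one of them covers the other. -/
def IsCyclicModel {V : Type*} (G : SimpleGraph V) {n : ℕ} (e : V ≃ Fin n) (d : ℕ → ℕ) : Prop :=
  (∀ i < n, d i < n) ∧ ∀ u v, G.Adj u v ↔
    u ≠ v ∧ (cycDist n (e u) (e v) ≤ d (e u) ∨ cycDist n (e v) (e u) ≤ d (e v))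

theorem coe_addCircle_eq_iff {x y : ℝ} :
    (x : AddCircle (1 : ℝ)) = y ↔ ∃ z : ℤ, x = y + z := by
  rw [← sub_eq_zero, ← AddCircle.coe_sub, AddCircle.coe_eq_zero_iff]
  simp only [zsmul_eq_mul, mul_one]
  exact exists_congr fun z => ⟨fun h => by linarith, fun h => by linarith⟩

/-- Lift a common point to the line. Of the two lifted arcs through it, the one that starts later
has its starting point inside the other. -/
theorem circleArc_inter_nonempty_iff {a b a' b' : ℝ} (h : a ≤ b) (h' : a' ≤ b') :
    (circleArc a b ∩ circleArc a' b').Nonempty ↔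
      (∃ z : ℤ, a ≤ a' + z ∧ a' + z ≤ b) ∨ ∃ z : ℤ, a' ≤ a + z ∧ a + z ≤ b' := by
  constructor
  · rintro ⟨_, ⟨x, ⟨hx1, hx2⟩, rfl⟩, ⟨y, ⟨hy1, hy2⟩, hxy⟩⟩
    obtain ⟨z, hz⟩ := coe_addCircle_eq_iff.1 hxy
    rcases le_total (a' - z) a with h1 | h1
    · exact Or.inr ⟨z, by linarith, by linarith⟩
    · exact Or.inl ⟨-z, by push_cast; linarith, by push_cast; linarith⟩
  · rintro (⟨z, h1, h2⟩ | ⟨z, h1, h2⟩)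
    · exact ⟨((a' + z : ℝ) : AddCircle (1 : ℝ)), ⟨_, ⟨h1, h2⟩, rfl⟩, ⟨a', ⟨le_rfl, h'⟩,
        (coe_addCircle_eq_iff.2 ⟨z, rfl⟩).symm⟩⟩
    · exact ⟨((a + z : ℝ) : AddCircle (1 : ℝ)), ⟨a, ⟨le_rfl, h⟩,
        (coe_addCircle_eq_iff.2 ⟨z, rfl⟩).symm⟩, ⟨_, ⟨h1, h2⟩, rfl⟩⟩

/-- The fractional part is the least nonnegative translate of `a' - a`, so it suffices to test this
one translate. -/
theorem exists_int_add_mem_iff {a b a' : ℝ} :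
    (∃ z : ℤ, a ≤ a' + z ∧ a' + z ≤ b) ↔ Int.fract (a' - a) ≤ b - a := by
  constructor
  · rintro ⟨z, h1, h2⟩
    have : Int.fract (a' - a) = Int.fract (a' - a + z) := (Int.fract_add_intCast _ _).symm
    rw [this]
    have h3 : (0 : ℝ) ≤ ⌊a' - a + z⌋ := by
      exact_mod_cast Int.floor_nonneg.2 (by linarith)
    have := Int.self_sub_floor (a' - a + z)
    linarith
  · intro h
    refine ⟨-⌊a' - a⌋, ?_⟩
    have h1 := Int.self_sub_floor (a' - a)
    have h2 := Int.fract_nonneg (a' - a)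
    push_cast
    constructor <;> linarith

theorem fract_sub_eq (a a' : ℝ) : Int.fract (a' - a) =
    if Int.fract a ≤ Int.fract a' then Int.fract a' - Int.fract a
    else Int.fract a' - Int.fract a + 1 := by
  have h0 := Int.fract_nonneg a
  have h1 := Int.fract_nonneg a'
  have h2 := Int.fract_lt_one a
  have h3 := Int.fract_lt_one a'
  have h4 := Int.self_sub_floor a
  have h5 := Int.self_sub_floor a'
  split_ifs with h
  · rw [Int.fract_eq_iff]
    refine ⟨by linarith, by linarith, ⌊a'⌋ - ⌊a⌋, ?_⟩
    push_cast; linarith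
  · rw [Int.fract_eq_iff]
    refine ⟨by linarith, by linarith, ⌊a'⌋ - ⌊a⌋ - 1, ?_⟩
    push_cast; linarith

theorem cycDist_of_le {n i j : ℕ} (hj : j < n) (h : i ≤ j) : cycDist n i j = j - i := by
  rw [cycDist, show j + n - i = j - i + n by omega, Nat.add_mod_right, Nat.mod_eq_of_lt (by omega)]

theorem cycDist_of_lt {n i j : ℕ} (hi : i < n) (h : j < i) : cycDist n i j = j + n - i := by
  rw [cycDist, Nat.mod_eq_of_lt (by omega)]

theorem cycDist_lt {n i j : ℕ} (hi : i < n) : cycDist n i j < n :=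
  Nat.mod_lt _ (by omega)

theorem cycDist_add {n i k : ℕ} (hi : i < n) (hk : k < n) : cycDist n i ((i + k) % n) = k := by
  rcases lt_or_ge (i + k) n with h | h
  · rw [Nat.mod_eq_of_lt h, cycDist_of_le h (by omega)]; omega
  · rw [Nat.mod_eq_sub_mod h, Nat.mod_eq_of_lt (by omega), cycDist_of_lt hi (by omega)]; omega

theorem add_cycDist {n i j : ℕ} (hi : i < n) (hj : j < n) : (i + cycDist n i j) % n = j := by
  rcases le_or_gt i j with h | h
  · rw [cycDist_of_le hj h, Nat.add_sub_cancel' h, Nat.mod_eq_of_lt hj]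
  · rw [cycDist_of_lt hi h, show i + (j + n - i) = j + n by omega, Nat.add_mod_right,
      Nat.mod_eq_of_lt hj]

/-- The points of a cycle with positions `x 0 ≤ … ≤ x (n - 1)` in `[0, 1)` that follow `i` within
length `l` are `i, …, i + d` for some `d`. -/
theorem exists_cover {n : ℕ} (x : ℕ → ℝ) (hx : ∀ i j, i ≤ j → j < n → x i ≤ x j)
    (h0 : ∀ i < n, 0 ≤ x i) (h1 : ∀ i < n, x i < 1) {i : ℕ} (hi : i < n) {l : ℝ} (hl : 0 ≤ l) :
    ∃ d < n, ∀ j < n, j ≠ i →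
      (cycDist n i j ≤ d ↔ (if i < j then x j - x i else x j - x i + 1) ≤ l) := by
  classical
  -- `A k` is the distance from `i` to its `k`-th successor, one full turn being added after the
  -- wrap. It is monotone, so the successors within distance `l` form an initial segment.
  let A : ℕ → ℝ := fun k => if i + k < n then x (i + k) - x i else x (i + k - n) - x i + 1
  have hA : ∀ k k', k ≤ k' → k' < n → A k ≤ A k' := by
    intro k k' h h'
    simp only [A]
    split_ifs with h2 h3
    · linarith [hx (i + k) (i + k') (by omega) h3]
    · linarith [h1 (i + k) h2, h0 (i + k' - n) (by omega)]
    · omega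
    · linarith [hx (i + k - n) (i + k' - n) (by omega) (by omega)]
  have hA0 : A 0 ≤ l := by simp [A, hi, hl]
  refine ⟨Nat.findGreatest (fun k => A k ≤ l) (n - 1), ?_, fun j hj hji => ?_⟩
  · have := Nat.findGreatest_le (P := fun k => A k ≤ l) (n - 1); omega
  have hlt := cycDist_lt (j := j) hi
  have hAj : A (cycDist n i j) = if i < j then x j - x i else x j - x i + 1 := by
    simp only [A]
    rcases lt_or_ge i j with h | h
    · rw [cycDist_of_le hj h.le, if_pos (by omega), if_pos h, Nat.add_sub_cancel' h.le]
    · rw [cycDist_of_lt hi (by omega), if_neg (by omega), if_neg (by omega)]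
      congr 3; omega
  rw [← hAj]
  constructor
  · intro h
    refine (hA _ _ h ?_).trans (Nat.findGreatest_spec (P := fun k => A k ≤ l) (Nat.zero_le _) hA0)
    have := Nat.findGreatest_le (P := fun k => A k ≤ l) (n - 1); omega
  · intro h
    exact Nat.le_findGreatest (by omega) h

/-- Sort the vertices by the fractional parts of their starting points. The starting points inside
an arc are then consecutive in cyclic order, and by `circleArc_inter_nonempty_iff` nothing else
about the arc matters. -/
theorem IsCircularArcGraph.exists_isCyclicModel {V : Type*} [Fintype V] {G : SimpleGraph V}
    (hG : IsCircularArcGraph G) {n : ℕ} (hn : n = Fintype.card V) :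
    ∃ (e : V ≃ Fin n) (d : ℕ → ℕ), IsCyclicModel G e d := by
  obtain ⟨a, b, hab, hadj⟩ := hG
  let e₀ := Fintype.equivFinOfCardEq hn.symm
  let f : Fin n → ℝ := fun i => Int.fract (a (e₀.symm i))
  let e : V ≃ Fin n := e₀.trans (Tuple.sort f).symm
  have hmono : Monotone fun i => Int.fract (a (e.symm i)) := Tuple.monotone_sort f
  let x : ℕ → ℝ := fun i => if h : i < n then Int.fract (a (e.symm ⟨i, h⟩)) else 0
  have hxe : ∀ v, x (e v) = Int.fract (a v) := fun v => by simp [x]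
  have hx : ∀ i j, i ≤ j → j < n → x i ≤ x j := by
    intro i j hij hj
    have hi : i < n := by omega
    simp only [x, hi, hj, dif_pos]
    exact hmono (show (⟨i, hi⟩ : Fin n) ≤ ⟨j, hj⟩ from hij)
  have h0 : ∀ i < n, 0 ≤ x i := fun i hi => by simp [x, hi, Int.fract_nonneg]
  have h1 : ∀ i < n, x i < 1 := fun i hi => by simp [x, hi, Int.fract_lt_one]
  have hd : ∀ v : V, ∃ d < n, ∀ j < n, j ≠ e v → (cycDist n (e v) j ≤ d ↔
      (if (e v : ℕ) < j then x j - x (e v) else x j - x (e v) + 1) ≤ b v - a v) :=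
    fun v => exists_cover x hx h0 h1 (e v).2 (by linarith [hab v])
  choose d hdn hd using hd
  refine ⟨e, fun i => if h : i < n then d (e.symm ⟨i, h⟩) else 0, fun i hi => ?_, fun u v => ?_⟩
  · simp [hi, hdn]
  rw [hadj]
  refine and_congr_right fun huv => ?_
  have huv' : (e u : ℕ) ≠ e v := fun h => huv (e.injective (Fin.ext h))
  rw [circleArc_inter_nonempty_iff (hab u) (hab v), exists_int_add_mem_iff,
    exists_int_add_mem_iff, fract_sub_eq, fract_sub_eq, ← hxe, ← hxe]
  simp only [Fin.is_lt, dif_pos, Fin.eta, Equiv.symm_apply_apply]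
  rw [hd u _ (e v).2 huv'.symm, hd v _ (e u).2 huv']
  have hl := hab u
  have hl' := hab v
  rcases lt_or_gt_of_ne huv' with h | h
  · have h2 := hx _ _ h.le (e v).2
    rw [if_pos h2, if_pos h, if_neg (by omega : ¬ (e v : ℕ) < e u)]
    -- If the starting points coincide, the sorted order makes one of the two distances a full turn
    -- instead of zero. This is harmless, since the other distance is zero and already yields
    -- adjacency.
    split_ifs with h3
    · have : x (e u) = x (e v) := le_antisymm h2 h3
      simp [this, hl, hl']
    · rfl
  · have h2 := hx _ _ h.le (e u).2
    rw [if_pos h2, if_pos h, if_neg (by omega : ¬ (e u : ℕ) < e v)]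
    split_ifs with h3
    · have : x (e u) = x (e v) := le_antisymm h3 h2
      simp [this, hl, hl']
    · rfl

/-! ## Expressions and structured programs for the word RAM -/

namespace WordRAM

/-- Expressions over sixteen registers and the stored data. -/
inductive Ex
  | reg (r : Fin 16)
  | const (k : ℕ)
  | bin (op : BinOp) (a b : Ex)
  | data (a : Ex)
  | ite (c a b : Ex)

namespace Ex

instance (k : ℕ) : OfNat Ex k := ⟨.const k⟩
instance : Add Ex := ⟨.bin .add⟩
instance : Sub Ex := ⟨.bin .sub⟩
instance : Mul Ex := ⟨.bin .mul⟩
instance : Div Ex := ⟨.bin .div⟩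
instance : Mod Ex := ⟨.bin .mod⟩

/-- The value of an expression when the registers hold `ρ`. -/
def eval (w : ℕ) (bits : List Bool) (ρ : Fin 16 → ℕ) : Ex → ℕ
  | reg r => ρ r
  | const k => k % 2 ^ w
  | bin op a b => op.eval w (eval w bits ρ a) (eval w bits ρ b)
  | data a => dataWord w bits (eval w bits ρ a)
  | ite c a b => if eval w bits ρ c ≠ 0 then eval w bits ρ a else eval w bits ρ b

/-- Code that puts the value of an expression into register `r`, using the registers from `r` on as
scratch space. -/
def compile : Ex → ℕ → Cmd
  | reg x, r => .bin .or r x x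
  | const k, r => .const r k
  | bin op a b, r => .seq (compile a r) (.seq (compile b (r + 1)) (.bin op r r (r + 1)))
  | data a, r => .seq (compile a r) (.loadData r r)
  | ite c a b, r => .seq (compile c r) (.ite r (compile a r) (compile b r))

/-- A bound on the number of steps needed to evaluate an expression. -/
def cost : Ex → ℕ
  | reg _ => 1
  | const _ => 1
  | bin _ a b => cost a + (cost b + 1)
  | data a => cost a + 1
  | ite c a b => cost c + (cost a + cost b + 1)

/-- Code compiled for register `r` writes to no register below `r`. Hence a left operand kept in `r`
survives the evaluation of the right operand from `r + 1` on, and the sixteen program registers are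
never disturbed. -/
theorem exec_compile (w : ℕ) (bits : List Bool) (ρ : Fin 16 → ℕ) (e : Ex) :
    ∀ (r : ℕ) (s : State), 16 ≤ r → (∀ i : Fin 16, s.reg i = ρ i) →
      ∃ s' t, Exec w bits (e.compile r) s s' t ∧ t ≤ e.cost ∧ s'.reg r = e.eval w bits ρ ∧
        (∀ i < r, s'.reg i = s.reg i) ∧ s'.mem = s.mem ∧ s'.out = s.out := by
  induction e with
  | reg x =>
    intro r s hr hs
    refine ⟨_, _, .bin _ _ _ _ _, le_rfl, ?_, fun i hi => ?_, rfl, rfl⟩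
    · simp [State.set, BinOp.eval, eval, hs]
    · simp [State.set, hi.ne]
  | const k =>
    intro r s hr hs
    refine ⟨_, _, .const _ _ _, le_rfl, ?_, fun i hi => ?_, rfl, rfl⟩
    · simp [State.set, eval]
    · simp [State.set, hi.ne]
  | bin op a b iha ihb =>
    intro r s hr hs
    obtain ⟨s1, t1, h1, ht1, hr1, hp1, hm1, ho1⟩ := iha r s hr hs
    obtain ⟨s2, t2, h2, ht2, hr2, hp2, hm2, ho2⟩ := ihb (r + 1) s1 (by omega)
      fun i => by rw [hp1 i (by omega), hs]
    refine ⟨_, _, .seq h1 (.seq h2 (.bin _ _ _ _ _)), ?_, ?_, fun i hi => ?_, ?_, ?_⟩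
    · simp only [cost]; omega
    · simp [State.set, eval, hr2, hp2 r (by omega), hr1]
    · simp [State.set, hi.ne, hp2 i (by omega), hp1 i hi]
    · simp [State.set, hm2, hm1]
    · simp [State.set, ho2, ho1]
  | data a iha =>
    intro r s hr hs
    obtain ⟨s1, t1, h1, ht1, hr1, hp1, hm1, ho1⟩ := iha r s hr hs
    refine ⟨_, _, .seq h1 (.loadData _ _ _), ?_, ?_, fun i hi => ?_, ?_, ?_⟩
    · simp only [cost]; omega
    · simp [State.set, eval, hr1]
    · simp [State.set, hi.ne, hp1 i hi]
    · simp [State.set, hm1]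
    · simp [State.set, ho1]
  | ite c a b ihc iha ihb =>
    intro r s hr hs
    obtain ⟨s1, t1, h1, ht1, hr1, hp1, hm1, ho1⟩ := ihc r s hr hs
    have hs1 : ∀ i : Fin 16, s1.reg i = ρ i := fun i => by rw [hp1 i (by omega), hs]
    by_cases hc : eval w bits ρ c = 0
    · obtain ⟨s2, t2, h2, ht2, hr2, hp2, hm2, ho2⟩ := ihb r s1 hr hs1
      refine ⟨_, _, .seq h1 (.iteFalse (by rw [hr1, hc]) h2), ?_, ?_, fun i hi => ?_, ?_, ?_⟩
      · simp only [cost]; omega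
      · simp [eval, hc, hr2]
      · rw [hp2 i hi, hp1 i hi]
      · rw [hm2, hm1]
      · rw [ho2, ho1]
    · obtain ⟨s2, t2, h2, ht2, hr2, hp2, hm2, ho2⟩ := iha r s1 hr hs1
      refine ⟨_, _, .seq h1 (.iteTrue (by rwa [hr1]) h2), ?_, ?_, fun i hi => ?_, ?_, ?_⟩
      · simp only [cost]; omega
      · simp [eval, hc, hr2]
      · rw [hp2 i hi, hp1 i hi]
      · rw [hm2, hm1]
      · rw [ho2, ho1]

end Ex

/-- A configuration as seen by structured programs: only the first sixteen registers matter. -/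
@[ext] structure View where
  reg : Fin 16 → ℕ
  mem : ℕ → ℕ
  out : List ℕ

/-- Replace the value of a register. -/
def View.set (σ : View) (r : Fin 16) (x : ℕ) : View :=
  { σ with reg := Function.update σ.reg r x }

/-- The view of a configuration. -/
def State.view (s : State) : View := ⟨fun i => s.reg i, s.mem, s.out⟩

/-- From every configuration with view `σ`, the program halts within `t` steps in a configuration
with view `σ'`. -/
def Reaches (w : ℕ) (bits : List Bool) (p : Cmd) (σ σ' : View) (t : ℕ) : Prop :=
  ∀ s : State, s.view = σ → ∃ s' t', Exec w bits p s s' t' ∧ t' ≤ t ∧ s'.view = σ'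

namespace Cmd

/-- `r := e` -/
def assign (r : Fin 16) (e : Ex) : Cmd := .seq (e.compile 16) (.bin .or r 16 16)

/-- `r :=` the word of the working memory at address `e` -/
def fetch (r : Fin 16) (e : Ex) : Cmd := .seq (e.compile 16) (.load r 16)

/-- write `b` to the working memory at address `a` -/
def put (a b : Ex) : Cmd := .seq (a.compile 16) (.seq (b.compile 17) (.store 16 17))

/-- append `e` to the output -/
def print (e : Ex) : Cmd := .seq (e.compile 16) (.emit 16)

/-- run `p` if `e` is nonzero, and `q` otherwise -/
def cond (e : Ex) (p q : Cmd) : Cmd := .seq (e.compile 16) (.ite 16 p q)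

/-- run `p` as long as `e` is nonzero -/
def repeatWhile (e : Ex) (p : Cmd) : Cmd :=
  .seq (e.compile 16) (.loop 16 (.seq p (e.compile 16)))

end Cmd

/-! ### Composition rules for programs with time bounds -/

namespace Reaches

variable {w : ℕ} {bits : List Bool} {p q : Cmd} {σ σ' σ'' : View} {t t' : ℕ}

theorem mono (h : Reaches w bits p σ σ' t) (ht : t ≤ t') : Reaches w bits p σ σ' t' :=
  fun s hs => let ⟨s', u, h1, h2, h3⟩ := h s hs; ⟨s', u, h1, h2.trans ht, h3⟩

theorem skip : Reaches w bits .skip σ σ 1 :=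
  fun s hs => ⟨s, 1, .skip s, le_rfl, hs⟩

theorem seq (h : Reaches w bits p σ σ' t) (h' : Reaches w bits q σ' σ'' t') :
    Reaches w bits (.seq p q) σ σ'' (t + t') := by
  intro s hs
  obtain ⟨s1, t1, h1, ht1, hs1⟩ := h s hs
  obtain ⟨s2, t2, h2, ht2, hs2⟩ := h' s1 hs1
  exact ⟨s2, _, .seq h1 h2, by omega, hs2⟩

theorem exec_expr (e : Ex) {r : ℕ} (hr : 16 ≤ r) {s : State} (hs : s.view = σ) :
    ∃ s' t, Exec w bits (e.compile r) s s' t ∧ t ≤ e.cost ∧ s'.reg r = e.eval w bits σ.reg ∧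
      (∀ i < r, s'.reg i = s.reg i) ∧ s'.view = σ := by
  obtain ⟨s', t, h1, h2, h3, h4, h5, h6⟩ := e.exec_compile w bits σ.reg r s hr
    fun i => by rw [← hs]; rfl
  refine ⟨s', t, h1, h2, h3, h4, ?_⟩
  subst hs
  ext i
  · exact h4 i (by omega)
  · exact congrFun h5 i
  · simp [State.view, h6]

theorem assign (r : Fin 16) (e : Ex) :
    Reaches w bits (.assign r e) σ (σ.set r (e.eval w bits σ.reg)) (e.cost + 1) := by
  intro s hs
  obtain ⟨s1, t1, h1, ht1, hr1, -, hs1⟩ := exec_expr (w := w) (bits := bits) e le_rfl hs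
  refine ⟨_, _, .seq h1 (.bin _ _ _ _ _), by omega, ?_⟩
  subst hs1
  ext i
  · by_cases h : i = r
    · subst h; simp [State.view, State.set, View.set, BinOp.eval, hr1]
    · simp [State.view, State.set, View.set, h, Fin.val_inj]
  · rfl
  · simp [State.view, State.set, View.set]

theorem fetch (r : Fin 16) (e : Ex) :
    Reaches w bits (.fetch r e) σ (σ.set r (σ.mem (e.eval w bits σ.reg))) (e.cost + 1) := by
  intro s hs
  obtain ⟨s1, t1, h1, ht1, hr1, -, hs1⟩ := exec_expr (w := w) (bits := bits) e le_rfl hs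
  refine ⟨_, _, .seq h1 (.load _ _ _), by omega, ?_⟩
  subst hs1
  ext i
  · by_cases h : i = r
    · subst h; simp [State.view, State.set, View.set, hr1]
    · simp [State.view, State.set, View.set, h, Fin.val_inj]
  · rfl
  · simp [State.view, State.set, View.set]

theorem put (a b : Ex) :
    Reaches w bits (.put a b) σ
      { σ with mem := Function.update σ.mem (a.eval w bits σ.reg) (b.eval w bits σ.reg) }
      (a.cost + b.cost + 1) := by
  intro s hs
  obtain ⟨s1, t1, h1, ht1, hr1, -, hs1⟩ := exec_expr (w := w) (bits := bits) a le_rfl hs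
  obtain ⟨s2, t2, h2, ht2, hr2, hp2, hs2⟩ :=
    exec_expr (w := w) (bits := bits) b (by omega : 16 ≤ 17) hs1
  refine ⟨_, _, .seq h1 (.seq h2 (.store _ _ _)), by omega, ?_⟩
  rw [hr2, hp2 16 (by omega), hr1]
  subst hs2
  rfl

theorem print (e : Ex) :
    Reaches w bits (.print e) σ { σ with out := σ.out ++ [e.eval w bits σ.reg] } (e.cost + 1) := by
  intro s hs
  obtain ⟨s1, t1, h1, ht1, hr1, -, hs1⟩ := exec_expr (w := w) (bits := bits) e le_rfl hs
  refine ⟨_, _, .seq h1 (.emit _ _), by omega, ?_⟩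
  rw [hr1]
  subst hs1
  rfl

theorem cond_true {e : Ex} (he : e.eval w bits σ.reg ≠ 0) (h : Reaches w bits p σ σ' t) :
    Reaches w bits (.cond e p q) σ σ' (e.cost + t + 1) := by
  intro s hs
  obtain ⟨s1, t1, h1, ht1, hr1, -, hs1⟩ := exec_expr (w := w) (bits := bits) e le_rfl hs
  obtain ⟨s2, t2, h2, ht2, hs2⟩ := h s1 hs1
  exact ⟨_, _, .seq h1 (.iteTrue (by rwa [hr1]) h2), by omega, hs2⟩

theorem cond_false {e : Ex} (he : e.eval w bits σ.reg = 0) (h : Reaches w bits q σ σ' t) :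
    Reaches w bits (.cond e p q) σ σ' (e.cost + t + 1) := by
  intro s hs
  obtain ⟨s1, t1, h1, ht1, hr1, -, hs1⟩ := exec_expr (w := w) (bits := bits) e le_rfl hs
  obtain ⟨s2, t2, h2, ht2, hs2⟩ := h s1 hs1
  exact ⟨_, _, .seq h1 (.iteFalse (by rwa [hr1]) h2), by omega, hs2⟩

theorem while_false {e : Ex} (he : e.eval w bits σ.reg = 0) :
    Reaches w bits (.repeatWhile e p) σ σ (e.cost + 1) := by
  intro s hs
  obtain ⟨s1, t1, h1, ht1, hr1, -, hs1⟩ := exec_expr (w := w) (bits := bits) e le_rfl hs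
  exact ⟨_, _, .seq h1 (.loopFalse (by rw [hr1, he])), by omega, hs1⟩

/-- The guard is compiled twice, before the loop and at the end of its body. The remaining run
starts with an evaluation of the guard, and this evaluation serves as the end of the first
iteration. -/
theorem while_true {e : Ex} (he : e.eval w bits σ.reg ≠ 0) (h : Reaches w bits p σ σ' t)
    (h' : Reaches w bits (.repeatWhile e p) σ' σ'' t') :
    Reaches w bits (.repeatWhile e p) σ σ'' (e.cost + t + 1 + t') := by
  intro s hs
  obtain ⟨s1, t1, h1, ht1, hr1, -, hs1⟩ := exec_expr (w := w) (bits := bits) e le_rfl hs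
  obtain ⟨s2, t2, h2, ht2, hs2⟩ := h s1 hs1
  obtain ⟨s3, t3, h3, ht3, hs3⟩ := h' s2 hs2
  cases h3 with
  | seq h4 h5 =>
    exact ⟨s3, _, .seq h1 (.loopTrue (by rwa [hr1]) (.seq h2 h4) h5), by omega, hs3⟩

end Reaches

/-- The initial view. -/
def View.init (args : List ℕ) : View := ⟨fun i => args.getD i 0, fun _ => 0, []⟩

theorem Reaches.computes {w : ℕ} {bits : List Bool} {p : Cmd} {args : List ℕ} {σ : View} {T : ℕ}
    (h : Reaches w bits p (View.init args) σ T) :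
    ∃ t ≤ T, Computes w bits p args σ.out t := by
  obtain ⟨s, t, h1, ht, hs⟩ := h (State.init args) rfl
  exact ⟨t, ht, s, h1, by rw [← hs]; rfl⟩

/-- A loop that runs through the views `f 0, …, f k`. -/
theorem Reaches.iterate {w : ℕ} {bits : List Bool} {p : Cmd} {e : Ex} {t : ℕ} (f : ℕ → View) :
    ∀ k : ℕ, (∀ i < k, e.eval w bits (f i).reg ≠ 0 ∧ Reaches w bits p (f i) (f (i + 1)) t) →
      e.eval w bits (f k).reg = 0 →
      Reaches w bits (.repeatWhile e p) (f 0) (f k) ((e.cost + t + 1) * (k + 1)) := by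
  intro k
  induction k generalizing f with
  | zero => intro _ h; exact (Reaches.while_false h).mono (by omega)
  | succ k ih =>
    intro h h0
    have := Reaches.while_true (h 0 (by omega)).1 (h 0 (by omega)).2
      (ih (fun i => f (i + 1)) (fun i hi => h (i + 1) (by omega)) h0)
    exact this.mono (by ring_nf; omega)

end WordRAM

/-! ## Reading bit fields -/

namespace WordRAM

theorem sum_bits_lt (f : ℕ → Bool) (t : ℕ) :
    (∑ j ∈ Finset.range t, if f j then 2 ^ j else 0) < 2 ^ t := by
  induction t with
  | zero => simp
  | succ t ih =>
    rw [Finset.sum_range_succ, pow_succ]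
    split_ifs <;> omega

theorem testBit_sum_bits (f : ℕ → Bool) (t i : ℕ) :
    (∑ j ∈ Finset.range t, if f j then 2 ^ j else 0).testBit i = (decide (i < t) && f i) := by
  induction t with
  | zero => simp
  | succ t ih =>
    have hlt := sum_bits_lt f t
    have h := Nat.testBit_two_pow_mul_add (if f t then 1 else 0) hlt i
    rw [Finset.sum_range_succ, show ∀ x : ℕ, x + (if f t then 2 ^ t else 0) =
      2 ^ t * (if f t then 1 else 0) + x by intro x; split_ifs <;> ring, h, ih]
    rcases lt_trichotomy i t with h1 | h1 | h1
    · simp [h1, h1.trans (Nat.lt_succ_self t)]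
    · subst h1; cases hf : f i <;> simp
    · have : ¬ i < t + 1 := by omega
      have h2 : i - t = i - t - 1 + 1 := by omega
      rw [if_neg (by omega), h2]
      split_ifs <;> simp [this, Nat.testBit_succ]

theorem dataWord_lt (w : ℕ) (bits : List Bool) (i : ℕ) : dataWord w bits i < 2 ^ w :=
  sum_bits_lt (fun j => bits.getD (i * w + j) false) w

theorem testBit_dataWord (w : ℕ) (bits : List Bool) (i j : ℕ) :
    (dataWord w bits i).testBit j = (decide (j < w) && bits.getD (i * w + j) false) :=
  testBit_sum_bits (fun j => bits.getD (i * w + j) false) w j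

/-- A bit field of `m` bits at bit `r` of word `q` is obtained from two consecutive words. -/
theorem field_eq {w r m q x : ℕ} {bits : List Bool} (hr : r < w) (hm : m ≤ w) (hx : x < 2 ^ m)
    (h : ∀ j < m, bits.getD (q * w + r + j) false = x.testBit j) :
    (dataWord w bits q / 2 ^ r + dataWord w bits (q + 1) * 2 ^ (w - r) % 2 ^ w) % 2 ^ w % 2 ^ m =
      x := by
  have hw : 2 ^ w = 2 ^ r * 2 ^ (w - r) := by rw [← pow_add]; congr 1; omega
  have ha : dataWord w bits q / 2 ^ r < 2 ^ (w - r) := by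
    rw [Nat.div_lt_iff_lt_mul (by positivity), mul_comm, ← hw]; exact dataWord_lt _ _ _
  -- The left shift drops the high bits of the second word and keeps its low `r` bits, which land
  -- directly above the `w - r` bits left from the first word.
  have hb : dataWord w bits (q + 1) * 2 ^ (w - r) % 2 ^ w =
      2 ^ (w - r) * (dataWord w bits (q + 1) % 2 ^ r) := by
    rw [hw, Nat.mul_mod_mul_right, mul_comm]
  have hc : dataWord w bits (q + 1) % 2 ^ r < 2 ^ r := Nat.mod_lt _ (by positivity)
  rw [hb, add_comm]
  have hlt : 2 ^ (w - r) * (dataWord w bits (q + 1) % 2 ^ r) + dataWord w bits q / 2 ^ r < 2 ^ w := by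
    have h1 := Nat.mul_le_mul_left (2 ^ (w - r)) (Nat.succ_le_of_lt hc)
    rw [Nat.mul_succ] at h1
    rw [hw, mul_comm (2 ^ r)]
    omega
  rw [Nat.mod_eq_of_lt hlt]
  apply Nat.eq_of_testBit_eq
  intro j
  rw [Nat.testBit_mod_two_pow]
  by_cases hj : j < m
  · rw [Nat.testBit_two_pow_mul_add _ ha, ← h j hj]
    split_ifs with h1
    · rw [Nat.testBit_div_two_pow, testBit_dataWord, show q * w + (j + r) = q * w + r + j by ring]
      simp [hj, show j + r < w by omega]
    · rw [Nat.testBit_mod_two_pow, testBit_dataWord,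
        show (q + 1) * w + (j - (w - r)) = q * w + r + j by rw [add_mul]; omega]
      simp [hj, show j - (w - r) < r by omega, show j - (w - r) < w by omega]
  · simp only [hj, decide_false, Bool.false_and]
    exact (Nat.testBit_lt_two_pow (hx.trans_le (Nat.pow_le_pow_right (by omega) (by omega)))).symm

/-- Subtracting one flips exactly the bits up to the lowest set bit. This isolates that bit without
any search or logarithm. -/
theorem xor_pred_eq (z m : ℕ) :
    (2 ^ (m + 1) * z + 2 ^ m) ^^^ (2 ^ (m + 1) * z + 2 ^ m - 1) = 2 ^ (m + 1) - 1 := by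
  have h0 : 0 < 2 ^ m := by positivity
  have h1 : 2 ^ m < 2 ^ (m + 1) := by rw [pow_succ]; omega
  rw [Nat.add_sub_assoc (by omega)]
  apply Nat.eq_of_testBit_eq
  intro j
  rw [Nat.testBit_xor, Nat.testBit_two_pow_mul_add _ h1,
    Nat.testBit_two_pow_mul_add _ (by omega), Nat.testBit_two_pow_sub_one]
  split_ifs with h
  · rw [Nat.testBit_two_pow, Nat.testBit_two_pow_sub_one]
    rcases lt_or_ge j m with h2 | h2
    · simp [h, h2, h2.ne']
    · have : j = m := by omega
      simp [this]
  · simp [h]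

/-! ### Values of expressions in the absence of overflow -/

namespace Ex

variable {w : ℕ} {bits : List Bool} {ρ : Fin 16 → ℕ} {a b c : Ex} {x y : ℕ}

theorem eval_reg {r : Fin 16} : (reg r).eval w bits ρ = ρ r := rfl

theorem eval_ofNat (h : x < 2 ^ w) : (OfNat.ofNat x : Ex).eval w bits ρ = x := Nat.mod_eq_of_lt h

theorem eval_add (ha : a.eval w bits ρ = x) (hb : b.eval w bits ρ = y) (h : x + y < 2 ^ w) :
    (a + b).eval w bits ρ = x + y := by
  show (a.eval w bits ρ + b.eval w bits ρ) % 2 ^ w = _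
  rw [ha, hb, Nat.mod_eq_of_lt h]

theorem eval_sub (ha : a.eval w bits ρ = x) (hb : b.eval w bits ρ = y) (h : y ≤ x)
    (hx : x < 2 ^ w) : (a - b).eval w bits ρ = x - y := by
  show (a.eval w bits ρ + (2 ^ w - b.eval w bits ρ)) % 2 ^ w = _
  rw [ha, hb, show x + (2 ^ w - y) = x - y + 2 ^ w by omega, Nat.add_mod_right,
    Nat.mod_eq_of_lt (by omega)]

theorem eval_mul (ha : a.eval w bits ρ = x) (hb : b.eval w bits ρ = y) (h : x * y < 2 ^ w) :
    (a * b).eval w bits ρ = x * y := by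
  show (a.eval w bits ρ * b.eval w bits ρ) % 2 ^ w = _
  rw [ha, hb, Nat.mod_eq_of_lt h]

theorem eval_div (ha : a.eval w bits ρ = x) (hb : b.eval w bits ρ = y) :
    (a / b).eval w bits ρ = x / y := by
  show a.eval w bits ρ / b.eval w bits ρ = _
  rw [ha, hb]

theorem eval_mod (ha : a.eval w bits ρ = x) (hb : b.eval w bits ρ = y) :
    (a % b).eval w bits ρ = x % y := by
  show a.eval w bits ρ % b.eval w bits ρ = _
  rw [ha, hb]

theorem eval_shl (ha : a.eval w bits ρ = x) (hb : b.eval w bits ρ = y) (h : x * 2 ^ y < 2 ^ w) :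
    (bin .shl a b).eval w bits ρ = x * 2 ^ y := by
  show (a.eval w bits ρ * 2 ^ b.eval w bits ρ) % 2 ^ w = _
  rw [ha, hb, Nat.mod_eq_of_lt h]

/-- `1` if `a < b`, and `0` otherwise. -/
def lt (a b : Ex) : Ex := bin .lt a b

theorem eval_lt (ha : a.eval w bits ρ = x) (hb : b.eval w bits ρ = y) :
    (lt a b).eval w bits ρ = if x < y then 1 else 0 := by
  show (if a.eval w bits ρ < b.eval w bits ρ then 1 else 0) = _
  rw [ha, hb]

theorem eval_lt_ne_zero (ha : a.eval w bits ρ = x) (hb : b.eval w bits ρ = y) :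
    (lt a b).eval w bits ρ ≠ 0 ↔ x < y := by
  rw [eval_lt ha hb]; split_ifs with h <;> simp [h]

theorem eval_ite {P : Prop} [Decidable P] (hc : c.eval w bits ρ ≠ 0 ↔ P)
    (ha : P → a.eval w bits ρ = x) (hb : ¬ P → b.eval w bits ρ = y) :
    (ite c a b).eval w bits ρ = if P then x else y := by
  show (if c.eval w bits ρ ≠ 0 then a.eval w bits ρ else b.eval w bits ρ) = _
  by_cases hP : P
  · rw [if_pos (hc.2 hP), if_pos hP, ha hP]
  · rw [if_neg (fun h => hP (hc.1 h)), if_neg hP, hb hP]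

theorem eval_one (hw : 0 < w) : (1 : Ex).eval w bits ρ = 1 :=
  eval_ofNat (Nat.one_lt_two_pow (by omega))

theorem eval_two (hw : 1 < w) : (2 : Ex).eval w bits ρ = 2 :=
  eval_ofNat (by calc 2 = 2 ^ 1 := rfl
    _ < 2 ^ w := Nat.pow_lt_pow_right (by omega) hw)

theorem eval_zero : (0 : Ex).eval w bits ρ = 0 := eval_ofNat (by positivity)

/-- The field of `m` bits that starts `t` bits after the beginning of word `q`. -/
def field (q t m : Ex) : Ex :=
  (bin .shr (data (q + t / reg 1)) (t % reg 1) +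
    bin .shl (data (q + t / reg 1 + 1)) (reg 1 - t % reg 1)) % bin .shl 1 m

/-- The position is given by a word index `Q` and a bit offset `T`, so that the bit position `Q * w
+ T`, which need not fit into a word, is never formed. `M < w` keeps the mask `2 ^ M` from
overflowing. -/
theorem eval_field {q t m : Ex} {Q T M : ℕ} (hρ : ρ 1 = w) (hq : q.eval w bits ρ = Q)
    (ht : t.eval w bits ρ = T) (hm : m.eval w bits ρ = M) (hQ : Q + T / w + 1 < 2 ^ w)
    (hM : M < w) (hx : x < 2 ^ M)
    (h : ∀ j < M, bits.getD (Q * w + T + j) false = x.testBit j) :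
    (field q t m).eval w bits ρ = x := by
  have hr : T % w < w := Nat.mod_lt _ (by omega)
  have hww : w < 2 ^ w := Nat.lt_two_pow_self
  have e1 : (q + t / reg 1).eval w bits ρ = Q + T / w :=
    eval_add hq (eval_div ht (eval_reg.trans hρ)) (by omega)
  have e2 : (t % reg 1).eval w bits ρ = T % w := eval_mod ht (eval_reg.trans hρ)
  have e3 : (q + t / reg 1 + 1).eval w bits ρ = Q + T / w + 1 := eval_add e1 (eval_one (by omega)) hQ
  have e4 : (reg 1 - t % reg 1).eval w bits ρ = w - T % w :=
    eval_sub (eval_reg.trans hρ) e2 hr.le hww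
  have e5 : (bin .shl 1 m).eval w bits ρ = 1 * 2 ^ M := eval_shl (eval_one (by omega)) hm (by
    rw [one_mul]; exact Nat.pow_lt_pow_right (by omega) hM)
  have e6 : (data (q + t / reg 1)).eval w bits ρ = dataWord w bits (Q + T / w) := by rw [eval, e1]
  have e7 : (data (q + t / reg 1 + 1)).eval w bits ρ = dataWord w bits (Q + T / w + 1) := by
    rw [eval, e3]
  show ((data (q + t / reg 1)).eval w bits ρ / 2 ^ (t % reg 1).eval w bits ρ +
    (data (q + t / reg 1 + 1)).eval w bits ρ * 2 ^ (reg 1 - t % reg 1).eval w bits ρ % 2 ^ w)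
      % 2 ^ w % (bin .shl 1 m).eval w bits ρ = x
  rw [e2, e4, e5, e6, e7, one_mul]
  refine field_eq hr hM.le hx fun j hj => ?_
  rw [← h j hj]
  congr 2
  have := Nat.div_add_mod T w
  rw [add_mul]
  linarith [mul_comm w (T / w)]

end Ex

end WordRAM

/-! ## The encoding of a cyclic model -/

namespace ArcCode

open WordRAM

/-- Bits of a vertex label. -/
def idxBits (n : ℕ) : ℕ := Nat.clog 2 n + 1

/-- Bits of a bit position inside a vertex label. -/
def logBits (n : ℕ) : ℕ := (idxBits n).size

/-- Bits of a position inside a block. -/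
def subBits (n : ℕ) : ℕ := 2 * logBits n

/-- The length of a block. -/
def blockLen (n : ℕ) : ℕ := 2 ^ subBits n

/-- Bits of a record. -/
def recLen (n : ℕ) : ℕ := idxBits n + subBits n * (subBits n + 2)

/-- The number of records. -/
def numRecs (n : ℕ) : ℕ := n + 2 + (n / blockLen n + 1) * idxBits n

/-- The last point covered by the vertex at `i`, on the unrolled cycle. -/
def reach (d : ℕ → ℕ) (i : ℕ) : ℕ := i + d i

theorem exists_argMax (r : ℕ → ℕ) {s e : ℕ} (h : s < e) :
    ∃ x, s ≤ x ∧ x < e ∧ ∀ y, s ≤ y → y < e → r y ≤ r x := by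
  obtain ⟨x, hx, hmax⟩ := Finset.exists_max_image (Finset.Ico s e) r ⟨s, by simp [h]⟩
  rw [Finset.mem_Ico] at hx
  exact ⟨x, hx.1, hx.2, fun y h1 h2 => hmax y (by simp [h1, h2])⟩

open Classical in
/-- A position in `[s, e)` where `r` is maximal. -/
noncomputable def argMax (r : ℕ → ℕ) (s e : ℕ) : ℕ :=
  if h : s < e then (exists_argMax r h).choose else s

/-- The header: a marker, and the two basic parameters. -/
def header (n : ℕ) : ℕ :=
  2 ^ logBits n + 2 ^ (logBits n + 1) * (logBits n + 2 ^ (logBits n + 1) * idxBits n)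

/-- The short fields stored with `x`: its logarithm, and for each `j` the offset of a position of
maximal reach among the `2 ^ j` positions that start with `x`. -/
noncomputable def shortField (n : ℕ) (d : ℕ → ℕ) (x : ℕ) : ℕ → ℕ
  | 0 => Nat.log 2 x
  | j + 1 => argMax (reach d) x (min (x + 2 ^ j) n) - x

/-- A position of maximal reach among the `2 ^ j` blocks that start with block `b`. -/
noncomputable def blockField (n : ℕ) (d : ℕ → ℕ) (b j : ℕ) : ℕ :=
  argMax (reach d) (b * blockLen n) (min ((b + 2 ^ j) * blockLen n) n)

/-- Bit `o` of record `i`. -/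
noncomputable def recordBit (n : ℕ) (d : ℕ → ℕ) (i o : ℕ) : Bool :=
  if i = 0 then (header n).testBit o
  else if i < n + 2 then
    if o < idxBits n then (d (i - 1)).testBit o
    else (shortField n d (i - 1) ((o - idxBits n) / subBits n)).testBit
      ((o - idxBits n) % subBits n)
  else (blockField n d ((i - (n + 2)) / idxBits n) ((i - (n + 2)) % idxBits n)).testBit o

/-- The bit string that represents the cyclic model `d` on `n` points. -/
noncomputable def encode (n : ℕ) (d : ℕ → ℕ) : List Bool :=
  (List.range (numRecs n * recLen n)).map fun p => recordBit n d (p / recLen n) (p % recLen n)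

theorem length_encode (n : ℕ) (d : ℕ → ℕ) : (encode n d).length = numRecs n * recLen n := by
  simp [encode]

theorem getD_encode {n : ℕ} {d : ℕ → ℕ} {p : ℕ} (hp : p < numRecs n * recLen n) :
    (encode n d).getD p false = recordBit n d (p / recLen n) (p % recLen n) := by
  simp [encode, List.getD_eq_getElem?_getD, hp]

/-! ### Bounds on the parameters -/

theorem idxBits_pos (n : ℕ) : 0 < idxBits n := by simp [idxBits]

theorem lt_two_pow_idxBits (n : ℕ) : n < 2 ^ idxBits n := by
  have := Nat.le_pow_clog (b := 2) (by norm_num) n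
  rw [idxBits, pow_succ]
  have : 0 < 2 ^ Nat.clog 2 n := by positivity
  omega

theorem idxBits_lt_two_pow (n : ℕ) : idxBits n < 2 ^ logBits n := Nat.lt_size_self _

theorem logBits_pos (n : ℕ) : 0 < logBits n := Nat.size_pos.2 (idxBits_pos n)

theorem two_pow_logBits_le (n : ℕ) : 2 ^ (logBits n - 1) ≤ idxBits n :=
  Nat.lt_size.1 (by have := logBits_pos n; unfold logBits at *; omega)

theorem two_pow_logBits_le' (n : ℕ) : 2 ^ logBits n ≤ 2 * idxBits n := by
  have := two_pow_logBits_le n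
  obtain ⟨m, hm⟩ := Nat.exists_eq_succ_of_ne_zero (logBits_pos n).ne'
  rw [hm] at this ⊢
  rw [pow_succ]
  simp at this
  omega

theorem sq_two_pow_logBits (n : ℕ) : blockLen n = 2 ^ logBits n * 2 ^ logBits n := by
  rw [blockLen, subBits, two_mul, pow_add]

/-- The reason for the factor two in `subBits`: there are about `n / blockLen n * idxBits n` block
entries, each in a record of `O(idxBits n)` bits, which makes `O(n)` bits. -/
theorem sq_idxBits_le_blockLen (n : ℕ) : idxBits n * idxBits n ≤ blockLen n := by
  rw [sq_two_pow_logBits]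
  exact Nat.mul_le_mul (idxBits_lt_two_pow n).le (idxBits_lt_two_pow n).le

/-- For `logBits n = m + 1` the left side is `subBits n * (subBits n + 2)`, and `2 ^ m ≤ idxBits n`.
The excess over `2 ^ m` is largest for `m = 6` and `m = 7`, where it is 160. This is the source of
the constant 200 in the word size. -/
theorem mul_self_le_two_pow_add (m : ℕ) : 4 * (m + 1) * (m + 2) ≤ 2 ^ m + 200 := by
  rcases lt_or_ge m 9 with h | h
  · interval_cases m <;> norm_num
  · induction m, h using Nat.le_induction with
    | base => norm_num
    | succ m hm ih => rw [pow_succ]; nlinarith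

theorem shorts_le_add (n : ℕ) : subBits n * (subBits n + 2) ≤ idxBits n + 200 := by
  obtain ⟨m, hm⟩ := Nat.exists_eq_succ_of_ne_zero (logBits_pos n).ne'
  have h1 := two_pow_logBits_le n
  have h2 := mul_self_le_two_pow_add m
  rw [hm, Nat.succ_eq_add_one, Nat.add_sub_cancel] at h1
  have h4 : subBits n * (subBits n + 2) = 4 * (m + 1) * (m + 2) := by
    rw [subBits, hm, Nat.succ_eq_add_one]; ring
  omega

theorem two_pow_ge (w : ℕ) (h : 30 ≤ w) : 1000 * (w * w) ≤ 2 ^ w := by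
  induction w, h using Nat.le_induction with
  | base => norm_num
  | succ m hm ih => rw [pow_succ]; nlinarith

/-- The word size is large enough for the encoding of models on `n` points. -/
structure Wide (n w : ℕ) : Prop where
  lt : Nat.clog 2 n + 200 < w

namespace Wide

variable {n w : ℕ}

theorem idxBits_le (h : Wide n w) : idxBits n + 200 ≤ w := by
  have := h.lt; unfold idxBits; omega

theorem one_lt (h : Wide n w) : 1 < w := by
  have := h.lt; omega

theorem pos (h : Wide n w) : 0 < w := by
  have := h.lt; omega

theorem shorts_le (h : Wide n w) : subBits n * (subBits n + 2) ≤ w := by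
  have := shorts_le_add n; have := h.idxBits_le; omega

theorem recLen_le (h : Wide n w) : recLen n ≤ 2 * w := by
  have := h.shorts_le; have := h.idxBits_le; unfold recLen; omega

theorem subBits_pos (n : ℕ) : 2 ≤ subBits n := by
  have := logBits_pos n; unfold subBits; omega

theorem subBits_lt (h : Wide n w) : subBits n + 2 < w := by
  have h1 := h.shorts_le
  have h2 := subBits_pos n
  have h3 := h.idxBits_le
  by_contra h4
  have : 2 * (subBits n + 2) ≤ subBits n * (subBits n + 2) := Nat.mul_le_mul_right _ h2
  omega

/-- The header has three slots of `logBits n + 1` bits, for the marker, `logBits n` and `idxBits n`.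
The bound makes it fit into the first record and into one word. -/
theorem header_le (n : ℕ) : 3 * (logBits n + 1) ≤ subBits n * (subBits n + 2) := by
  have := logBits_pos n
  unfold subBits
  nlinarith

theorem sq_le (h : Wide n w) : 1000 * (w * w) ≤ 2 ^ w :=
  two_pow_ge w (by have := h.idxBits_le; omega)

theorem le_sq (h : Wide n w) : 200 * w ≤ w * w :=
  Nat.mul_le_mul_right _ (by have := h.idxBits_le; omega)

theorem size_lt (h : Wide n w) : 1000 * n < 2 ^ w := by
  have h1 := lt_two_pow_idxBits n
  have h2 : 2 ^ (idxBits n + 10) ≤ 2 ^ w :=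
    Nat.pow_le_pow_right (by norm_num) (by have := h.idxBits_le; omega)
  rw [pow_add] at h2
  norm_num at h2
  omega

theorem blockLen_le (h : Wide n w) : blockLen n ≤ 4 * (w * w) := by
  have h1 : 2 ^ logBits n ≤ 2 * w :=
    (two_pow_logBits_le' n).trans (by have := h.idxBits_le; omega)
  rw [sq_two_pow_logBits]
  calc _ ≤ (2 * w) * (2 * w) := Nat.mul_le_mul h1 h1
    _ = _ := by ring

theorem blocks_le (h : Wide n w) : (n / blockLen n + 1) * idxBits n ≤ n + w := by
  have h1 : n / blockLen n * idxBits n ≤ n := by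
    refine (Nat.mul_le_mul_left _ ?_).trans (Nat.div_mul_le_self n (blockLen n))
    have := sq_idxBits_le_blockLen n
    have := idxBits_pos n
    nlinarith
  have := h.idxBits_le
  rw [add_mul]
  omega

theorem numRecs_le (h : Wide n w) : numRecs n ≤ 2 * n + w + 2 := by
  have := h.blocks_le; unfold numRecs; omega

end Wide

/-- The bit string holds an encoding of the cyclic model `d` on `n` points, possibly followed by
other data. -/
structure Stores (n w : ℕ) (bits : List Bool) (d : ℕ → ℕ) : Prop where
  wide : Wide n w
  cover_lt : ∀ i < n, d i < n
  bits_eq : ∀ p < numRecs n * recLen n,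
    bits.getD p false = recordBit n d (p / recLen n) (p % recLen n)

theorem Stores.record {n w : ℕ} {bits : List Bool} {d : ℕ → ℕ} (h : Stores n w bits d) {i o : ℕ}
    (hi : i < numRecs n) (ho : o < recLen n) :
    bits.getD (i * recLen n + o) false = recordBit n d i o := by
  rw [h.bits_eq, add_comm, Nat.add_mul_mod_self_right, Nat.mod_eq_of_lt ho,
    Nat.add_mul_div_right _ _ (by omega), Nat.div_eq_of_lt ho, zero_add]
  calc _ < i * recLen n + recLen n := by omega
    _ = (i + 1) * recLen n := by ring
    _ ≤ _ := Nat.mul_le_mul_right _ hi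

/-! ### The access expressions -/

/-- The marker of the header. -/
def markerE : Ex := .bin .xor (.data 0) (.data 0 - 1) + 1

/-- The parameter `logBits`. -/
def logBitsE : Ex := .data 0 / markerE % markerE

/-- The parameter `idxBits`. -/
def idxBitsE : Ex := .data 0 / (markerE * markerE) % markerE

/-- The parameter `subBits`. -/
def subBitsE : Ex := logBitsE + logBitsE

/-- The parameter `blockLen`. -/
def blockLenE : Ex := .bin .shl 1 subBitsE

/-- The parameter `recLen`. -/
def recLenE : Ex := idxBitsE + subBitsE * (subBitsE + 2)

/-- The parameter `numRecs`. -/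
def numRecsE : Ex := .reg 0 + 2 + (.reg 0 / blockLenE + 1) * idxBitsE

/-- The `m` bits of record `i` from bit `o` on. -/
def recordE (i o m : Ex) : Ex :=
  .field (i / .reg 1 * recLenE) (i % .reg 1 * recLenE + o) m

/-- The number of points covered by `i`. -/
def coverE (i : Ex) : Ex := recordE (i + 1) 0 idxBitsE

/-- Short field `j` of `i`. -/
def shortE (i j : Ex) : Ex := recordE (i + 1) (idxBitsE + j * subBitsE) subBitsE

/-- The entry for `2 ^ j` blocks from block `b` on. -/
def blockE (b j : Ex) : Ex := recordE (.reg 0 + 2 + (b * idxBitsE + j)) 0 idxBitsE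

theorem header_lt (n : ℕ) : header n < 2 ^ (3 * (logBits n + 1)) := by
  have h1 : logBits n < 2 ^ logBits n := Nat.lt_two_pow_self
  have h2 := idxBits_lt_two_pow n
  have h3 : 2 ^ (3 * (logBits n + 1)) = 8 * (2 ^ logBits n) ^ 3 := by
    rw [← pow_mul, show 8 = 2 ^ 3 by norm_num, ← pow_add]; congr 1; ring
  rw [h3, header, pow_succ]
  set P := 2 ^ logBits n
  have h4 : logBits n + P * 2 * idxBits n < P * 2 * P := by nlinarith
  have h5 : P * 2 * (logBits n + P * 2 * idxBits n) + P * 2 ≤ P * 2 * (P * 2 * P) := by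
    have := Nat.mul_le_mul_left (P * 2) (Nat.succ_le_of_lt h4)
    rw [Nat.mul_succ] at this
    exact this
  have h6 : 1 ≤ P := by omega
  nlinarith [Nat.mul_le_mul_left (P * P) h6, pow_pos (show 0 < P by omega) 3]

section Access

variable {n w : ℕ} {bits : List Bool} {d : ℕ → ℕ} {ρ : Fin 16 → ℕ}

theorem Stores.exists_dataWord_zero (h : Stores n w bits d) :
    ∃ z, dataWord w bits 0 = header n + 2 ^ (3 * (logBits n + 1)) * z := by
  have hle := Wide.header_le n
  have hw := h.wide.shorts_le
  refine ⟨dataWord w bits 0 / 2 ^ (3 * (logBits n + 1)), ?_⟩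
  conv_lhs => rw [← Nat.mod_add_div (dataWord w bits 0) (2 ^ (3 * (logBits n + 1)))]
  congr 1
  apply Nat.eq_of_testBit_eq
  intro j
  rw [Nat.testBit_mod_two_pow, testBit_dataWord]
  by_cases hj : j < 3 * (logBits n + 1)
  · have h1 : j < recLen n := by unfold recLen; omega
    have h2 := h.record (i := 0) (by unfold numRecs; omega) h1
    rw [recordBit, if_pos rfl, zero_mul] at h2
    rw [zero_mul, h2]
    simp [hj, show j < w by omega]
  · simp only [hj, decide_false, Bool.false_and]
    exact (Nat.testBit_lt_two_pow ((header_lt n).trans_le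
      (Nat.pow_le_pow_right (by omega) (by omega)))).symm

/-- In this form the lowest set bit is visibly bit `logBits n`, and division by powers of the marker
uncovers the other slots, whatever data `z` follow the header in the first word. -/
theorem Stores.exists_dataWord_zero' (h : Stores n w bits d) :
    ∃ z, dataWord w bits 0 = 2 ^ (logBits n + 1) * (logBits n + 2 ^ (logBits n + 1) *
      (idxBits n + 2 ^ (logBits n + 1) * z)) + 2 ^ logBits n := by
  obtain ⟨z, hz⟩ := h.exists_dataWord_zero
  refine ⟨z, hz.trans ?_⟩
  rw [header, show 3 * (logBits n + 1) = (logBits n + 1) + (logBits n + 1) + (logBits n + 1) by ring,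
    pow_add, pow_add]
  ring

theorem eval_data_zero : (Ex.data 0).eval w bits ρ = dataWord w bits 0 := by
  rw [Ex.eval, Ex.eval_zero]

/-- The slot width is itself unknown to the program. It is recovered from the position of the lowest
set bit by `xor_pred_eq`. -/
theorem eval_markerE (h : Stores n w bits d) :
    markerE.eval w bits ρ = 2 ^ (logBits n + 1) := by
  obtain ⟨z, hz⟩ := h.exists_dataWord_zero'
  have hlt := dataWord_lt w bits 0
  have h0 : 0 < 2 ^ logBits n := by positivity
  have e1 : (Ex.data 0 - 1).eval w bits ρ = dataWord w bits 0 - 1 :=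
    Ex.eval_sub eval_data_zero (Ex.eval_one h.wide.pos) (by omega) hlt
  have e2 : (Ex.bin .xor (.data 0) (.data 0 - 1)).eval w bits ρ = 2 ^ (logBits n + 1) - 1 := by
    show (Ex.data 0).eval w bits ρ ^^^ (Ex.data 0 - 1).eval w bits ρ = _
    rw [e1, eval_data_zero, hz]
    exact xor_pred_eq _ _
  have h1 : 2 ^ (logBits n + 1) < 2 ^ w := by
    have := Wide.header_le n; have := h.wide.shorts_le
    exact Nat.pow_lt_pow_right (by omega) (by omega)
  have h2 : 0 < 2 ^ (logBits n + 1) := by positivity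
  have := Ex.eval_add e2 (Ex.eval_one h.wide.pos) (by omega)
  rw [markerE, this]; omega

theorem eval_logBitsE (h : Stores n w bits d) : logBitsE.eval w bits ρ = logBits n := by
  obtain ⟨z, hz⟩ := h.exists_dataWord_zero'
  have h1 : 2 ^ logBits n < 2 ^ (logBits n + 1) := Nat.pow_lt_pow_right (by omega) (by omega)
  have h2 : logBits n < 2 ^ logBits n := Nat.lt_two_pow_self
  have := Ex.eval_mod (Ex.eval_div (eval_data_zero (ρ := ρ)) (eval_markerE h)) (eval_markerE h)
  rw [logBitsE, this, hz, Nat.mul_add_div (by positivity), Nat.div_eq_of_lt h1, add_zero,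
    Nat.add_mul_mod_self_left, Nat.mod_eq_of_lt (by omega)]

theorem eval_idxBitsE (h : Stores n w bits d) : idxBitsE.eval w bits ρ = idxBits n := by
  obtain ⟨z, hz⟩ := h.exists_dataWord_zero'
  have h1 : 2 ^ logBits n < 2 ^ (logBits n + 1) := Nat.pow_lt_pow_right (by omega) (by omega)
  have h2 : logBits n < 2 ^ logBits n := Nat.lt_two_pow_self
  have h3 := idxBits_lt_two_pow n
  have h4 : 2 ^ (logBits n + 1) * 2 ^ (logBits n + 1) < 2 ^ w := by
    have := Wide.header_le n; have := h.wide.shorts_le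
    rw [← pow_add]
    exact Nat.pow_lt_pow_right (by omega) (by omega)
  have := Ex.eval_mod (Ex.eval_div (eval_data_zero (ρ := ρ)) (Ex.eval_mul (eval_markerE h)
    (eval_markerE h) h4)) (eval_markerE h)
  rw [idxBitsE, this, hz, ← Nat.div_div_eq_div_mul, Nat.mul_add_div (by positivity),
    Nat.div_eq_of_lt h1, add_zero, Nat.add_mul_div_left _ _ (by positivity),
    Nat.div_eq_of_lt (by omega), zero_add, Nat.add_mul_mod_self_left, Nat.mod_eq_of_lt (by omega)]

theorem eval_subBitsE (h : Stores n w bits d) : subBitsE.eval w bits ρ = subBits n := by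
  have h1 := h.wide.subBits_lt
  have h2 : w < 2 ^ w := Nat.lt_two_pow_self
  have := Ex.eval_add (eval_logBitsE (ρ := ρ) h) (eval_logBitsE (ρ := ρ) h)
    (by unfold subBits at h1; omega)
  rw [subBitsE, this, subBits, two_mul]

theorem eval_blockLenE (h : Stores n w bits d) : blockLenE.eval w bits ρ = blockLen n := by
  have h1 := h.wide.subBits_lt
  have := Ex.eval_shl (Ex.eval_one h.wide.pos) (eval_subBitsE (ρ := ρ) h)
    (by rw [one_mul]; exact Nat.pow_lt_pow_right (by omega) (by omega))
  rw [blockLenE, this, one_mul, blockLen]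

theorem eval_recLenE (h : Stores n w bits d) : recLenE.eval w bits ρ = recLen n := by
  have h1 := h.wide.subBits_lt
  have h2 : w < 2 ^ w := Nat.lt_two_pow_self
  have h3 := h.wide.shorts_le
  have h4 := h.wide.recLen_le
  have h5 := h.wide.sq_le
  have h6 := h.wide.le_sq
  exact Ex.eval_add (eval_idxBitsE h) (Ex.eval_mul (eval_subBitsE h)
    (Ex.eval_add (eval_subBitsE h) (Ex.eval_two h.wide.one_lt) (by omega)) (by omega))
    (by unfold recLen at h4; omega)

theorem eval_numRecsE (h : Stores n w bits d) (h0 : ρ 0 = n) :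
    numRecsE.eval w bits ρ = numRecs n := by
  have h2 := h.wide.blocks_le
  have h4 := h.wide.numRecs_le
  have h5 := h.wide.sq_le
  have h6 := h.wide.le_sq
  have h7 := h.wide.size_lt
  have h8 := h.wide.idxBits_le
  have h9 : n / blockLen n ≤ n := Nat.div_le_self _ _
  exact Ex.eval_add (Ex.eval_add (Ex.eval_reg.trans h0) (Ex.eval_two h.wide.one_lt) (by omega))
    (Ex.eval_mul (Ex.eval_add (Ex.eval_div (Ex.eval_reg.trans h0) (eval_blockLenE h))
    (Ex.eval_one h.wide.pos) (by omega)) (eval_idxBitsE h) (by omega))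
    (by unfold numRecs at h4; omega)

theorem div_mul_le (h : Wide n w) {i : ℕ} : i / w * recLen n ≤ 2 * i := by
  calc _ ≤ i / w * (2 * w) := Nat.mul_le_mul_left _ h.recLen_le
    _ = 2 * (i / w * w) := by ring
    _ ≤ _ := Nat.mul_le_mul_left _ (Nat.div_mul_le_self _ _)

theorem mod_mul_le (h : Wide n w) {i : ℕ} : i % w * recLen n + recLen n ≤ 2 * (w * w) := by
  have h1 : i % w < w := Nat.mod_lt _ (by have := h.idxBits_le; omega)
  calc _ = (i % w + 1) * recLen n := by ring
    _ ≤ w * (2 * w) := Nat.mul_le_mul h1 h.recLen_le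
    _ = _ := by ring

/-- Since `I = w * (I / w) + I % w`, record `I` starts `I / w * recLen n` whole words and `I % w *
recLen n` further bits after the beginning. Both numbers fit into a word, although `I * recLen n`
may not. -/
theorem eval_recordE (h : Stores n w bits d) (h1 : ρ 1 = w) {i o m : Ex} {I O M x : ℕ}
    (hi : i.eval w bits ρ = I) (ho : o.eval w bits ρ = O) (hm : m.eval w bits ρ = M)
    (hI : I < numRecs n) (hO : O + M ≤ recLen n) (hM : M < w) (hx : x < 2 ^ M)
    (hb : ∀ j < M, recordBit n d I (O + j) = x.testBit j) :
    (recordE i o m).eval w bits ρ = x := by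
  have h4 := h.wide.numRecs_le
  have h5 := h.wide.sq_le
  have h6 := h.wide.le_sq
  have h7 := h.wide.size_lt
  have h8 := h.wide.idxBits_le
  have h9 := div_mul_le h.wide (i := I)
  have h10 := mod_mul_le h.wide (i := I)
  have h11 : (I % w * recLen n + O) / w ≤ 2 * w := by
    rw [Nat.div_le_iff_le_mul_add_pred (by omega)]
    have : w * (2 * w) = 2 * (w * w) := by ring
    omega
  refine Ex.eval_field h1 (Ex.eval_mul (Ex.eval_div hi (Ex.eval_reg.trans h1)) (eval_recLenE h)
    (by omega)) (Ex.eval_add (Ex.eval_mul (Ex.eval_mod hi (Ex.eval_reg.trans h1)) (eval_recLenE h)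
    (by omega)) ho (by omega)) hm (by omega) hM hx fun j hj => ?_
  rw [← hb j hj, ← h.record hI (by omega)]
  congr 1
  have := Nat.div_add_mod I w
  calc _ = (w * (I / w) + I % w) * recLen n + (O + j) := by ring
    _ = _ := by rw [this]

theorem eval_coverE (h : Stores n w bits d) (h1 : ρ 1 = w) {i : Ex} {I : ℕ}
    (hi : i.eval w bits ρ = I) (hI : I < n) : (coverE i).eval w bits ρ = d I := by
  have h7 := h.wide.size_lt
  have h8 := h.wide.idxBits_le
  refine eval_recordE h h1 (Ex.eval_add hi (Ex.eval_one h.wide.pos) (by omega)) Ex.eval_zero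
    (eval_idxBitsE h) (by unfold numRecs; omega) (by unfold recLen; omega) (by omega)
    ((h.cover_lt I hI).trans (lt_two_pow_idxBits n)) fun j hj => ?_
  rw [recordBit, if_neg (by omega), if_pos (by omega), if_pos (by omega), zero_add,
    Nat.add_sub_cancel]

theorem eval_shortE (h : Stores n w bits d) (h1 : ρ 1 = w) {i j : Ex} {I J : ℕ}
    (hi : i.eval w bits ρ = I) (hj : j.eval w bits ρ = J) (hI : I ≤ n) (hJ : J < subBits n + 2)
    (hx : shortField n d I J < 2 ^ subBits n) :
    (shortE i j).eval w bits ρ = shortField n d I J := by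
  have h2 := h.wide.shorts_le
  have h3 := h.wide.subBits_lt
  have h5 := h.wide.sq_le
  have h6 := h.wide.le_sq
  have h7 := h.wide.size_lt
  have h8 := h.wide.idxBits_le
  have h9 : J * subBits n + subBits n ≤ subBits n * (subBits n + 2) := by
    calc _ = (J + 1) * subBits n := by ring
      _ ≤ (subBits n + 2) * subBits n := Nat.mul_le_mul_right _ hJ
      _ = _ := mul_comm _ _
  refine eval_recordE h h1 (Ex.eval_add hi (Ex.eval_one h.wide.pos) (by omega))
    (Ex.eval_add (eval_idxBitsE h) (Ex.eval_mul hj (eval_subBitsE h) (by omega)) (by omega))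
    (eval_subBitsE h) (by unfold numRecs; omega) (by unfold recLen; omega) (by omega)
    hx fun l hl => ?_
  have h10 : idxBits n + J * subBits n + l - idxBits n = l + J * subBits n := by omega
  rw [recordBit, if_neg (by omega), if_pos (by omega), if_neg (by omega), Nat.add_sub_cancel, h10,
    Nat.add_mul_mod_self_right, Nat.mod_eq_of_lt hl, Nat.add_mul_div_right _ _ (by omega),
    Nat.div_eq_of_lt hl, zero_add]

theorem eval_blockE (h : Stores n w bits d) (h0 : ρ 0 = n) (h1 : ρ 1 = w) {b j : Ex} {I J : ℕ}
    (hb : b.eval w bits ρ = I) (hj : j.eval w bits ρ = J) (hI : I ≤ n / blockLen n)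
    (hJ : J < idxBits n) (hx : blockField n d I J < n) :
    (blockE b j).eval w bits ρ = blockField n d I J := by
  have h2 := h.wide.blocks_le
  have h5 := h.wide.sq_le
  have h6 := h.wide.le_sq
  have h7 := h.wide.size_lt
  have h8 := h.wide.idxBits_le
  have h9 : I * idxBits n + J < (n / blockLen n + 1) * idxBits n := by
    calc _ < I * idxBits n + idxBits n := by omega
      _ = (I + 1) * idxBits n := by ring
      _ ≤ _ := Nat.mul_le_mul_right _ (by omega)
  refine eval_recordE h h1 (Ex.eval_add (Ex.eval_add (Ex.eval_reg.trans h0)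
    (Ex.eval_two h.wide.one_lt) (by omega)) (Ex.eval_add (Ex.eval_mul hb (eval_idxBitsE h)
    (by omega)) hj (by omega)) (by omega)) Ex.eval_zero (eval_idxBitsE h)
    (by unfold numRecs; omega) (by unfold recLen; omega) (by omega)
    (hx.trans (lt_two_pow_idxBits n)) fun l hl => ?_
  have h10 : n + 2 + (I * idxBits n + J) - (n + 2) = J + I * idxBits n := by omega
  rw [recordBit, if_neg (by omega), if_neg (by omega), h10, zero_add,
    Nat.add_mul_mod_self_right, Nat.mod_eq_of_lt hJ, Nat.add_mul_div_right _ _ (by omega),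
    Nat.div_eq_of_lt hJ, zero_add]

end Access

end ArcCode

/-! ## Range maximum queries -/

namespace ArcCode

open WordRAM

/-- `r` is maximal on `S` at `x`. -/
def MaxAt (r : ℕ → ℕ) (S : Set ℕ) (x : ℕ) : Prop := x ∈ S ∧ ∀ y ∈ S, r y ≤ r x

/-- The two sets may overlap, which is what allows an interval to be covered by two windows of
power-of-two length. -/
theorem MaxAt.union {r : ℕ → ℕ} {S T : Set ℕ} {x y : ℕ} (hx : MaxAt r S x) (hy : MaxAt r T y) :
    MaxAt r (S ∪ T) (if r x < r y then y else x) := by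
  split_ifs with h
  · exact ⟨Or.inr hy.1, fun z hz => hz.elim (fun h1 => (hx.2 z h1).trans h.le) (hy.2 z)⟩
  · exact ⟨Or.inl hx.1, fun z hz => hz.elim (hx.2 z) fun h1 => (hy.2 z h1).trans (by omega)⟩

theorem maxAt_argMax (r : ℕ → ℕ) {s e : ℕ} (h : s < e) :
    MaxAt r (Set.Ico s e) (argMax r s e) := by
  rw [argMax, dif_pos h]
  have := (exists_argMax r h).choose_spec
  exact ⟨⟨this.1, this.2.1⟩, fun y hy => this.2.2 y hy.1 hy.2⟩

/-- The last point covered by `i`, on the unrolled cycle. -/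
def reachE (i : Ex) : Ex := i + coverE i

/-- The one of two positions that has the larger reach. -/
def betterE (x y : Ex) : Ex := .ite (.lt (reachE x) (reachE y)) y x

/-- The logarithm of a number. -/
def logE (i : Ex) : Ex := shortE i 0

/-- A position of maximal reach among the `2 ^ j` positions from `s` on. -/
def shortMaxE (s j : Ex) : Ex := s + shortE s (j + 1)

/-- The smaller one of two numbers. -/
def minE (a b : Ex) : Ex := .ite (.lt a b) a b

/-- A position of maximal reach in `[s, e)`, according to the short fields at both ends. -/
def endsMaxE (s e : Ex) : Ex :=
  betterE (shortMaxE s (minE (logE (e - s)) subBitsE))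
    (shortMaxE (e - .bin .shl 1 (minE (logE (e - s)) subBitsE)) (minE (logE (e - s)) subBitsE))

/-- A position of maximal reach in the blocks `b, …, b' - 1`. -/
def blocksMaxE (b b' : Ex) : Ex :=
  betterE (blockE b (logE (b' - b)))
    (blockE (b' - .bin .shl 1 (logE (b' - b))) (logE (b' - b)))

/-- The first block that starts at or after `s`. -/
def blockUpE (s : Ex) : Ex := (s + (blockLenE - 1)) / blockLenE

/-- A position of maximal reach in `[s, e)`. -/
def rangeMaxE (s e : Ex) : Ex :=
  .ite (.lt (blockUpE s) (e / blockLenE))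
    (betterE (endsMaxE s e) (blocksMaxE (blockUpE s) (e / blockLenE))) (endsMaxE s e)

section RangeMax

variable {n w : ℕ} {bits : List Bool} {d : ℕ → ℕ} {ρ : Fin 16 → ℕ}

theorem eval_reachE (h : Stores n w bits d) (h1 : ρ 1 = w) {i : Ex} {I : ℕ}
    (hi : i.eval w bits ρ = I) (hI : I < n) : (reachE i).eval w bits ρ = reach d I := by
  have := h.wide.size_lt
  have := h.cover_lt I hI
  exact Ex.eval_add hi (eval_coverE h h1 hi hI) (by omega)

theorem eval_betterE (h : Stores n w bits d) (h1 : ρ 1 = w) {a b : Ex} {x y : ℕ} {S T : Set ℕ}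
    (ha : a.eval w bits ρ = x) (hb : b.eval w bits ρ = y) (hx : MaxAt (reach d) S x)
    (hy : MaxAt (reach d) T y) (hxn : x < n) (hyn : y < n) :
    MaxAt (reach d) (S ∪ T) ((betterE a b).eval w bits ρ) := by
  rw [betterE, Ex.eval_ite (Ex.eval_lt_ne_zero (eval_reachE h h1 ha hxn) (eval_reachE h h1 hb hyn))
    (fun _ => hb) fun _ => ha]
  exact hx.union hy

theorem eval_minE {a b : Ex} {x y : ℕ} (ha : a.eval w bits ρ = x) (hb : b.eval w bits ρ = y) :
    (minE a b).eval w bits ρ = min x y := by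
  rw [minE, Ex.eval_ite (Ex.eval_lt_ne_zero ha hb) (fun _ => ha) fun _ => hb]
  split_ifs <;> omega

theorem log_lt_idxBits {n x : ℕ} (hx : x ≤ n) : Nat.log 2 x < idxBits n := by
  rcases Nat.eq_zero_or_pos x with rfl | h0
  · simpa using idxBits_pos n
  · exact Nat.log_lt_of_lt_pow h0.ne' (hx.trans_lt (lt_two_pow_idxBits n))

theorem idxBits_lt_two_pow_subBits (n : ℕ) : idxBits n < 2 ^ subBits n :=
  (idxBits_lt_two_pow n).trans_le (Nat.pow_le_pow_right (by omega) (by unfold subBits; omega))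

/-- Short field 0 tabulates the logarithm. Interval lengths go up to `n` itself, and therefore there
is also a record for the number `n`. -/
theorem eval_logE (h : Stores n w bits d) (h1 : ρ 1 = w) {i : Ex} {I : ℕ}
    (hi : i.eval w bits ρ = I) (hI : I ≤ n) : (logE i).eval w bits ρ = Nat.log 2 I :=
  eval_shortE h h1 hi Ex.eval_zero hI (by omega)
    ((log_lt_idxBits hI).trans (idxBits_lt_two_pow_subBits n))

theorem eval_shortMaxE (h : Stores n w bits d) (h1 : ρ 1 = w) {s j : Ex} {I J : ℕ}
    (hs : s.eval w bits ρ = I) (hj : j.eval w bits ρ = J) (hJ : J ≤ subBits n)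
    (hI : I + 2 ^ J ≤ n) :
    MaxAt (reach d) (Set.Ico I (I + 2 ^ J)) ((shortMaxE s j).eval w bits ρ) := by
  have h2 : 0 < 2 ^ J := by positivity
  have h3 := maxAt_argMax (reach d) (s := I) (e := I + 2 ^ J) (by omega)
  have h4 := h.wide.subBits_lt
  have h5 : w < 2 ^ w := Nat.lt_two_pow_self
  have h6 := h.wide.size_lt
  have h7 : shortField n d I (J + 1) = argMax (reach d) I (I + 2 ^ J) - I := by
    rw [shortField, min_eq_left hI]
  have h8 := h3.1.1
  have h9 := h3.1.2
  -- The stored offset is less than `2 ^ J`, so it fits into `subBits n` bits.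
  have h10 : 2 ^ J ≤ 2 ^ subBits n := Nat.pow_le_pow_right (by omega) hJ
  have e1 := eval_shortE h h1 hs (Ex.eval_add hj (Ex.eval_one h.wide.pos) (by omega)) (by omega)
    (by omega) (by rw [h7]; omega)
  rw [h7] at e1
  have e2 := Ex.eval_add hs e1 (by omega)
  rw [shortMaxE, e2, Nat.add_sub_cancel' h8]
  exact h3

theorem eval_blockE' (h : Stores n w bits d) (h0 : ρ 0 = n) (h1 : ρ 1 = w) {b j : Ex} {I J : ℕ}
    (hb : b.eval w bits ρ = I) (hj : j.eval w bits ρ = J) (hJ : J < idxBits n)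
    (hI : (I + 2 ^ J) * blockLen n ≤ n) :
    MaxAt (reach d) (Set.Ico (I * blockLen n) ((I + 2 ^ J) * blockLen n))
      ((blockE b j).eval w bits ρ) := by
  have h2 : 0 < 2 ^ J := by positivity
  have hB : 0 < blockLen n := by unfold blockLen; positivity
  have h3 := maxAt_argMax (reach d) (s := I * blockLen n) (e := (I + 2 ^ J) * blockLen n)
    (Nat.mul_lt_mul_of_pos_right (by omega) hB)
  have h7 : blockField n d I J =
      argMax (reach d) (I * blockLen n) ((I + 2 ^ J) * blockLen n) := by
    rw [blockField, min_eq_left hI]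
  rw [eval_blockE h h0 h1 hb hj ((Nat.le_div_iff_mul_le hB).2 (le_trans
    (Nat.mul_le_mul_right _ (by omega)) hI)) hJ (by rw [h7]; exact h3.1.2.trans_le hI), h7]
  exact h3

/-- `S` is the union of a window at the beginning and a window at the end, both of length `2 ^ j`.
If `j` is the logarithm of the length, they overlap and exhaust the interval; if `j` is cut off at
`subBits n`, each has length `blockLen n`. -/
theorem eval_endsMaxE (h : Stores n w bits d) (h1 : ρ 1 = w) {a b : Ex} {s e : ℕ}
    (ha : a.eval w bits ρ = s) (hb : b.eval w bits ρ = e) (hse : s < e) (he : e ≤ n) :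
    ∃ S, MaxAt (reach d) S ((endsMaxE a b).eval w bits ρ) ∧ S ⊆ Set.Ico s e ∧
      ∀ x ∈ Set.Ico s e, x < s + blockLen n ∨ e ≤ x + blockLen n → x ∈ S := by
  have h6 := h.wide.size_lt
  have h4 := h.wide.subBits_lt
  set j := min (Nat.log 2 (e - s)) (subBits n) with hj
  have e1 := Ex.eval_sub hb ha hse.le (by omega)
  have e2 : (minE (logE (b - a)) subBitsE).eval w bits ρ = j :=
    eval_minE (eval_logE h h1 e1 (by omega)) (eval_subBitsE h)
  have h2 : 2 ^ j ≤ e - s :=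
    (Nat.pow_le_pow_right (by omega) (min_le_left _ _)).trans (Nat.pow_log_le_self 2 (by omega))
  have e3 : (Ex.bin .shl 1 (minE (logE (b - a)) subBitsE)).eval w bits ρ = 1 * 2 ^ j :=
    Ex.eval_shl (Ex.eval_one h.wide.pos) e2 (by omega)
  have e4 := Ex.eval_sub hb e3 (by omega) (by omega)
  have hjs : j ≤ subBits n := min_le_right _ _
  have m1 := eval_shortMaxE h h1 ha e2 hjs (by omega)
  have m2 := eval_shortMaxE h h1 e4 e2 hjs (by omega)
  have h3 := m1.1.2
  have h5 := m2.1.2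
  refine ⟨_, eval_betterE h h1 rfl rfl m1 m2 (by omega) (by omega), ?_, ?_⟩
  · rintro x (hx | hx) <;> rw [Set.mem_Ico] at hx ⊢ <;> omega
  · intro x hx hx'
    rw [Set.mem_Ico] at hx
    rw [Set.mem_union, Set.mem_Ico, Set.mem_Ico]
    rcases le_total (Nat.log 2 (e - s)) (subBits n) with h7 | h7
    · have h8 : e - s < 2 ^ (j + 1) := by
        rw [hj, min_eq_left h7]; exact Nat.lt_pow_succ_log_self (by omega) _
      rw [pow_succ] at h8
      omega
    · have h8 : 2 ^ j = blockLen n := by rw [hj, min_eq_right h7, blockLen]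
      omega

/-- Two windows of `2 ^ j` blocks, where `j` is the logarithm of the number of blocks, together
exhaust the range, as more than half of it lies in each. -/
theorem eval_blocksMaxE (h : Stores n w bits d) (h0 : ρ 0 = n) (h1 : ρ 1 = w) {a b : Ex} {s e : ℕ}
    (ha : a.eval w bits ρ = s) (hb : b.eval w bits ρ = e) (hse : s < e) (he : e * blockLen n ≤ n) :
    MaxAt (reach d) (Set.Ico (s * blockLen n) (e * blockLen n)) ((blocksMaxE a b).eval w bits ρ) := by
  have h6 := h.wide.size_lt
  have hB : 0 < blockLen n := by unfold blockLen; positivity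
  have he' : e ≤ n := (Nat.le_mul_of_pos_right e hB).trans he
  set j := Nat.log 2 (e - s) with hj
  have e1 := Ex.eval_sub hb ha hse.le (by omega)
  have e2 : (logE (b - a)).eval w bits ρ = j := eval_logE h h1 e1 (by omega)
  have h2 : 2 ^ j ≤ e - s := Nat.pow_log_le_self 2 (by omega)
  have e3 : (Ex.bin .shl 1 (logE (b - a))).eval w bits ρ = 1 * 2 ^ j :=
    Ex.eval_shl (Ex.eval_one h.wide.pos) e2 (by omega)
  have e4 := Ex.eval_sub hb e3 (by omega) (by omega)
  have hji : j < idxBits n := log_lt_idxBits (by omega)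
  have h8 : e - s < 2 ^ (j + 1) := Nat.lt_pow_succ_log_self (by omega) _
  rw [pow_succ] at h8
  have h9 : (s + 2 ^ j) * blockLen n ≤ e * blockLen n := Nat.mul_le_mul_right _ (by omega)
  have h10 : s * blockLen n ≤ (e - 1 * 2 ^ j) * blockLen n := Nat.mul_le_mul_right _ (by omega)
  have h11 : (e - 1 * 2 ^ j) * blockLen n ≤ (s + 2 ^ j) * blockLen n :=
    Nat.mul_le_mul_right _ (by omega)
  have h12 : e - 1 * 2 ^ j + 2 ^ j = e := by omega
  have m1 := eval_blockE' h h0 h1 ha e2 hji (h9.trans he)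
  have m2 := eval_blockE' h h0 h1 e4 e2 hji (by rw [h12]; exact he)
  rw [h12] at m2
  have := eval_betterE h h1 rfl rfl m1 m2 (m1.1.2.trans_le (h9.trans he)) (m2.1.2.trans_le he)
  rwa [Set.Ico_union_Ico' h11 (h10.trans (h11.trans h9)), min_eq_left h10, max_eq_right h9] at this

/-- A position further than `blockLen n` from both ends lies in a block that is contained in `[s,
e)`. So the end windows and the full blocks together cover everything. -/
theorem eval_rangeMaxE (h : Stores n w bits d) (h0 : ρ 0 = n) (h1 : ρ 1 = w) {a b : Ex} {s e : ℕ}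
    (ha : a.eval w bits ρ = s) (hb : b.eval w bits ρ = e) (hse : s < e) (he : e ≤ n) :
    MaxAt (reach d) (Set.Ico s e) ((rangeMaxE a b).eval w bits ρ) := by
  have h6 := h.wide.size_lt
  have h5 := h.wide.sq_le
  have h4 := h.wide.blockLen_le
  have hB : 0 < blockLen n := by unfold blockLen; positivity
  have e1 : (blockUpE a).eval w bits ρ = (s + (blockLen n - 1)) / blockLen n :=
    Ex.eval_div (Ex.eval_add ha (Ex.eval_sub (eval_blockLenE h) (Ex.eval_one h.wide.pos)
      (by omega) (by omega)) (by omega)) (eval_blockLenE h)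
  have e2 : (b / blockLenE).eval w bits ρ = e / blockLen n := Ex.eval_div hb (eval_blockLenE h)
  set b₀ := (s + (blockLen n - 1)) / blockLen n with hb0
  set b₁ := e / blockLen n with hb1
  obtain ⟨S, m1, hS, hS'⟩ := eval_endsMaxE h h1 ha hb hse he
  have h7 := hS m1.1
  rw [Set.mem_Ico] at h7
  have l1 := Nat.div_add_mod e (blockLen n)
  have l2 := Nat.mod_lt e hB
  have l3 := Nat.div_add_mod (s + (blockLen n - 1)) (blockLen n)
  have l4 := Nat.mod_lt (s + (blockLen n - 1)) hB
  rw [← hb1, mul_comm] at l1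
  rw [← hb0, mul_comm] at l3
  rw [rangeMaxE, Ex.eval_ite (Ex.eval_lt_ne_zero e1 e2) (fun _ => rfl) fun _ => rfl]
  split_ifs with hlt
  · have m2 := eval_blocksMaxE h h0 h1 e1 e2 hlt (by omega)
    have h8 := m2.1
    rw [Set.mem_Ico] at h8
    have m3 := eval_betterE h h1 rfl rfl m1 m2 (by omega) (by omega)
    convert m3 using 1
    ext x
    constructor
    · intro hx
      by_cases hx' : x < s + blockLen n ∨ e ≤ x + blockLen n
      · exact Or.inl (hS' x hx hx')
      · refine Or.inr ?_
        rw [Set.mem_Ico]; omega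
    · rintro (hx | hx)
      · exact hS hx
      · rw [Set.mem_Ico] at hx ⊢; omega
  -- Without a full block in between, every position is within `blockLen n` of one of the ends.
  · have h8 := Nat.mul_le_mul_right (blockLen n) (not_lt.1 hlt)
    convert m1 using 1
    refine Set.Subset.antisymm (fun x hx => hS' x hx ?_) hS
    rw [Set.mem_Ico] at hx
    omega

end RangeMax

/-! ## Adjacency and degree -/

/-- Whether the vertex at `u` covers the point `v`. -/
def coversE (u v : Ex) : Ex := .lt ((v + .reg 0 - u) % .reg 0) (coverE u + 1)

/-- The answer to an adjacency query. -/
def adjacentE : Ex :=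
  .ite (.bin .eq (.reg 2) (.reg 3)) 0
    (.ite (coversE (.reg 2) (.reg 3)) 1 (.ite (coversE (.reg 3) (.reg 2)) 1 0))

/-- The answer to a degree query. -/
def degreeE : Ex :=
  .field (numRecsE / .reg 1 * recLenE + .reg 2 / .reg 1 * (idxBitsE - 1))
    (numRecsE % .reg 1 * recLenE + .reg 2 % .reg 1 * (idxBitsE - 1)) (idxBitsE - 1)

/-- The table of the degrees `f 0, …, f (n - 1)`. -/
def degreeTable (n : ℕ) (f : ℕ → ℕ) : List Bool :=
  (List.range (n * Nat.clog 2 n)).map fun p => (f (p / Nat.clog 2 n)).testBit (p % Nat.clog 2 n)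

theorem eval_coversE {n w : ℕ} {bits : List Bool} {d : ℕ → ℕ} {ρ : Fin 16 → ℕ}
    (h : Stores n w bits d) (h0 : ρ 0 = n) (h1 : ρ 1 = w) {a b : Ex} {u v : ℕ}
    (ha : a.eval w bits ρ = u) (hb : b.eval w bits ρ = v) (hu : u < n) (hv : v < n) :
    (coversE a b).eval w bits ρ ≠ 0 ↔ cycDist n u v ≤ d u := by
  have h6 := h.wide.size_lt
  have hd := h.cover_lt u hu
  rw [coversE, Ex.eval_lt_ne_zero (Ex.eval_mod (Ex.eval_sub (Ex.eval_add hb (Ex.eval_reg.trans h0)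
    (by omega)) ha (by omega) (by omega)) (Ex.eval_reg.trans h0))
    (Ex.eval_add (eval_coverE h h1 ha hu) (Ex.eval_one h.wide.pos) (by omega))]
  exact Nat.lt_succ_iff

theorem answersAdjacent {V : Type*} {G : SimpleGraph V} {n : ℕ} {e : V ≃ Fin n} {d : ℕ → ℕ}
    (hG : IsCyclicModel G e d) {w : ℕ} {bits : List Bool} (h : Stores n w bits d) {C : ℕ}
    (hC : adjacentE.cost + 1 ≤ C) : AnswersAdjacent G e w bits (.print adjacentE) C := by
  intro u v
  obtain ⟨t, ht, hc⟩ := (Reaches.print (w := w) (bits := bits)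
    (σ := View.init [n, w, e u, e v]) adjacentE).computes
  refine ⟨t, _, hc, ht.trans hC, ?_⟩
  set ρ := (View.init [n, w, e u, e v]).reg with hρ
  have h0 : ρ 0 = n := rfl
  have h1 : ρ 1 = w := rfl
  have h2 : ρ 2 = e u := rfl
  have h3 : ρ 3 = e v := rfl
  have c1 := eval_coversE (a := .reg 2) (b := .reg 3) h h0 h1 h2 h3 (e u).2 (e v).2
  have c2 := eval_coversE (a := .reg 3) (b := .reg 2) h h0 h1 h3 h2 (e v).2 (e u).2
  have c3 : (Ex.bin .eq (.reg 2) (.reg 3)).eval w bits ρ ≠ 0 ↔ u = v := by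
    show (if ρ 2 = ρ 3 then 1 else 0) ≠ 0 ↔ _
    rw [h2, h3]
    by_cases huv : u = v
    · simp [huv]
    · have : (e u : ℕ) ≠ e v := fun h => huv (e.injective (Fin.ext h))
      simp [huv, this]
  have := h.wide.pos
  classical
  have key : adjacentE.eval w bits ρ = if G.Adj u v then 1 else 0 := by
    rw [adjacentE, Ex.eval_ite c3 (fun _ => Ex.eval_zero) fun _ =>
      Ex.eval_ite c1 (fun _ => Ex.eval_one this) fun _ =>
      Ex.eval_ite c2 (fun _ => Ex.eval_one this) fun _ => Ex.eval_zero, hG.2]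
    split_ifs <;> tauto
  rw [key]
  exact ⟨fun h => if_pos h, fun h => if_neg h⟩

/-- The degree table follows the last record immediately. Its start and the offset of entry `v` are
each split into whole words and remaining bits, as in `eval_recordE`. -/
theorem eval_degreeE {n w : ℕ} {bits : List Bool} {d f : ℕ → ℕ} {ρ : Fin 16 → ℕ}
    (h : Stores n w bits d) (h0 : ρ 0 = n) (h1 : ρ 1 = w) {v : ℕ} (h2 : ρ 2 = v) (hv : v < n)
    (hf : f v < 2 ^ Nat.clog 2 n) (hD : ∀ p < n * Nat.clog 2 n,
      bits.getD (numRecs n * recLen n + p) false =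
        (f (p / Nat.clog 2 n)).testBit (p % Nat.clog 2 n)) :
    degreeE.eval w bits ρ = f v := by
  have l1 := h.wide.size_lt
  have l2 := h.wide.sq_le
  have l3 := h.wide.le_sq
  have l4 := h.wide.idxBits_le
  have l5 := h.wide.numRecs_le
  have l6 := div_mul_le h.wide (i := numRecs n)
  have l7 := mod_mul_le h.wide (i := numRecs n)
  have hk : idxBits n - 1 = Nat.clog 2 n := rfl
  set k := Nat.clog 2 n
  have l8 : v / w * k ≤ v :=
    (Nat.mul_le_mul_left _ (by omega)).trans (Nat.div_mul_le_self v w)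
  have l9 : v % w * k ≤ w * w := Nat.mul_le_mul (Nat.mod_lt _ h.wide.pos).le (by omega)
  have ek : (idxBitsE - 1).eval w bits ρ = k :=
    Ex.eval_sub (eval_idxBitsE h) (Ex.eval_one h.wide.pos) (idxBits_pos n) (by omega)
  have l10 : (numRecs n % w * recLen n + v % w * k) / w ≤ 4 * w := by
    rw [Nat.div_le_iff_le_mul_add_pred h.wide.pos]
    have : w * (4 * w) = 4 * (w * w) := by ring
    omega
  refine Ex.eval_field h1 (Ex.eval_add (Ex.eval_mul (Ex.eval_div (eval_numRecsE h h0)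
    (Ex.eval_reg.trans h1)) (eval_recLenE h) (by omega)) (Ex.eval_mul (Ex.eval_div
    (Ex.eval_reg.trans h2) (Ex.eval_reg.trans h1)) ek (by omega)) (by omega))
    (Ex.eval_add (Ex.eval_mul (Ex.eval_mod (eval_numRecsE h h0)
    (Ex.eval_reg.trans h1)) (eval_recLenE h) (by omega)) (Ex.eval_mul (Ex.eval_mod
    (Ex.eval_reg.trans h2) (Ex.eval_reg.trans h1)) ek (by omega)) (by omega)) ek (by omega)
    (by omega) hf fun j hj => ?_
  have e1 := hD (j + v * k) (by
    calc _ < k + v * k := by omega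
      _ = (v + 1) * k := by ring
      _ ≤ _ := Nat.mul_le_mul_right _ hv)
  rw [Nat.add_mul_mod_self_right, Nat.mod_eq_of_lt hj, Nat.add_mul_div_right _ _ (by omega),
    Nat.div_eq_of_lt hj, zero_add] at e1
  rw [← e1]
  congr 1
  have r1 := Nat.div_add_mod (numRecs n) w
  have r2 := Nat.div_add_mod v w
  calc _ = (w * (numRecs n / w) + numRecs n % w) * recLen n + (j + (w * (v / w) + v % w) * k) := by
        ring
    _ = _ := by rw [r1, r2]

theorem answersDegree {V : Type*} {G : SimpleGraph V} {n : ℕ} {e : V ≃ Fin n} {d f : ℕ → ℕ}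
    {w : ℕ} {bits : List Bool} (h : Stores n w bits d) {C : ℕ} (hC : degreeE.cost + 1 ≤ C)
    (hf : ∀ v : V, f (e v) = (G.neighborSet v).ncard)
    (hD : ∀ p < n * Nat.clog 2 n, bits.getD (numRecs n * recLen n + p) false =
      (f (p / Nat.clog 2 n)).testBit (p % Nat.clog 2 n)) :
    AnswersDegree G e w bits (.print degreeE) C := by
  intro v
  obtain ⟨t, ht, hc⟩ := (Reaches.print (w := w) (bits := bits)
    (σ := View.init [n, w, e v]) degreeE).computes
  -- A vertex is not its own neighbour, so its degree is at most `n - 1`; this is why `Nat.clog 2 n`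
  -- bits suffice.
  have hlt : f (e v) < 2 ^ Nat.clog 2 n := by
    rw [hf]
    refine lt_of_lt_of_le ?_ (Nat.le_pow_clog (by norm_num) n)
    have : Finite V := .of_equiv _ e.symm
    calc _ < (Set.univ : Set V).ncard := Set.ncard_lt_ncard
          ⟨Set.subset_univ _, fun hsub => G.loopless.irrefl v (hsub (Set.mem_univ v))⟩
      _ = n := by rw [Set.ncard_univ, Nat.card_congr e, Nat.card_fin]
  have := eval_degreeE h (v := (e v : ℕ)) (ρ := (View.init [n, w, e v]).reg) rfl rfl rfl (e v).2 hlt hD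
  refine ⟨t, ?_, ht.trans hC⟩
  rw [hf] at this
  rw [← this]
  exact hc

end ArcCode

/-! ## Straight-line programs -/

namespace WordRAM

/-- A program without loops. -/
def Cmd.LoopFree : Cmd → Prop
  | .seq p q => p.LoopFree ∧ q.LoopFree
  | .ite _ p q => p.LoopFree ∧ q.LoopFree
  | .loop _ _ => False
  | _ => True

/-- A bound on the running time of a program without loops. -/
def Cmd.bound : Cmd → ℕ
  | .seq p q => p.bound + q.bound
  | .ite _ p q => p.bound + q.bound + 1
  | _ => 1

/-- Straight-line code has a time bound that depends on the program alone. The explicit step counts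
that arise from composition can thus be discarded. -/
theorem Exec.le_bound {w : ℕ} {bits : List Bool} {p : Cmd} {s s' : State} {t : ℕ}
    (h : Exec w bits p s s' t) : p.LoopFree → t ≤ p.bound := by
  induction h with
  | seq _ _ h1 h2 => intro h; have := h1 h.1; have := h2 h.2; simp only [Cmd.bound]; omega
  | iteTrue _ _ h1 => intro h; have := h1 h.1; simp only [Cmd.bound]; omega
  | iteFalse _ _ h1 => intro h; have := h1 h.2; simp only [Cmd.bound]; omega
  | loopTrue => intro h; exact h.elim
  | loopFalse => intro h; exact h.elim
  | _ => intro _; exact le_rfl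

theorem Ex.loopFree_compile (e : Ex) : ∀ r, (e.compile r).LoopFree := by
  induction e with
  | reg => exact fun _ => trivial
  | const => exact fun _ => trivial
  | bin op a b iha ihb => exact fun r => ⟨iha r, ihb _, trivial⟩
  | data a ih => exact fun r => ⟨ih r, trivial⟩
  | ite c a b ihc iha ihb => exact fun r => ⟨ihc r, iha r, ihb r⟩

theorem Cmd.loopFree_assign (r : Fin 16) (e : Ex) : (Cmd.assign r e).LoopFree :=
  ⟨e.loopFree_compile _, trivial⟩

theorem Cmd.loopFree_fetch (r : Fin 16) (e : Ex) : (Cmd.fetch r e).LoopFree :=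
  ⟨e.loopFree_compile _, trivial⟩

theorem Cmd.loopFree_put (a b : Ex) : (Cmd.put a b).LoopFree :=
  ⟨a.loopFree_compile _, b.loopFree_compile _, trivial⟩

theorem Cmd.loopFree_print (e : Ex) : (Cmd.print e).LoopFree := ⟨e.loopFree_compile _, trivial⟩

theorem Cmd.loopFree_seq {p q : Cmd} (hp : p.LoopFree) (hq : q.LoopFree) :
    (Cmd.seq p q).LoopFree := ⟨hp, hq⟩

theorem Cmd.loopFree_cond {e : Ex} {p q : Cmd} (hp : p.LoopFree) (hq : q.LoopFree) :
    (Cmd.cond e p q).LoopFree := ⟨e.loopFree_compile _, hp, hq⟩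

theorem Reaches.to_bound {w : ℕ} {bits : List Bool} {p : Cmd} {σ σ' : View} {t : ℕ}
    (h : Reaches w bits p σ σ' t) (hp : p.LoopFree) : Reaches w bits p σ σ' p.bound :=
  fun s hs => let ⟨s', u, h1, _, h3⟩ := h s hs; ⟨s', u, h1, h1.le_bound hp, h3⟩

namespace Reaches

variable {w : ℕ} {bits : List Bool} {σ : View} {e a b : Ex} {x y : ℕ}

theorem assign_eq (r : Fin 16) (he : e.eval w bits σ.reg = x) :
    Reaches w bits (.assign r e) σ (σ.set r x) (e.cost + 1) := he ▸ assign r e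

theorem fetch_eq (r : Fin 16) (he : e.eval w bits σ.reg = x) (hx : σ.mem x = y) :
    Reaches w bits (.fetch r e) σ (σ.set r y) (e.cost + 1) := by
  subst he hx; exact fetch r e

theorem put_eq (ha : a.eval w bits σ.reg = x) (hb : b.eval w bits σ.reg = y) :
    Reaches w bits (.put a b) σ { σ with mem := Function.update σ.mem x y }
      (a.cost + b.cost + 1) := by
  subst ha hb; exact put a b

theorem print_eq (he : e.eval w bits σ.reg = x) :
    Reaches w bits (.print e) σ { σ with out := σ.out ++ [x] } (e.cost + 1) := by
  subst he; exact print e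

end Reaches

@[simp] theorem View.reg_set (σ : View) (r i : Fin 16) (x : ℕ) :
    (σ.set r x).reg i = if i = r then x else σ.reg i := by
  simp [View.set, Function.update_apply]

@[simp] theorem View.mem_set (σ : View) (r : Fin 16) (x : ℕ) : (σ.set r x).mem = σ.mem := rfl

@[simp] theorem View.out_set (σ : View) (r : Fin 16) (x : ℕ) : (σ.set r x).out = σ.out := rfl

end WordRAM

/-! ## Neighborhood queries -/

namespace ArcCode

open WordRAM

/-- Report the next point covered by `v`. -/
def coverStep : Cmd :=
  .seq (.assign 4 (.reg 4 + 1)) (.print ((.reg 2 + .reg 4) % .reg 0))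

/-- Report a vertex of maximal reach in the interval on top of the stack if it covers `v`, and
replace the interval by the two remaining parts. -/
def stackStep : Cmd :=
  .seq (.fetch 6 (.reg 5 - 2)) <| .seq (.fetch 7 (.reg 5 - 1)) <| .seq (.assign 5 (.reg 5 - 2)) <|
  .cond (.lt (.reg 6) (.reg 7))
    (.seq (.assign 8 (rangeMaxE (.reg 6) (.reg 7))) <|
      .cond (coversE (.reg 8) (.reg 2))
        (.seq (.print (.reg 8)) <| .seq (.put (.reg 5) (.reg 6)) <|
          .seq (.put (.reg 5 + 1) (.reg 8)) <| .seq (.put (.reg 5 + 2) (.reg 8 + 1)) <|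
          .seq (.put (.reg 5 + 2 + 1) (.reg 7)) (.assign 5 (.reg 5 + 2 + 2)))
        .skip)
    .skip

/-- Preparations for the report of the covered points. -/
def coverInit : Cmd := .assign 3 (coverE (.reg 2))

/-- Put the two intervals of points not covered by `v` on the stack. -/
def stackInit : Cmd :=
  .seq (.put 0 (.ite (.lt (.reg 2 + .reg 3) (.reg 0)) 0 (.reg 2 + .reg 3 + 1 - .reg 0))) <|
  .seq (.put 1 (.reg 2)) <| .seq (.put 2 (minE (.reg 2 + .reg 3 + 1) (.reg 0))) <|
  .seq (.put (2 + 1) (.reg 0)) (.assign 5 (2 + 2))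

/-- The program for neighborhood queries. -/
def neighborhoodProg : Cmd :=
  .seq coverInit <| .seq (.repeatWhile (.lt (.reg 4) (.reg 3)) coverStep) <|
    .seq stackInit (.repeatWhile (.reg 5) stackStep)

theorem loopFree_stackStep : stackStep.LoopFree := by
  repeat' first
    | exact Cmd.loopFree_assign _ _ | exact Cmd.loopFree_fetch _ _ | exact Cmd.loopFree_put _ _
    | exact Cmd.loopFree_print _ | exact trivial
    | apply Cmd.loopFree_cond | apply Cmd.loopFree_seq

theorem loopFree_coverStep : coverStep.LoopFree :=
  Cmd.loopFree_seq (Cmd.loopFree_assign _ _) (Cmd.loopFree_print _)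

theorem loopFree_stackInit : stackInit.LoopFree := by
  repeat' first
    | exact Cmd.loopFree_assign _ _ | exact Cmd.loopFree_put _ _
    | apply Cmd.loopFree_seq

/-- The vertex at `x` covers the point `v`. -/
def Covers (n : ℕ) (d : ℕ → ℕ) (x v : ℕ) : Prop := cycDist n x v ≤ d x

/-- For `x` before `v`, covering `v` means `v ≤ reach d x`; for `x` after `v` it means `v + n ≤
reach d x`. An interval that avoids `v` lies on one side, so a single threshold decides. -/
theorem not_covers_of_maxAt {n : ℕ} {d : ℕ → ℕ} {s e m v : ℕ} (hv : v < n) (he : e ≤ n)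
    (hsv : e ≤ v ∨ v < s) (hm : MaxAt (reach d) (Set.Ico s e) m) (h : ¬ Covers n d m v) :
    ∀ x, s ≤ x → x < e → ¬ Covers n d x v := by
  intro x hx1 hx2 hx
  have h1 := hm.2 x ⟨hx1, hx2⟩
  have h2 := hm.1.1
  have h3 := hm.1.2
  unfold Covers at h hx
  unfold reach at h1
  rcases hsv with hsv | hsv
  · rw [cycDist_of_le hv (by omega)] at h hx
    omega
  · rw [cycDist_of_lt (by omega) (by omega)] at h hx
    omega

section Neighborhood

variable {n w : ℕ} {bits : List Bool} {d : ℕ → ℕ}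

/-- The registers that hold the query. -/
structure Query (n w v : ℕ) (σ : View) : Prop where
  reg0 : σ.reg 0 = n
  reg1 : σ.reg 1 = w
  reg2 : σ.reg 2 = v

/-- Either the maximum is reported and two intervals replace one, or the interval is dropped. The
second alternative also serves empty intervals. -/
theorem stackStep_spec (h : Stores n w bits d) {v sp s e : ℕ} (hv : v < n) {σ : View}
    (hq : Query n w v σ) (hsp : σ.reg 5 = sp + 2) (hs : σ.mem sp = s) (he : σ.mem (sp + 1) = e)
    (hen : e ≤ n) (hlt : sp + 4 < 2 ^ w) :
    (s < e ∧ ∃ m σ', MaxAt (reach d) (Set.Ico s e) m ∧ Covers n d m v ∧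
      Reaches w bits stackStep σ σ' stackStep.bound ∧ Query n w v σ' ∧ σ'.reg 5 = sp + 4 ∧
      σ'.mem sp = s ∧ σ'.mem (sp + 1) = m ∧ σ'.mem (sp + 2) = m + 1 ∧ σ'.mem (sp + 3) = e ∧
      (∀ i < sp, σ'.mem i = σ.mem i) ∧ σ'.out = σ.out ++ [m]) ∨
    ((s < e → ∃ m, MaxAt (reach d) (Set.Ico s e) m ∧ ¬ Covers n d m v) ∧ ∃ σ',
      Reaches w bits stackStep σ σ' stackStep.bound ∧ Query n w v σ' ∧ σ'.reg 5 = sp ∧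
      σ'.mem = σ.mem ∧ σ'.out = σ.out) := by
  have hwp := h.wide.pos
  have hw1 := h.wide.one_lt
  have hn := h.wide.size_lt
  have f1 : Reaches w bits (.fetch 6 (.reg 5 - 2)) σ (σ.set 6 s) _ :=
    Reaches.fetch_eq 6 (Ex.eval_sub (Ex.eval_reg.trans hsp) (Ex.eval_two hw1) (by omega) (by omega))
      hs
  have f2 : Reaches w bits (.fetch 7 (.reg 5 - 1)) (σ.set 6 s) ((σ.set 6 s).set 7 e) _ :=
    Reaches.fetch_eq 7 (Ex.eval_sub (x := sp + 2) (by simp [Ex.eval_reg, hsp]) (Ex.eval_one hwp)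
      (by omega) (by omega)) he
  have f3 : Reaches w bits (.assign 5 (.reg 5 - 2)) ((σ.set 6 s).set 7 e)
      (((σ.set 6 s).set 7 e).set 5 sp) _ :=
    Reaches.assign_eq 5 (Ex.eval_sub (x := sp + 2) (by simp [Ex.eval_reg, hsp]) (Ex.eval_two hw1)
      (by omega) (by omega))
  set σ₁ := ((σ.set 6 s).set 7 e).set 5 sp with hσ₁
  have q0 : σ₁.reg 0 = n := by simp [hσ₁, hq.reg0]
  have q1 : σ₁.reg 1 = w := by simp [hσ₁, hq.reg1]
  have q2 : σ₁.reg 2 = v := by simp [hσ₁, hq.reg2]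
  have q5 : σ₁.reg 5 = sp := by simp [hσ₁]
  have q6 : σ₁.reg 6 = s := by simp [hσ₁]
  have q7 : σ₁.reg 7 = e := by simp [hσ₁]
  have c1 : (Ex.lt (.reg 6) (.reg 7)).eval w bits σ₁.reg ≠ 0 ↔ s < e := Ex.eval_lt_ne_zero q6 q7
  by_cases hse : s < e
  swap
  · refine Or.inr ⟨fun h => absurd h hse, σ₁, ?_, ⟨q0, q1, q2⟩, q5, rfl, rfl⟩
    exact (f1.seq (f2.seq (f3.seq (.cond_false (by simpa using mt c1.1 hse) .skip)))).to_bound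
      loopFree_stackStep
  have hmax := eval_rangeMaxE h q0 q1 (a := .reg 6) (b := .reg 7) q6 q7 hse hen
  set m := (rangeMaxE (.reg 6) (.reg 7)).eval w bits σ₁.reg with hm
  have hmn : m < n := hmax.1.2.trans_le hen
  have f4 : Reaches w bits (.assign 8 (rangeMaxE (.reg 6) (.reg 7))) σ₁ (σ₁.set 8 m) _ :=
    Reaches.assign_eq 8 rfl
  set σ₂ := σ₁.set 8 m with hσ₂
  have p0 : σ₂.reg 0 = n := by simp [hσ₂, q0]
  have p1 : σ₂.reg 1 = w := by simp [hσ₂, q1]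
  have p2 : σ₂.reg 2 = v := by simp [hσ₂, q2]
  have p5 : σ₂.reg 5 = sp := by simp [hσ₂, q5]
  have p6 : σ₂.reg 6 = s := by simp [hσ₂, q6]
  have p7 : σ₂.reg 7 = e := by simp [hσ₂, q7]
  have p8 : σ₂.reg 8 = m := by simp [hσ₂]
  have c2 := eval_coversE (a := .reg 8) (b := .reg 2) h p0 p1 p8 p2 hmn hv
  by_cases hc : Covers n d m v
  swap
  · refine Or.inr ⟨fun _ => ⟨m, hmax, hc⟩, σ₂, ?_, ⟨p0, p1, p2⟩, p5, rfl, rfl⟩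
    exact (f1.seq (f2.seq (f3.seq (.cond_true (c1.2 hse) (f4.seq
      (.cond_false (by simpa using mt c2.1 hc) .skip)))))).to_bound loopFree_stackStep
  have e5 : (Ex.reg 5).eval w bits σ₂.reg = sp := p5
  have e8 : (Ex.reg 8).eval w bits σ₂.reg = m := p8
  have e2 : (Ex.reg 5 + 2).eval w bits σ₂.reg = sp + 2 :=
    Ex.eval_add e5 (Ex.eval_two hw1) (by omega)
  have g1 : Reaches w bits (.print (.reg 8)) σ₂ ⟨σ₂.reg, σ₂.mem, σ₂.out ++ [m]⟩ _ :=
    Reaches.print_eq p8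
  have g2 : Reaches w bits (.put (.reg 5) (.reg 6)) ⟨σ₂.reg, σ₂.mem, σ₂.out ++ [m]⟩
      ⟨σ₂.reg, _, σ₂.out ++ [m]⟩ _ := Reaches.put_eq p5 p6
  have g3 := Reaches.put_eq (a := .reg 5 + 1) (b := .reg 8) (w := w) (bits := bits)
    (σ := ⟨σ₂.reg, Function.update σ₂.mem sp s, σ₂.out ++ [m]⟩)
    (Ex.eval_add e5 (Ex.eval_one hwp) (by omega)) p8
  have g4 := Reaches.put_eq (a := .reg 5 + 2) (b := .reg 8 + 1) (w := w) (bits := bits)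
    (σ := ⟨σ₂.reg, Function.update (Function.update σ₂.mem sp s) (sp + 1) m, σ₂.out ++ [m]⟩)
    e2 (Ex.eval_add e8 (Ex.eval_one hwp) (by omega))
  have g5 := Reaches.put_eq (a := .reg 5 + 2 + 1) (b := .reg 7) (w := w) (bits := bits)
    (σ := ⟨σ₂.reg, Function.update (Function.update (Function.update σ₂.mem sp s) (sp + 1) m)
      (sp + 2) (m + 1), σ₂.out ++ [m]⟩)
    (Ex.eval_add e2 (Ex.eval_one hwp) (by omega)) p7
  have g6 := Reaches.assign_eq 5 (e := .reg 5 + 2 + 2) (w := w) (bits := bits)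
    (σ := ⟨σ₂.reg, Function.update (Function.update (Function.update (Function.update σ₂.mem sp s)
      (sp + 1) m) (sp + 2) (m + 1)) (sp + 2 + 1) e, σ₂.out ++ [m]⟩)
    (Ex.eval_add e2 (Ex.eval_two hw1) (by omega))
  refine Or.inl ⟨hse, m, _, hmax, hc, (f1.seq (f2.seq (f3.seq (.cond_true (c1.2 hse) (f4.seq
      (.cond_true (c2.2 hc) (g1.seq (g2.seq (g3.seq (g4.seq (g5.seq g6))))))))))).to_bound
      loopFree_stackStep, ⟨?_, ?_, ?_⟩, ?_, ?_, ?_, ?_, ?_, ?_, ?_⟩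
  · simpa using p0
  · simpa using p1
  · simpa using p2
  · simp
  · simp [Function.update_apply]; omega
  · simp
  · simp
  · simp
  · intro i hi
    have a1 : i ≠ sp := by omega
    have a2 : i ≠ sp + 1 := by omega
    have a3 : i ≠ sp + 2 := by omega
    have a4 : i ≠ sp + 2 + 1 := by omega
    simp [a1, a2, a3, a4, hσ₂, hσ₁]
  · simp [hσ₂, hσ₁]

/-- The time spent on one stack item. -/
def stackCost : ℕ := (Ex.reg 5).cost + stackStep.bound + 1

/-- Processing an interval on top of the stack reports the vertices of the interval that
cover `v`. -/
theorem stack_spec (h : Stores n w bits d) {v : ℕ} (hv : v < n) (k : ℕ) :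
    ∀ (sp s e : ℕ) (σ : View), e - s ≤ k → Query n w v σ → σ.reg 5 = sp + 2 → σ.mem sp = s →
      σ.mem (sp + 1) = e → e ≤ n → (e ≤ v ∨ v < s) → sp + 2 * (e - s) + 4 < 2 ^ w →
      ∃ (l : List ℕ) (σ' : View), l.Nodup ∧ (∀ x, x ∈ l ↔ s ≤ x ∧ x < e ∧ Covers n d x v) ∧
        Query n w v σ' ∧ σ'.reg 5 = sp ∧ (∀ i < sp, σ'.mem i = σ.mem i) ∧
        σ'.out = σ.out ++ l ∧
        ∀ σ'' t, Reaches w bits (.repeatWhile (.reg 5) stackStep) σ' σ'' t →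
          Reaches w bits (.repeatWhile (.reg 5) stackStep) σ σ''
            (stackCost * (2 * l.length + 1) + t) := by
  -- The time bound is stated for an arbitrary continuation `σ''`, because the loop does not stop
  -- when this interval is finished but goes on with the rest of the stack. A split moves the stack
  -- up by two cells and shortens the interval, which bounds all addresses by `sp + 2 * (e - s) +
  -- 4`.
  induction k with
  | zero =>
    intro sp s e σ hk hq hsp hs he hen hsv hlt
    rcases stackStep_spec h hv hq hsp hs he hen (by omega) with ⟨hse, -⟩ | ⟨-, σ', hr, hq', h5, hm, ho⟩
    · omega
    · refine ⟨[], σ', by simp, fun x => ?_, hq', h5, fun i _ => by rw [hm], by simp [ho], ?_⟩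
      · simp; omega
      · intro σ'' t ht
        exact (Reaches.while_true (by rw [Ex.eval_reg, hsp]; omega) hr ht).mono
          (by simp [stackCost])
  | succ k ih =>
    intro sp s e σ hk hq hsp hs he hen hsv hlt
    rcases stackStep_spec h hv hq hsp hs he hen (by omega) with
      ⟨hse, m, σ₁, hm, hc, hr, hq₁, h5, m0, m1, m2, m3, hmem, ho⟩ | ⟨hno, σ', hr, hq', h5, hm, ho⟩
    · have hm1 := hm.1.1
      have hm2 := hm.1.2
      -- The right part lies on top and is processed first; cells below it are untouched, so the
      -- left part is still there afterwards.
      obtain ⟨l₁, σ₂, hl₁, hx₁, hq₂, h5₂, hmem₂, ho₂, ht₂⟩ :=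
        ih (sp + 2) (m + 1) e σ₁ (by omega) hq₁ h5 m2 m3 hen (by omega) (by omega)
      obtain ⟨l₂, σ₃, hl₂, hx₂, hq₃, h5₃, hmem₃, ho₃, ht₃⟩ :=
        ih sp s m σ₂ (by omega) hq₂ h5₂ (by rw [hmem₂ _ (by omega), m0])
          (by rw [hmem₂ _ (by omega), m1]) (by omega) (by omega) (by omega)
      refine ⟨m :: (l₁ ++ l₂), σ₃, ?_, fun x => ?_, hq₃, h5₃, fun i hi => ?_, ?_, ?_⟩
      · rw [List.nodup_cons, List.nodup_append, List.mem_append]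
        refine ⟨?_, hl₁, hl₂, ?_⟩
        · rw [hx₁, hx₂]; omega
        · intro a ha b hb hab
          rw [hx₁] at ha; rw [hx₂] at hb; omega
      · rw [List.mem_cons, List.mem_append, hx₁, hx₂]
        constructor
        · rintro (rfl | ⟨a, b, c⟩ | ⟨a, b, c⟩)
          · exact ⟨hm1, hm2, hc⟩
          · exact ⟨by omega, b, c⟩
          · exact ⟨a, by omega, c⟩
        · rintro ⟨a, b, c⟩
          rcases lt_trichotomy x m with h1 | h1 | h1
          · exact Or.inr (Or.inr ⟨a, h1, c⟩)
          · exact Or.inl h1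
          · exact Or.inr (Or.inl ⟨h1, b, c⟩)
      · rw [hmem₃ i hi, hmem₂ i (by omega), hmem i hi]
      · rw [ho₃, ho₂, ho]; simp
      · intro σ'' t ht
        -- Reported vertices are the inner nodes of a binary tree whose leaves are the dropped
        -- intervals; hence the number `2 * l.length + 1` of iterations.
        refine (Reaches.while_true (by rw [Ex.eval_reg, hsp]; omega) hr
          (ht₂ _ _ (ht₃ _ _ ht))).mono ?_
        rw [← stackCost, List.length_cons, List.length_append]
        apply le_of_eq
        ring
    · refine ⟨[], σ', by simp, fun x => ?_, hq', h5, fun i _ => by rw [hm], by simp [ho], ?_⟩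
      · constructor
        · intro hx; simp at hx
        · rintro ⟨a, b, c⟩
          obtain ⟨m, hm, hc⟩ := hno (by omega)
          exact absurd c (not_covers_of_maxAt hv hen hsv hm hc x a b)
      · intro σ'' t ht
        exact (Reaches.while_true (by rw [Ex.eval_reg, hsp]; omega) hr ht).mono
          (by simp [stackCost])

theorem coverLoop_spec (h : Stores n w bits d) {v : ℕ} (hv : v < n) {σ : View}
    (hq : Query n w v σ) (h3 : σ.reg 3 = d v) (h4 : σ.reg 4 = 0) (ho : σ.out = []) :
    ∃ σ', Reaches w bits (.repeatWhile (.lt (.reg 4) (.reg 3)) coverStep) σ σ'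
        (((Ex.lt (.reg 4) (.reg 3)).cost + coverStep.bound + 1) * (d v + 1)) ∧
      Query n w v σ' ∧ σ'.reg 3 = d v ∧
      σ'.out = (List.range (d v)).map fun j => (v + (j + 1)) % n := by
  have hwp := h.wide.pos
  have hn := h.wide.size_lt
  have hd := h.cover_lt v hv
  let f : ℕ → View := fun i =>
    { reg := (σ.set 4 i).reg, mem := σ.mem, out := (List.range i).map fun j => (v + (j + 1)) % n }
  have hf0 : f 0 = σ := by
    ext i
    · by_cases hi : i = 4
      · subst hi; simp [f, h4]
      · simp [f, hi]
    · rfl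
    · simp [f, ho]
  have key := Reaches.iterate (w := w) (bits := bits) (p := coverStep) (t := coverStep.bound)
    (e := .lt (.reg 4) (.reg 3)) f (d v) (fun i hi => ⟨?_, ?_⟩) ?_
  · rw [hf0] at key
    exact ⟨_, key, ⟨by simp [f, hq.reg0], by simp [f, hq.reg1], by simp [f, hq.reg2]⟩,
      by simp [f, h3], rfl⟩
  · rw [Ex.eval_lt_ne_zero (x := i) (y := d v) (by simp [f, Ex.eval_reg])
      (by simp [f, Ex.eval_reg, h3])]
    exact hi
  · have g1 := Reaches.assign_eq (w := w) (bits := bits) (σ := f i) 4 (e := .reg 4 + 1)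
      (Ex.eval_add (x := i) (by simp [f, Ex.eval_reg]) (Ex.eval_one hwp) (by omega))
    have g2 := Reaches.print_eq (w := w) (bits := bits) (σ := (f i).set 4 (i + 1))
      (e := (.reg 2 + .reg 4) % .reg 0)
      (Ex.eval_mod (Ex.eval_add (x := v) (y := i + 1) (by simp [f, Ex.eval_reg, hq.reg2])
        (by simp [Ex.eval_reg]) (by omega)) (y := n) (by simp [f, Ex.eval_reg, hq.reg0]))
    have g3 : Reaches w bits coverStep (f i) _ coverStep.bound :=
      (g1.seq g2).to_bound loopFree_coverStep
    convert g3 using 1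
    ext j
    · by_cases hj : j = 4 <;> simp [f, hj]
    · rfl
    · simp [f, List.range_succ]
  · have := Ex.eval_lt_ne_zero (w := w) (bits := bits) (ρ := (f (d v)).reg) (a := .reg 4)
      (b := .reg 3) (x := d v) (y := d v) (by simp [f, Ex.eval_reg]) (by simp [f, Ex.eval_reg, h3])
    by_contra hne
    exact lt_irrefl _ (this.1 hne)

/-- The first point before `v` that is not covered by `v`. -/
def lowStart (n : ℕ) (d : ℕ → ℕ) (v : ℕ) : ℕ := if v + d v < n then 0 else v + d v + 1 - n

theorem stackInit_spec (h : Stores n w bits d) {v : ℕ} (hv : v < n) {σ : View}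
    (hq : Query n w v σ) (h3 : σ.reg 3 = d v) :
    ∃ σ', Reaches w bits stackInit σ σ' stackInit.bound ∧ Query n w v σ' ∧ σ'.reg 5 = 4 ∧
      σ'.mem 0 = lowStart n d v ∧ σ'.mem 1 = v ∧ σ'.mem 2 = min (v + d v + 1) n ∧ σ'.mem 3 = n ∧
      σ'.out = σ.out := by
  have hwp := h.wide.pos
  have hw1 := h.wide.one_lt
  have hn := h.wide.size_lt
  have hd := h.cover_lt v hv
  have e0 : (Ex.reg 0).eval w bits σ.reg = n := hq.reg0
  have e2 : (Ex.reg 2).eval w bits σ.reg = v := hq.reg2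
  have e3 : (Ex.reg 3).eval w bits σ.reg = d v := h3
  have e4 := Ex.eval_add e2 e3 (by omega)
  have e5 := Ex.eval_add e4 (Ex.eval_one hwp) (by omega)
  have el : (Ex.ite (.lt (.reg 2 + .reg 3) (.reg 0)) 0 (.reg 2 + .reg 3 + 1 - .reg 0)).eval
      w bits σ.reg = lowStart n d v :=
    Ex.eval_ite (Ex.eval_lt_ne_zero e4 e0) (fun _ => Ex.eval_zero)
      fun hle => Ex.eval_sub e5 e0 (by omega) (by omega)
  have f1 := Reaches.put_eq (w := w) (bits := bits) (σ := σ) (a := 0) Ex.eval_zero el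
  have f2 := Reaches.put_eq (w := w) (bits := bits) (a := 1) (b := .reg 2)
    (σ := ⟨σ.reg, Function.update σ.mem 0 (lowStart n d v), σ.out⟩) (Ex.eval_one hwp) e2
  have f3 := Reaches.put_eq (w := w) (bits := bits) (a := 2)
    (b := minE (.reg 2 + .reg 3 + 1) (.reg 0))
    (σ := ⟨σ.reg, Function.update (Function.update σ.mem 0 (lowStart n d v)) 1 v, σ.out⟩)
    (Ex.eval_two hw1) (eval_minE e5 e0)
  have f4 := Reaches.put_eq (w := w) (bits := bits) (a := 2 + 1) (b := .reg 0)
    (σ := ⟨σ.reg, Function.update (Function.update (Function.update σ.mem 0 (lowStart n d v)) 1 v)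
      2 (min (v + d v + 1) n), σ.out⟩)
    (Ex.eval_add (Ex.eval_two hw1) (Ex.eval_one hwp) (by omega)) e0
  have f5 := Reaches.assign_eq (w := w) (bits := bits) 5 (e := 2 + 2)
    (σ := ⟨σ.reg, Function.update (Function.update (Function.update (Function.update σ.mem 0
      (lowStart n d v)) 1 v) 2 (min (v + d v + 1) n)) (2 + 1) n, σ.out⟩)
    (Ex.eval_add (Ex.eval_two hw1) (Ex.eval_two hw1) (by omega))
  refine ⟨_, (f1.seq (f2.seq (f3.seq (f4.seq f5)))).to_bound loopFree_stackInit,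
    ⟨?_, ?_, ?_⟩, ?_, ?_, ?_, ?_, ?_, ?_⟩
  · simpa using hq.reg0
  · simpa using hq.reg1
  · simpa using hq.reg2
  all_goals simp

/-- A bound for the time of a neighborhood query, per neighbour. -/
def neighborhoodCost : ℕ :=
  coverInit.bound + ((Ex.lt (.reg 4) (.reg 3)).cost + coverStep.bound + 1) + stackInit.bound +
    2 * stackCost + (Ex.reg 5).cost + 1

/-- The three parts of the output are disjoint: the points covered by `v`, and the points covering
`v` in each of the two intervals that `v` leaves uncovered. Neither interval contains `v`, as the
search requires. -/
theorem neighborhoodProg_spec (h : Stores n w bits d) {v : ℕ} (hv : v < n) :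
    ∃ (t : ℕ) (l : List ℕ), Computes w bits neighborhoodProg [n, w, v] l t ∧
      t ≤ neighborhoodCost * (l.length + 1) ∧ l.Nodup ∧
      ∀ x, x ∈ l ↔ x < n ∧ x ≠ v ∧ (Covers n d v x ∨ Covers n d x v) := by
  have hn := h.wide.size_lt
  have hd := h.cover_lt v hv
  have hsq := h.wide.sq_le
  have hsq' := h.wide.le_sq
  have hwi := h.wide.idxBits_le
  have f1 := (Reaches.assign_eq (w := w) (bits := bits) (σ := View.init [n, w, v]) 3
    (eval_coverE (i := .reg 2) (I := v) h rfl rfl hv)).to_bound (Cmd.loopFree_assign _ _)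
  set σ₁ := (View.init [n, w, v]).set 3 (d v) with hσ₁
  have q₁ : Query n w v σ₁ := ⟨rfl, rfl, rfl⟩
  obtain ⟨σ₂, f2, q₂, h3, ho₂⟩ := coverLoop_spec h hv q₁ rfl rfl rfl
  obtain ⟨σ₃, f3, q₃, h5, m0, m1, m2, m3, ho₃⟩ := stackInit_spec h hv q₂ h3
  obtain ⟨l₁, σ₄, hl₁, hx₁, q₄, h5', hm₄, ho₄, ht₁⟩ :=
    stack_spec h hv n 2 (min (v + d v + 1) n) n σ₃ (by omega) q₃ h5 m2 m3 le_rfl (by omega)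
      (by omega)
  obtain ⟨l₂, σ₅, hl₂, hx₂, q₅, h5'', hm₅, ho₅, ht₂⟩ :=
    stack_spec h hv n 0 (lowStart n d v) v σ₄ (by omega) q₄ h5' ((hm₄ 0 (by omega)).trans m0)
      ((hm₄ 1 (by omega)).trans m1) (by omega) (by omega) (by omega)
  have f4 := ht₁ _ _ (ht₂ _ _ (Reaches.while_false (p := stackStep) (e := .reg 5)
    (w := w) (bits := bits) (σ := σ₅) h5''))
  obtain ⟨t, ht, hc⟩ := (f1.seq (f2.seq (f3.seq f4))).computes
  rw [ho₅, ho₄, ho₃, ho₂] at hc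
  have hx₀ : ∀ x, x ∈ (List.range (d v)).map (fun j => (v + (j + 1)) % n) ↔
      x < n ∧ x ≠ v ∧ Covers n d v x := by
    intro x
    rw [List.mem_map]
    constructor
    · rintro ⟨j, hj, rfl⟩
      rw [List.mem_range] at hj
      have := cycDist_add (n := n) (i := v) (k := j + 1) hv (by omega)
      refine ⟨Nat.mod_lt _ (by omega), fun heq => ?_, ?_⟩
      · rw [heq, cycDist_of_le hv le_rfl] at this; omega
      · rw [Covers, this]; omega
    · rintro ⟨hxn, hxv, hc⟩
      have h1 := add_cycDist hv hxn
      have h2 : cycDist n v x ≠ 0 := fun h0 => by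
        rw [h0, add_zero, Nat.mod_eq_of_lt hv] at h1; exact hxv h1.symm
      unfold Covers at hc
      refine ⟨cycDist n v x - 1, List.mem_range.2 (by omega), ?_⟩
      rw [Nat.sub_add_cancel (by omega), h1]
  -- If the arc of `v` does not wrap, the uncovered points lie before `v` and after its end. If it
  -- wraps, the upper interval is empty and the lower one starts behind the end of the arc.
  have hout : ∀ x, x < n → x ≠ v →
      (¬ Covers n d v x ↔ min (v + d v + 1) n ≤ x ∨ lowStart n d v ≤ x ∧ x < v) := by
    intro x hxn hxv
    unfold Covers lowStart
    rcases lt_or_gt_of_ne hxv with h1 | h1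
    · rw [cycDist_of_lt hv h1]
      split_ifs <;> omega
    · rw [cycDist_of_le hxn h1.le]
      split_ifs <;> omega
  refine ⟨t, _, hc, ht.trans ?_, ?_, ?_⟩
  · simp only [List.length_append, List.length_map, List.length_range, neighborhoodCost]
    change coverInit.bound + _ ≤ _
    generalize coverInit.bound = c1
    generalize stackInit.bound = c2
    generalize (Ex.lt (.reg 4) (.reg 3)).cost + coverStep.bound + 1 = c3
    generalize (Ex.reg 5).cost = c4
    generalize stackCost = c5
    -- The added summand is exactly the difference between the two sides.
    refine le_trans (Nat.le_add_right _ (c1 * (d v + l₁.length + l₂.length) +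
      c2 * (d v + l₁.length + l₂.length) + (c4 + 1) * (d v + l₁.length + l₂.length) +
      c3 * (l₁.length + l₂.length) + 2 * c5 * d v)) (le_of_eq ?_)
    ring
  · rw [List.nodup_append, List.nodup_append]
    refine ⟨⟨?_, hl₁, ?_⟩, hl₂, ?_⟩
    · refine List.Nodup.map_on (fun a ha b hb hab => ?_) List.nodup_range
      rw [List.mem_range] at ha hb
      have e1 := cycDist_add (n := n) (i := v) (k := a + 1) hv (by omega)
      have e2 := cycDist_add (n := n) (i := v) (k := b + 1) hv (by omega)
      rw [hab, e2] at e1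
      omega
    · intro a ha b hb hab
      subst hab
      rw [hx₀] at ha
      rw [hx₁] at hb
      exact (hout a ha.1 ha.2.1).2 (Or.inl hb.1) ha.2.2
    · intro a ha b hb hab
      subst hab
      rw [hx₂] at hb
      rw [List.mem_append, hx₀, hx₁] at ha
      rcases ha with ha | ha
      · exact (hout a ha.1 ha.2.1).2 (Or.inr ⟨hb.1, hb.2.1⟩) ha.2.2
      · omega
  · intro x
    rw [List.mem_append, List.mem_append, hx₀, hx₁, hx₂]
    constructor
    · rintro ((hx | hx) | hx)
      · exact ⟨hx.1, hx.2.1, Or.inl hx.2.2⟩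
      · exact ⟨hx.2.1, by omega, Or.inr hx.2.2⟩
      · exact ⟨by omega, by omega, Or.inr hx.2.2⟩
    · rintro ⟨hxn, hxv, hc⟩
      by_cases hcv : Covers n d v x
      · exact Or.inl (Or.inl ⟨hxn, hxv, hcv⟩)
      · have hc' := hc.resolve_left hcv
        rcases (hout x hxn hxv).1 hcv with h1 | h1
        · exact Or.inl (Or.inr ⟨h1, hxn, hc'⟩)
        · exact Or.inr ⟨h1.1, h1.2, hc'⟩

theorem exists_map_label {V : Type*} (e : V ≃ Fin n) (l : List ℕ) (hl : ∀ x ∈ l, x < n) :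
    ∃ L : List V, (L.map fun x => (e x : ℕ)) = l := by
  induction l with
  | nil => exact ⟨[], rfl⟩
  | cons a l ih =>
    obtain ⟨L, hL⟩ := ih fun x hx => hl x (List.mem_cons_of_mem _ hx)
    exact ⟨e.symm ⟨a, hl a List.mem_cons_self⟩ :: L, by simp [hL]⟩

theorem answersNeighborhood {V : Type*} {G : SimpleGraph V} {e : V ≃ Fin n}
    (hG : IsCyclicModel G e d) (h : Stores n w bits d) {C : ℕ} (hC : neighborhoodCost ≤ C) :
    AnswersNeighborhood G e w bits neighborhoodProg C := by
  intro v
  obtain ⟨t, l, hc, ht, hnd, hmem⟩ := neighborhoodProg_spec h (e v).2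
  obtain ⟨L, rfl⟩ := exists_map_label e l fun x hx => ((hmem x).1 hx).1
  have hinj : Function.Injective fun x => (e x : ℕ) := Fin.val_injective.comp e.injective
  have hL : ∀ x, x ∈ L ↔ G.Adj v x := by
    intro x
    rw [← List.mem_map_of_injective hinj, hmem, hG.2]
    constructor
    · rintro ⟨-, h1, h2⟩
      exact ⟨fun h => h1 (by rw [h]), h2⟩
    · rintro ⟨h1, h2⟩
      exact ⟨(e x).2, fun h => h1 (hinj h).symm, h2⟩
  have hnd' := List.Nodup.of_map _ hnd
  refine ⟨t, L, hc, ht.trans ?_, hnd', hL⟩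
  classical
  have hset : G.neighborSet v = (L.toFinset : Set V) := by
    ext x; simp [hL]
  rw [hset, Set.ncard_coe_finset, List.toFinset_card_of_nodup hnd', List.length_map]
  exact Nat.mul_le_mul_right _ hC

end Neighborhood

end ArcCode

/-! ## Shortest paths in cyclic models -/

namespace ArcCode

/-- The last point covered by the vertex at `y`, on the unrolled cycle. -/
def liftReach (n : ℕ) (d : ℕ → ℕ) (y : ℕ) : ℕ := y + d (y % n)

/-- The arcs of the vertices at `x` and `y` on the unrolled cycle intersect. -/
def Meets (n : ℕ) (d : ℕ → ℕ) (x y : ℕ) : Prop := y ≤ liftReach n d x ∧ x ≤ liftReach n d y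

/-- `z` has the largest reach among the points up to `p`. -/
structure IsNext (n : ℕ) (d : ℕ → ℕ) (p z : ℕ) : Prop where
  le : z ≤ p
  max : ∀ y ≤ p, liftReach n d y ≤ liftReach n d z

/-- A sequence that starts in `s`, always proceeds to a vertex of largest reach among the vertices
that meet the present one, and does not reach the point `t` before step `k`. -/
structure Greedy (n : ℕ) (d : ℕ → ℕ) (A : ℕ → ℕ) (s t k : ℕ) : Prop where
  start : A 0 = s
  next : ∀ i < k, IsNext n d (liftReach n d (A i)) (A (i + 1))
  before : ∀ i < k, liftReach n d (A i) < t

/-- The first point after `u + n` that lies over `v`. -/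
def target (n u v : ℕ) : ℕ := if u < v then v + n else v + n + n

theorem target_mod {n u v : ℕ} (hv : v < n) : target n u v % n = v := by
  unfold target
  split_ifs <;> simp [Nat.mod_eq_of_lt hv]

theorem lt_target {n u v : ℕ} (hu : u < n) : u + n < target n u v := by
  unfold target
  split_ifs <;> omega

theorem target_lt {n u v : ℕ} (hv : v < n) : target n u v < 3 * n := by
  unfold target
  split_ifs <;> omega

theorem liftReach_add_mul (n : ℕ) (d : ℕ → ℕ) (y c : ℕ) :
    liftReach n d (y + c * n) = liftReach n d y + c * n := by
  simp only [liftReach, Nat.add_mul_mod_self_right]; ring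

theorem le_liftReach (n : ℕ) (d : ℕ → ℕ) (y : ℕ) : y ≤ liftReach n d y := Nat.le_add_right _ _

/-! ### Greedy sequences on the unrolled cycle -/

section

variable {n : ℕ} {d : ℕ → ℕ}

theorem liftReach_lt (hd : ∀ i < n, d i < n) (hn : 0 < n) (y : ℕ) : liftReach n d y < y + n := by
  have := hd (y % n) (Nat.mod_lt _ hn)
  unfold liftReach; omega

theorem Greedy.liftReach_mono {A : ℕ → ℕ} {s t k : ℕ} (h : Greedy n d A s t k) {i : ℕ}
    (hi : i < k) : liftReach n d (A i) ≤ liftReach n d (A (i + 1)) :=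
  (h.next i hi).max _ (le_liftReach _ _ _)

theorem Greedy.start_le {A : ℕ → ℕ} {s t k : ℕ} (h : Greedy n d A s t k) :
    ∀ i ≤ k, s ≤ liftReach n d (A i) := by
  intro i
  induction i with
  | zero => intro _; rw [h.start]; exact le_liftReach _ _ _
  | succ i ih => intro hi; exact (ih (by omega)).trans (h.liftReach_mono (by omega))

theorem Greedy.lt_target {A : ℕ → ℕ} {s t k : ℕ} (h : Greedy n d A s t k) (hst : s < t) :
    ∀ i ≤ k, A i < t := by
  intro i hi
  cases i with
  | zero => rw [h.start]; exact hst
  | succ i => exact (h.next i hi).le.trans_lt (h.before i hi)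

/-- Equal reach means that the next choice is made from the same set of points, so the maximum does
not change any more. -/
theorem Greedy.stuck {A : ℕ → ℕ} {s t k : ℕ} (h : Greedy n d A s t k) {i : ℕ}
    (heq : liftReach n d (A (i + 1)) = liftReach n d (A i)) :
    ∀ j, i + j ≤ k → liftReach n d (A (i + j)) = liftReach n d (A i) := by
  intro j
  induction j with
  | zero => intro _; rfl
  | succ j ih =>
    intro hj
    have h1 := h.next (i + j) (by omega)
    have h2 := h.next i (by omega)
    rw [ih (by omega)] at h1
    exact le_antisymm ((h2.max _ h1.le).trans heq.le) (heq.symm.le.trans (h1.max _ h2.le))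

/-- Consecutive members are less than `n` apart, so the same vertex would mean the same point. Then
the sequence is stuck before the target, contrary to `ht`. -/
theorem Greedy.mod_ne (hd : ∀ i < n, d i < n) (hn : 0 < n) {A : ℕ → ℕ} {s t k : ℕ}
    (h : Greedy n d A s t k) (ht : t ≤ liftReach n d (A k)) {i : ℕ} (hi : i < k) :
    A i % n ≠ A (i + 1) % n := by
  intro heq
  have h1 := (h.next i hi).le
  have h2 := h.liftReach_mono hi
  have h3 := liftReach_lt hd hn (A i)
  have h4 : A i = A (i + 1) := by
    have h5 : A i ≤ A (i + 1) := by
      unfold liftReach at h2; rw [heq] at h2; omega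
    have h6 := (Nat.modEq_iff_dvd' h5).1 heq
    have h7 := Nat.eq_zero_of_dvd_of_lt h6 (by omega)
    omega
  have h5 := h.stuck (i := i) (by rw [← h4]) (k - i) (by omega)
  rw [Nat.add_sub_cancel' hi.le] at h5
  have := h.before i hi
  omega

theorem Greedy.meets {A : ℕ → ℕ} {s t k : ℕ} (h : Greedy n d A s t k) {i : ℕ} (hi : i < k) :
    Meets n d (A i) (A (i + 1)) :=
  ⟨(h.next i hi).le, (le_liftReach n d _).trans (h.liftReach_mono hi)⟩

theorem Meets.symm {x y : ℕ} (h : Meets n d x y) : Meets n d y x := ⟨h.2, h.1⟩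

theorem covers_of_meets (hd : ∀ i < n, d i < n) (hn : 0 < n) {x y : ℕ} (h : Meets n d x y) :
    Covers n d (x % n) (y % n) ∨ Covers n d (y % n) (x % n) := by
  wlog hxy : x ≤ y generalizing x y
  · exact (this h.symm (by omega)).symm
  left
  have h1 := h.1
  have h2 := hd (x % n) (Nat.mod_lt _ hn)
  unfold liftReach at h1
  have h3 := cycDist_add (n := n) (i := x % n) (k := y - x) (Nat.mod_lt _ hn) (by omega)
  rw [Nat.mod_add_mod, Nat.add_sub_cancel' hxy] at h3
  rw [Covers, h3]
  omega

/-- A greedy sequence is a lower bound for the reach of all other sequences. -/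
theorem Greedy.liftReach_le (hd : ∀ i < n, d i < n) (hn : 0 < n) {A : ℕ → ℕ} {s t k : ℕ}
    (h : Greedy n d A s t k) (hs : n ≤ s) {X : ℕ → ℕ} {L c : ℕ} (h0 : X 0 = s + c * n)
    (hX : ∀ i < L, Meets n d (X i) (X (i + 1))) :
    ∀ i ≤ L, i ≤ k → liftReach n d (X i) ≤ liftReach n d (A i) + c * n := by
  intro i
  induction i with
  | zero => intro _ _; rw [h0, liftReach_add_mul, h.start]
  | succ i ih =>
    intro hiL hik
    have h1 := (hX i hiL).1.trans (ih (by omega) (by omega))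
    -- Shifted back by `c * n`, the point `X (i + 1)` is a candidate for the greedy choice. If the
    -- shift would lead below zero, its reach is less than `c * n + n`, and `n ≤ s` already settles
    -- the claim.
    rcases le_or_gt (c * n) (X (i + 1)) with h2 | h2
    · have h3 := (h.next i hik).max (X (i + 1) - c * n) (by omega)
      have h4 := liftReach_add_mul n d (X (i + 1) - c * n) c
      rw [Nat.sub_add_cancel h2] at h4
      omega
    · have h3 := liftReach_lt hd hn (X (i + 1))
      have h4 := h.start_le (i + 1) hik
      omega

/-- The points over `v` are `n` apart, and `target n u v` is the first one after `u + n`; both facts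
are invariant under the shift by `c * n`. -/
theorem target_add_le {u v c y : ℕ} (hv : v < n) (hy : y % n = v)
    (h : u + n + c * n < y) : target n u v + c * n ≤ y := by
  have h1 := Nat.div_add_mod y n
  rw [hy] at h1
  rw [mul_comm] at h1
  by_contra hlt
  unfold target at hlt
  split_ifs at hlt with huv
  · have h2 : y / n < c + 1 := by
      by_contra h3
      have := Nat.mul_le_mul_right n (not_lt.1 h3)
      rw [add_mul] at this
      omega
    have := Nat.mul_le_mul_right n (Nat.lt_succ_iff.1 h2)
    omega
  · have h2 : y / n < c + 2 := by
      by_contra h3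
      have := Nat.mul_le_mul_right n (not_lt.1 h3)
      rw [add_mul] at this
      omega
    have := Nat.mul_le_mul_right n (Nat.lt_succ_iff.1 h2)
    rw [add_mul] at this
    omega

/-- The end of `X` lies at or behind the shifted target, and the member before it must reach that
far. By `Greedy.liftReach_le` the greedy sequence would have reached the target by step `L - 1` as
well. -/
theorem Greedy.lt_length (hd : ∀ i < n, d i < n) {A : ℕ → ℕ} {u v k : ℕ} (hv : v < n)
    (h : Greedy n d A (u + n) (target n u v) k) {X : ℕ → ℕ} {L c : ℕ} (h0 : X 0 = u + n + c * n)
    (hX : ∀ i < L, Meets n d (X i) (X (i + 1))) (hL : X L % n = v) (hlt : X 0 < X L) : k < L := by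
  by_contra hk
  have h1 := target_add_le hv hL (h0 ▸ hlt)
  obtain ⟨L, rfl⟩ : ∃ L', L = L' + 1 := ⟨L - 1, by
    have : L ≠ 0 := by rintro rfl; exact lt_irrefl _ hlt
    omega⟩
  have h2 := h.liftReach_le hd (by omega) (by omega) h0 hX L (by omega) (by omega)
  have h3 := (hX L (by omega)).1
  have h4 := h.before L (by omega)
  omega

end

/-! ### Walks of the graph and sequences on the unrolled cycle -/

section Walks

variable {V : Type*} {G : SimpleGraph V} {n : ℕ} {e : V ≃ Fin n} {d : ℕ → ℕ}

/-- One moves forward to `v` if `u` covers `v`, and backward if `v` covers `u`. The hypothesis `n ≤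
x` leaves room for the backward move. -/
theorem exists_meets (hG : IsCyclicModel G e d) {u v : V} (h : G.Adj u v) {x : ℕ}
    (hx : x % n = e u) (hxn : n ≤ x) : ∃ y, y % n = e v ∧ Meets n d x y ∧ x ≤ y + n := by
  have hu := (e u).2
  have hv := (e v).2
  rcases ((hG.2 u v).1 h).2 with h1 | h1
  · refine ⟨x + cycDist n (e u) (e v), ?_, ⟨?_, ?_⟩, by omega⟩
    · rw [Nat.add_mod, hx, Nat.add_mod_mod, add_cycDist hu hv]
    · unfold liftReach; rw [hx]; omega
    · exact (Nat.le_add_right _ _).trans (le_liftReach _ _ _)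
  · have h2 := cycDist_lt (j := e u) hv
    have h3 : (x - cycDist n (e v) (e u)) % n = e v := by
      have h4 : x - cycDist n (e v) (e u) + cycDist n (e v) (e u) ≡
          e v + cycDist n (e v) (e u) [MOD n] := by
        rw [Nat.sub_add_cancel (by omega), Nat.ModEq, add_cycDist hv hu, hx]
      have h5 := Nat.ModEq.add_right_cancel' _ h4
      rwa [Nat.ModEq, Nat.mod_eq_of_lt hv] at h5
    refine ⟨x - cycDist n (e v) (e u), h3, ⟨?_, ?_⟩, by omega⟩
    · exact (Nat.sub_le _ _).trans (le_liftReach _ _ _)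
    · unfold liftReach; rw [h3]; omega

/-- Walks lift to the unrolled cycle. -/
theorem exists_lift (hG : IsCyclicModel G e d) {u v : V} (p : G.Walk u v) :
    ∀ x, x % n = e u → p.length * n ≤ x → ∃ X : ℕ → ℕ, X 0 = x ∧ X p.length % n = e v ∧
      (∀ i < p.length, Meets n d (X i) (X (i + 1))) ∧ x ≤ X p.length + p.length * n := by
  induction p with
  | nil => intro x hx _; exact ⟨fun _ => x, rfl, hx, by simp, by simp⟩
  | cons h p ih =>
    intro x hx hle
    rw [SimpleGraph.Walk.length_cons, add_mul, one_mul] at hle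
    -- A step descends by at most `n`, so a start at height at least `n` times the length never
    -- falls below zero.
    obtain ⟨y, hy, hxy, hle'⟩ := exists_meets hG h hx (by omega)
    obtain ⟨X, h0, hL, hX, hle''⟩ := ih y hy (by omega)
    refine ⟨fun i => Nat.casesOn i x X, rfl, by simpa using hL, fun i hi => ?_, ?_⟩
    · cases i with
      | zero => show Meets n d x (X 0); rwa [h0]
      | succ i => exact hX i (by simpa using hi)
    · rw [SimpleGraph.Walk.length_cons, add_mul, one_mul]
      show x ≤ X p.length + _
      omega

/-- No walk is shorter than both greedy sequences. -/
theorem lt_walk_length (hG : IsCyclicModel G e d) {u v : V} (huv : u ≠ v) {A B : ℕ → ℕ} {k : ℕ}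
    (hA : Greedy n d A (e u + n) (target n (e u) (e v)) k)
    (hB : Greedy n d B (e v + n) (target n (e v) (e u)) k) (p : G.Walk u v) : k < p.length := by
  have hu := (e u).2
  have hv := (e v).2
  -- The additional `n` in the starting height ensures that the end point is at least `n`, which
  -- makes the shift `X p.length / n - 1` below meaningful.
  obtain ⟨X, h0, hL, hX, hle⟩ := exists_lift hG p (e u + n + p.length * n)
    (by simp [Nat.mod_eq_of_lt hu]) (by omega)
  rcases lt_trichotomy (X 0) (X p.length) with h | h | h
  · exact hA.lt_length hG.1 hv h0 hX hL h
  · rw [← h, h0, Nat.add_mul_mod_self_right, Nat.add_mod_right, Nat.mod_eq_of_lt hu] at hL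
    exact absurd (e.injective (Fin.ext hL)) huv
  · have h1 := Nat.div_add_mod (X p.length) n
    rw [hL, mul_comm] at h1
    have h2 : 1 ≤ X p.length / n := (Nat.one_le_div_iff (by omega)).2 (by omega)
    -- A descending lift, read backwards, ascends from a point over `v` to a point over `u`.
    refine hB.lt_length hG.1 hu (X := fun i => X (p.length - i)) (c := X p.length / n - 1) ?_
      (fun i hi => ?_) ?_ ?_
    · have h3 := Nat.sub_mul (X p.length / n) 1 n
      have h4 := Nat.mul_le_mul_right n h2
      simp only [Nat.sub_zero]
      omega
    · have := (hX (p.length - (i + 1)) (by omega)).symm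
      rwa [show p.length - (i + 1) + 1 = p.length - i by omega] at this
    · simp only [Nat.sub_self, h0]
      simp [Nat.mod_eq_of_lt hu]
    · simpa using h

theorem exists_walk_of_adj (a : ℕ → V) (m : ℕ) (h : ∀ i < m, G.Adj (a i) (a (i + 1))) :
    ∃ p : G.Walk (a 0) (a m), p.length = m ∧ p.support = (List.range (m + 1)).map a := by
  induction m with
  | zero => exact ⟨.nil, rfl, by simp⟩
  | succ m ih =>
    obtain ⟨p, hp, hs⟩ := ih fun i hi => h i (by omega)
    refine ⟨p.concat (h m (by omega)), by simp [hp], ?_⟩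
    rw [SimpleGraph.Walk.support_concat, hs, List.range_succ (n := m + 1)]
    simp

/-- A greedy sequence that reaches its target is a walk. -/
theorem Greedy.exists_walk (hG : IsCyclicModel G e d) {u v : V} {A : ℕ → ℕ} {k : ℕ}
    (hA : Greedy n d A (e u + n) (target n (e u) (e v)) k)
    (hk : target n (e u) (e v) ≤ liftReach n d (A k)) :
    ∃ p : G.Walk u v, p.length = k + 1 ∧
      p.support.map (fun x => (e x : ℕ)) = (List.range (k + 1)).map (fun i => A i % n) ++
        [(e v : ℕ)] := by
  have hu := (e u).2
  have hv := (e v).2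
  have hn : 0 < n := by omega
  let a : ℕ → V := fun i => if i ≤ k then e.symm ⟨A i % n, Nat.mod_lt _ hn⟩ else v
  have hea : ∀ i ≤ k, (e (a i) : ℕ) = A i % n := fun i hi => by simp [a, hi]
  have hadj : ∀ i < k + 1, G.Adj (a i) (a (i + 1)) := by
    intro i hi
    rw [hG.2]
    rcases Nat.lt_succ_iff_lt_or_eq.1 hi with h | rfl
    · have h1 := hA.mod_ne hG.1 hn hk h
      rw [← hea i h.le, ← hea (i + 1) h] at h1
      refine ⟨fun h2 => h1 (by rw [h2]), ?_⟩
      rw [hea i h.le, hea (i + 1) h]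
      exact covers_of_meets hG.1 hn (hA.meets h)
    · have h1 : a (i + 1) = v := by simp [a]
      -- The last edge: `A k` lies before the target and reaches it, and is less than `n` away from
      -- it, so it belongs to a neighbour of `v` distinct from `v`.
      have h2 := hA.lt_target (ArcCode.lt_target hu) i le_rfl
      have h3 := liftReach_lt hG.1 hn (A i)
      have h4 := target_mod (u := e u) hv
      refine ⟨fun h5 => ?_, ?_⟩
      · have h6 : A i % n = target n (e u) (e v) % n := by
          rw [h4, ← hea i le_rfl, h5, h1]
        have h7 := Nat.eq_zero_of_dvd_of_lt ((Nat.modEq_iff_dvd' h2.le).1 h6) (by omega)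
        omega
      · rw [h1, hea i le_rfl]
        conv in (occs := *) (e v : ℕ) => all_goals rw [← h4]
        exact covers_of_meets hG.1 hn ⟨hk, h2.le.trans (le_liftReach _ _ _)⟩
  obtain ⟨p, hp, hs⟩ := exists_walk_of_adj a (k + 1) hadj
  have ha0 : a 0 = u := e.injective (Fin.ext (by
    rw [hea 0 (by omega), hA.start, Nat.add_mod_right, Nat.mod_eq_of_lt hu]))
  have hak : a (k + 1) = v := by simp [a]
  refine ⟨p.copy ha0 hak, by simpa using hp, ?_⟩
  rw [SimpleGraph.Walk.support_copy, hs, List.map_map, List.range_succ, List.map_append]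
  congr 1
  · refine List.map_congr_left fun i hi => ?_
    rw [List.mem_range] at hi
    exact hea i (by omega)
  · simp [hak]

end Walks

end ArcCode

/-! ## Shortest path queries -/

namespace WordRAM

/-- A loop with an invariant. -/
theorem Reaches.iterate_inv {w : ℕ} {bits : List Bool} {p : Cmd} {e : Ex} {t k : ℕ}
    (P : ℕ → View → Prop) (hstep : ∀ i < k, ∀ σ, P i σ → e.eval w bits σ.reg ≠ 0 ∧
      ∃ σ', Reaches w bits p σ σ' t ∧ P (i + 1) σ')
    (hend : ∀ σ, P k σ → e.eval w bits σ.reg = 0) (j : ℕ) :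
    ∀ i, i + j = k → ∀ σ, P i σ →
      ∃ σ', P k σ' ∧ Reaches w bits (.repeatWhile e p) σ σ' ((e.cost + t + 1) * (j + 1)) := by
  induction j with
  | zero =>
    intro i hi σ hσ
    obtain rfl : i = k := hi
    exact ⟨σ, hσ, (Reaches.while_false (hend σ hσ)).mono (by omega)⟩
  | succ j ih =>
    intro i hi σ hσ
    obtain ⟨he, σ₁, h1, hP⟩ := hstep i (by omega) σ hσ
    obtain ⟨σ₂, hP₂, h2⟩ := ih (i + 1) (by omega) σ₁ hP
    exact ⟨σ₂, hP₂, (Reaches.while_true he h1 h2).mono (by rw [mul_add _ (j + 1)]; omega)⟩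

end WordRAM

namespace ArcCode

open WordRAM

/-- The last point covered by the vertex at a point of the unrolled cycle. -/
def liftReachE (y : Ex) : Ex := y + coverE (y % .reg 0)

/-- The first point over `b` that follows the point `a + n`. -/
def targetE (a b : Ex) : Ex := .ite (.lt a b) (b + .reg 0) (b + .reg 0 + .reg 0)

/-- A point of maximal reach among the points up to `p`. -/
def nextE (p : Ex) : Ex :=
  .ite (.lt (p % .reg 0 + 1) (.reg 0))
    (.ite (.lt (reachE (rangeMaxE 0 (p % .reg 0 + 1)) + .reg 0)
        (reachE (rangeMaxE (p % .reg 0 + 1) (.reg 0))))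
      (p - p % .reg 0 + rangeMaxE (p % .reg 0 + 1) (.reg 0) - .reg 0)
      (p - p % .reg 0 + rangeMaxE 0 (p % .reg 0 + 1)))
    (p - p % .reg 0 + rangeMaxE 0 (p % .reg 0 + 1))

/-- Whether both greedy sequences have to be continued. -/
def continueE : Ex :=
  .ite (.lt (liftReachE (.reg 4)) (targetE (.reg 2) (.reg 3)))
    (.ite (.lt (liftReachE (.reg 5)) (targetE (.reg 3) (.reg 2))) (.lt (.reg 6) (.reg 0)) 0) 0

/-- Save the current members of the greedy sequences. -/
def saveStep : Cmd :=
  .seq (.put (.reg 6 + .reg 6) (.reg 4)) (.put (.reg 6 + .reg 6 + 1) (.reg 5))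

/-- Continue the greedy sequences by one step. -/
def greedyStep : Cmd :=
  .seq (.assign 7 (liftReachE (.reg 4))) <| .seq (.assign 4 (nextE (.reg 7))) <|
  .seq (.assign 7 (liftReachE (.reg 5))) <| .seq (.assign 5 (nextE (.reg 7)))
    (.assign 6 (.reg 6 + 1))

/-- Start the greedy sequences. -/
def greedyInit : Cmd :=
  .seq (.assign 4 (.reg 2 + .reg 0)) (.assign 5 (.reg 3 + .reg 0))

/-- Report the next vertex of the first greedy sequence. -/
def forwardStep : Cmd :=
  .seq (.fetch 8 (.reg 9 + .reg 9)) <| .seq (.print (.reg 8 % .reg 0)) (.assign 9 (.reg 9 + 1))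

/-- Report the first greedy sequence and the last vertex of the path. -/
def forwardProg : Cmd :=
  .seq (.repeatWhile (.lt (.reg 9) (.reg 6 + 1)) forwardStep) (.print (.reg 3))

/-- Report the previous vertex of the second greedy sequence. -/
def backwardStep : Cmd :=
  .seq (.assign 9 (.reg 9 - 1)) <| .seq (.fetch 8 (.reg 9 + .reg 9 + 1)) (.print (.reg 8 % .reg 0))

/-- Report the first vertex of the path and the second greedy sequence in reverse order. -/
def backwardProg : Cmd :=
  .seq (.seq (.print (.reg 2)) (.assign 9 (.reg 6 + 1))) (.repeatWhile (.reg 9) backwardStep)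

/-- The program for shortest path queries. -/
def spathProg : Cmd :=
  .cond (.bin .eq (.reg 2) (.reg 3)) (.print (.reg 2)) <|
  .seq greedyInit <| .seq (.repeatWhile continueE (.seq saveStep greedyStep)) <| .seq saveStep <|
  .cond (.lt (liftReachE (.reg 4)) (targetE (.reg 2) (.reg 3)))
    (.cond (.lt (liftReachE (.reg 5)) (targetE (.reg 3) (.reg 2))) .skip backwardProg)
    forwardProg

theorem loopFree_saveStep : saveStep.LoopFree :=
  Cmd.loopFree_seq (Cmd.loopFree_put _ _) (Cmd.loopFree_put _ _)

theorem loopFree_greedyStep : greedyStep.LoopFree := by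
  repeat' first | exact Cmd.loopFree_assign _ _ | apply Cmd.loopFree_seq

theorem loopFree_forwardStep : forwardStep.LoopFree :=
  Cmd.loopFree_seq (Cmd.loopFree_fetch _ _)
    (Cmd.loopFree_seq (Cmd.loopFree_print _) (Cmd.loopFree_assign _ _))

theorem loopFree_backwardStep : backwardStep.LoopFree :=
  Cmd.loopFree_seq (Cmd.loopFree_assign _ _)
    (Cmd.loopFree_seq (Cmd.loopFree_fetch _ _) (Cmd.loopFree_print _))

theorem Greedy.extend {n : ℕ} {d A : ℕ → ℕ} {s t k z : ℕ} (h : Greedy n d A s t k)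
    (ht : liftReach n d (A k) < t) (hz : IsNext n d (liftReach n d (A k)) z) :
    Greedy n d (Function.update A (k + 1) z) s t (k + 1) := by
  refine ⟨by simp [h.start], fun i hi => ?_, fun i hi => ?_⟩
  · rcases Nat.lt_succ_iff_lt_or_eq.1 hi with h1 | rfl
    · have h2 : i ≠ k + 1 := by omega
      have h3 : i ≠ k := by omega
      simpa [h2, h3] using h.next i h1
    · simpa using hz
  · have h2 : i ≠ k + 1 := by omega
    rcases Nat.lt_succ_iff_lt_or_eq.1 hi with h1 | rfl
    · simpa [h2] using h.before i h1
    · simpa using ht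

/-! ### Correctness of the shortest path program -/

section Spath

variable {n w : ℕ} {bits : List Bool} {d : ℕ → ℕ} {ρ : Fin 16 → ℕ}

theorem eval_liftReachE (h : Stores n w bits d) (h0 : ρ 0 = n) (h1 : ρ 1 = w) {a : Ex} {y : ℕ}
    (hn : 0 < n) (ha : a.eval w bits ρ = y) (hy : y < 4 * n) :
    (liftReachE a).eval w bits ρ = liftReach n d y := by
  have h2 := h.wide.size_lt
  have h3 := Nat.mod_lt y hn
  have h4 := h.cover_lt _ h3
  exact Ex.eval_add ha (eval_coverE h h1 (Ex.eval_mod ha (Ex.eval_reg.trans h0)) h3) (by omega)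

theorem eval_targetE (h : Stores n w bits d) (h0 : ρ 0 = n) {a b : Ex} {u v : ℕ}
    (ha : a.eval w bits ρ = u) (hb : b.eval w bits ρ = v) (hv : v < n) :
    (targetE a b).eval w bits ρ = target n u v := by
  have h2 := h.wide.size_lt
  have h3 := Ex.eval_add hb (Ex.eval_reg.trans h0) (by omega)
  exact Ex.eval_ite (Ex.eval_lt_ne_zero ha hb) (fun _ => h3)
    fun _ => Ex.eval_add h3 (Ex.eval_reg.trans h0) (by omega)

/-- Every residue is best represented by its last occurrence up to `p`. For residues up to `p % n`
it is in the current lap, for the others in the previous lap, so two range maxima suffice. They are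
compared after adding `n` to the reach in the current lap. -/
theorem eval_nextE (h : Stores n w bits d) (h0 : ρ 0 = n) (h1 : ρ 1 = w) {a : Ex} {p : ℕ}
    (hn : 0 < n) (ha : a.eval w bits ρ = p) (hp : n ≤ p) (hp' : p < 4 * n) :
    IsNext n d p ((nextE a).eval w bits ρ) := by
  have h2 := h.wide.size_lt
  have h3 := Nat.mod_lt p hn
  have e0 : (Ex.reg 0).eval w bits ρ = n := h0
  have e1 := Ex.eval_mod ha e0
  have e2 := Ex.eval_add e1 (Ex.eval_one h.wide.pos) (by omega)
  have e3 := Ex.eval_sub ha e1 (Nat.mod_le _ _) (by omega)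
  have m1 := eval_rangeMaxE h h0 h1 (Ex.eval_zero) e2 (by omega) (by omega)
  have hdiv := Nat.div_add_mod p n
  rw [mul_comm] at hdiv
  have hP : 1 ≤ p / n := (Nat.one_le_div_iff hn).2 hp
  have hPn := Nat.mul_le_mul_right n hP
  set x₁ := (rangeMaxE 0 (a % .reg 0 + 1)).eval w bits ρ with hx₁
  have b1 := m1.1.2
  have r1 := eval_reachE h h1 hx₁.symm (by omega)
  have e4 := Ex.eval_add e3 hx₁.symm (by omega)
  have hsplit : ∀ y ≤ p, liftReach n d y = reach d (y % n) + y / n * n ∧ y % n < n ∧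
      (y / n * n ≤ p / n * n) ∧ (p % n < y % n → y / n * n + n ≤ p / n * n) := by
    intro y hy
    have h4 := Nat.div_add_mod y n
    rw [mul_comm] at h4
    have h5 := Nat.div_le_div_right (c := n) hy
    have h6 := Nat.mod_lt y hn
    refine ⟨?_, h6, Nat.mul_le_mul_right _ h5, fun h7 => ?_⟩
    · unfold liftReach reach; omega
    · have h8 : y / n ≠ p / n := fun h9 => by rw [h9] at h4; omega
      have h9 : y / n + 1 ≤ p / n := by omega
      have := Nat.mul_le_mul_right n h9
      rw [add_mul] at this
      omega
  have l1 : liftReach n d (p - p % n + x₁) = reach d x₁ + p / n * n := by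
    have := liftReach_add_mul n d x₁ (p / n)
    rw [show p - p % n + x₁ = x₁ + p / n * n by omega, this, liftReach, reach,
      Nat.mod_eq_of_lt (by omega)]
  -- If `p` is the last point of its lap, the current lap contains all residues and the second range
  -- is empty.
  by_cases hc : p % n + 1 < n
  swap
  · have := Ex.eval_ite (a := .ite (.lt (reachE (rangeMaxE 0 (a % .reg 0 + 1)) + .reg 0)
        (reachE (rangeMaxE (a % .reg 0 + 1) (.reg 0))))
      (a - a % .reg 0 + rangeMaxE (a % .reg 0 + 1) (.reg 0) - .reg 0)
      (a - a % .reg 0 + rangeMaxE 0 (a % .reg 0 + 1))) (x := 0) (Ex.eval_lt_ne_zero e2 e0)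
      (fun h => absurd h hc) (fun _ => e4)
    rw [if_neg hc] at this
    rw [nextE, this]
    refine ⟨by omega, fun y hy => ?_⟩
    obtain ⟨g1, g2, g3, g4⟩ := hsplit y hy
    have g5 := m1.2 (y % n) ⟨by omega, by omega⟩
    rw [l1, g1]
    omega
  have m2 := eval_rangeMaxE h h0 h1 e2 e0 hc le_rfl
  set x₂ := (rangeMaxE (a % .reg 0 + 1) (.reg 0)).eval w bits ρ with hx₂
  have b2 := m2.1.2
  have b2' := m2.1.1
  have r2 := eval_reachE h h1 hx₂.symm b2
  have e5 := Ex.eval_add e3 hx₂.symm (by omega)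
  have hrn : reach d x₁ < 2 * n := by
    have := h.cover_lt x₁ (by omega)
    unfold reach; omega
  have l2 : liftReach n d (p - p % n + x₂ - n) + n = reach d x₂ + p / n * n := by
    have h4 := liftReach_add_mul n d x₂ (p / n - 1)
    have h5 := Nat.sub_mul (p / n) 1 n
    rw [show p - p % n + x₂ - n = x₂ + (p / n - 1) * n by omega, h4, liftReach, reach,
      Nat.mod_eq_of_lt b2]
    omega
  have key := Ex.eval_ite (Ex.eval_lt_ne_zero e2 e0) (fun _ => Ex.eval_ite
    (Ex.eval_lt_ne_zero (Ex.eval_add r1 e0 (by omega)) r2)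
    (fun _ => Ex.eval_sub e5 e0 (by omega) (by omega)) fun _ => e4) (fun _ => e4)
  rw [if_pos hc] at key
  rw [nextE, key]
  split_ifs with hlt
  · refine ⟨by omega, fun y hy => ?_⟩
    obtain ⟨g1, g2, g3, g4⟩ := hsplit y hy
    rw [g1]
    rcases le_or_gt (y % n) (p % n) with g6 | g6
    · have g5 := m1.2 (y % n) ⟨by omega, by omega⟩
      omega
    · have g5 := m2.2 (y % n) ⟨by omega, by omega⟩
      have := g4 g6
      omega
  · refine ⟨by omega, fun y hy => ?_⟩
    obtain ⟨g1, g2, g3, g4⟩ := hsplit y hy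
    rw [l1, g1]
    rcases le_or_gt (y % n) (p % n) with g6 | g6
    · have g5 := m1.2 (y % n) ⟨by omega, by omega⟩
      omega
    · have g5 := m2.2 (y % n) ⟨by omega, by omega⟩
      have := g4 g6
      omega

/-- The state of the shortest path program after `k` steps of the greedy sequences `A` and `B`,
of which `m` members are saved. -/
structure PathState (n w u v k m : ℕ) (A B : ℕ → ℕ) (σ : View) : Prop where
  reg0 : σ.reg 0 = n
  reg1 : σ.reg 1 = w
  reg2 : σ.reg 2 = u
  reg3 : σ.reg 3 = v
  reg4 : σ.reg 4 = A k
  reg5 : σ.reg 5 = B k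
  reg6 : σ.reg 6 = k
  reg9 : σ.reg 9 = 0
  memA : ∀ i < m, σ.mem (i + i) = A i
  memB : ∀ i < m, σ.mem (i + i + 1) = B i
  out : σ.out = []

theorem saveStep_spec (h : Stores n w bits d) {u v k : ℕ} {A B : ℕ → ℕ} {σ : View}
    (hσ : PathState n w u v k k A B σ) (hk : k ≤ n) :
    ∃ σ', Reaches w bits saveStep σ σ' saveStep.bound ∧ PathState n w u v k (k + 1) A B σ' := by
  have h2 := h.wide.size_lt
  have h3 := h.wide.one_lt
  have h4 := h.wide.sq_le
  have h5 := h.wide.le_sq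
  have e6 : (Ex.reg 6).eval w bits σ.reg = k := hσ.reg6
  have e66 := Ex.eval_add e6 e6 (by omega)
  have f1 := Reaches.put_eq (b := .reg 4) e66 (y := A k) hσ.reg4
  have f2 := Reaches.put_eq (b := .reg 5) (a := .reg 6 + .reg 6 + 1) (w := w) (bits := bits)
    (σ := ⟨σ.reg, Function.update σ.mem (k + k) (A k), σ.out⟩)
    (Ex.eval_add e66 (Ex.eval_one h.wide.pos) (by omega)) (y := B k) hσ.reg5
  refine ⟨_, (f1.seq f2).to_bound loopFree_saveStep, hσ.reg0, hσ.reg1, hσ.reg2, hσ.reg3,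
    hσ.reg4, hσ.reg5, hσ.reg6, hσ.reg9, fun i hi => ?_, fun i hi => ?_, hσ.out⟩
  · rcases Nat.lt_succ_iff_lt_or_eq.1 hi with h6 | rfl
    · have a1 : i + i ≠ k + k := by omega
      have a2 : i + i ≠ k + k + 1 := by omega
      simp [a1, a2, hσ.memA i h6]
    · simp
  · rcases Nat.lt_succ_iff_lt_or_eq.1 hi with h6 | rfl
    · have a1 : i + i + 1 ≠ k + k := by omega
      have a2 : i + i ≠ k + k := by omega
      simp [a1, a2, hσ.memB i h6]
    · simp

theorem greedyStep_spec (h : Stores n w bits d) {u v k : ℕ} (hu : u < n) (hv : v < n)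
    {A B : ℕ → ℕ} {σ : View} (hσ : PathState n w u v k (k + 1) A B σ) (hk : k < n)
    (hA : Greedy n d A (u + n) (target n u v) k) (hB : Greedy n d B (v + n) (target n v u) k)
    (hAk : liftReach n d (A k) < target n u v) (hBk : liftReach n d (B k) < target n v u) :
    ∃ A' B' σ', Reaches w bits greedyStep σ σ' greedyStep.bound ∧
      PathState n w u v (k + 1) (k + 1) A' B' σ' ∧
      Greedy n d A' (u + n) (target n u v) (k + 1) ∧
      Greedy n d B' (v + n) (target n v u) (k + 1) := by
  have hn : 0 < n := by omega
  have h2 := h.wide.size_lt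
  have h3 := h.wide.one_lt
  have h4 := h.wide.sq_le
  have h5 := h.wide.le_sq
  have a1 := target_lt (u := u) hv
  have a2 := target_lt (u := v) hu
  have a3 := hA.start_le k le_rfl
  have a4 := hB.start_le k le_rfl
  have a5 := le_liftReach n d (A k)
  have a6 := le_liftReach n d (B k)
  have f1 := Reaches.assign_eq (σ := σ) 7 (eval_liftReachE (a := .reg 4) h hσ.reg0 hσ.reg1 hn hσ.reg4
    (by omega))
  set σ₁ := σ.set 7 (liftReach n d (A k)) with hσ₁
  have n1 := eval_nextE (a := .reg 7) (ρ := σ₁.reg) (p := liftReach n d (A k)) h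
    (by simp [hσ₁, hσ.reg0]) (by simp [hσ₁, hσ.reg1]) hn (by simp [hσ₁, Ex.eval_reg]) (by omega)
    (by omega)
  set z₁ := (nextE (.reg 7)).eval w bits σ₁.reg with hz₁
  have f2 : Reaches w bits (.assign 4 (nextE (.reg 7))) σ₁ (σ₁.set 4 z₁) _ :=
    Reaches.assign_eq 4 rfl
  set σ₂ := σ₁.set 4 z₁ with hσ₂
  have f3 := Reaches.assign_eq (σ := σ₂) 7 (eval_liftReachE (a := .reg 5) (ρ := σ₂.reg) (y := B k) h
    (by simp [hσ₂, hσ₁, hσ.reg0]) (by simp [hσ₂, hσ₁, hσ.reg1]) hn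
    (by simp [hσ₂, hσ₁, hσ.reg5, Ex.eval_reg]) (by omega))
  set σ₃ := σ₂.set 7 (liftReach n d (B k)) with hσ₃
  have n2 := eval_nextE (a := .reg 7) (ρ := σ₃.reg) (p := liftReach n d (B k)) h
    (by simp [hσ₃, hσ₂, hσ₁, hσ.reg0]) (by simp [hσ₃, hσ₂, hσ₁, hσ.reg1]) hn
    (by simp [hσ₃, Ex.eval_reg]) (by omega) (by omega)
  set z₂ := (nextE (.reg 7)).eval w bits σ₃.reg with hz₂
  have f4 : Reaches w bits (.assign 5 (nextE (.reg 7))) σ₃ (σ₃.set 5 z₂) _ :=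
    Reaches.assign_eq 5 rfl
  set σ₄ := σ₃.set 5 z₂ with hσ₄
  have f5 := Reaches.assign_eq (σ := σ₄) (w := w) (bits := bits) 6 (e := .reg 6 + 1)
    (Ex.eval_add (x := k) (by simp [hσ₄, hσ₃, hσ₂, hσ₁, hσ.reg6, Ex.eval_reg])
      (Ex.eval_one h.wide.pos) (by omega))
  refine ⟨Function.update A (k + 1) z₁, Function.update B (k + 1) z₂, _,
    (f1.seq (f2.seq (f3.seq (f4.seq f5)))).to_bound loopFree_greedyStep, ⟨?_, ?_, ?_, ?_, ?_, ?_,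
    ?_, ?_, fun i hi => ?_, fun i hi => ?_, ?_⟩, hA.extend hAk n1, hB.extend hBk n2⟩
  · simp [hσ₄, hσ₃, hσ₂, hσ₁, hσ.reg0]
  · simp [hσ₄, hσ₃, hσ₂, hσ₁, hσ.reg1]
  · simp [hσ₄, hσ₃, hσ₂, hσ₁, hσ.reg2]
  · simp [hσ₄, hσ₃, hσ₂, hσ₁, hσ.reg3]
  · simp [hσ₄, hσ₃, hσ₂]
  · simp [hσ₄]
  · simp
  · simp [hσ₄, hσ₃, hσ₂, hσ₁, hσ.reg9]
  · simp [hσ₄, hσ₃, hσ₂, hσ₁, hσ.memA i hi, hi.ne]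
  · simp [hσ₄, hσ₃, hσ₂, hσ₁, hσ.memB i hi, hi.ne]
  · simp [hσ₄, hσ₃, hσ₂, hσ₁, hσ.out]

/-- The time of one iteration of the main loop. -/
def greedyCost : ℕ := continueE.cost + (saveStep.bound + greedyStep.bound) + 1

theorem eval_lt_liftReachE (h : Stores n w bits d) {u v k m : ℕ} (hu : u < n) (hv : v < n)
    {A B : ℕ → ℕ} {σ : View} (hσ : PathState n w u v k m A B σ)
    (hA : Greedy n d A (u + n) (target n u v) k) :
    (Ex.lt (liftReachE (.reg 4)) (targetE (.reg 2) (.reg 3))).eval w bits σ.reg ≠ 0 ↔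
      liftReach n d (A k) < target n u v := by
  have a1 := target_lt (u := u) hv
  have a3 := hA.lt_target (ArcCode.lt_target hu) k le_rfl
  exact Ex.eval_lt_ne_zero (eval_liftReachE h hσ.reg0 hσ.reg1 (by omega) hσ.reg4 (by omega))
    (eval_targetE h hσ.reg0 hσ.reg2 hσ.reg3 hv)

theorem eval_lt_liftReachE' (h : Stores n w bits d) {u v k m : ℕ} (hu : u < n) (hv : v < n)
    {A B : ℕ → ℕ} {σ : View} (hσ : PathState n w u v k m A B σ)
    (hB : Greedy n d B (v + n) (target n v u) k) :
    (Ex.lt (liftReachE (.reg 5)) (targetE (.reg 3) (.reg 2))).eval w bits σ.reg ≠ 0 ↔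
      liftReach n d (B k) < target n v u := by
  have a1 := target_lt (u := v) hu
  have a3 := hB.lt_target (ArcCode.lt_target hv) k le_rfl
  exact Ex.eval_lt_ne_zero (eval_liftReachE h hσ.reg0 hσ.reg1 (by omega) hσ.reg5 (by omega))
    (eval_targetE h hσ.reg0 hσ.reg3 hσ.reg2 hu)

theorem eval_continueE (h : Stores n w bits d) {u v k m : ℕ} (hu : u < n) (hv : v < n)
    {A B : ℕ → ℕ} {σ : View} (hσ : PathState n w u v k m A B σ)
    (hA : Greedy n d A (u + n) (target n u v) k) (hB : Greedy n d B (v + n) (target n v u) k) :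
    continueE.eval w bits σ.reg ≠ 0 ↔ liftReach n d (A k) < target n u v ∧
      liftReach n d (B k) < target n v u ∧ k < n := by
  rw [continueE, Ex.eval_ite (eval_lt_liftReachE h hu hv hσ hA) (fun _ => Ex.eval_ite
    (eval_lt_liftReachE' h hu hv hσ hB) (fun _ => Ex.eval_lt (a := .reg 6) (b := .reg 0) hσ.reg6
    hσ.reg0) fun _ => Ex.eval_zero) fun _ => Ex.eval_zero]
  split_ifs <;> simp_all

/-- The induction runs over the number `j` of steps left before the counter reaches `n`, which also
guarantees that the loop halts when there is no path. -/
theorem greedyLoop_spec (h : Stores n w bits d) {u v : ℕ} (hu : u < n) (hv : v < n) (j : ℕ) :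
    ∀ (k : ℕ) (A B : ℕ → ℕ) (σ : View), k + j = n → PathState n w u v k k A B σ →
      Greedy n d A (u + n) (target n u v) k → Greedy n d B (v + n) (target n v u) k →
      ∃ (k' : ℕ) (A' B' : ℕ → ℕ) (σ' : View), k ≤ k' ∧ k' ≤ n ∧
        PathState n w u v k' k' A' B' σ' ∧
        Greedy n d A' (u + n) (target n u v) k' ∧ Greedy n d B' (v + n) (target n v u) k' ∧
        (liftReach n d (A' k') < target n u v → liftReach n d (B' k') < target n v u → k' = n) ∧
        Reaches w bits (.repeatWhile continueE (.seq saveStep greedyStep)) σ σ'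
          (greedyCost * (k' - k + 1)) := by
  have hdone : ∀ (k : ℕ) (A B : ℕ → ℕ) (σ : View), PathState n w u v k k A B σ →
      Greedy n d A (u + n) (target n u v) k → Greedy n d B (v + n) (target n v u) k →
      ¬ (liftReach n d (A k) < target n u v ∧ liftReach n d (B k) < target n v u ∧ k < n) →
      Reaches w bits (.repeatWhile continueE (.seq saveStep greedyStep)) σ σ
        (greedyCost * (k - k + 1)) := by
    intro k A B σ hσ hA hB hc
    refine (Reaches.while_false (by
      by_contra hne; exact hc ((eval_continueE h hu hv hσ hA hB).1 hne))).mono ?_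
    simp [greedyCost]
  induction j with
  | zero =>
    intro k A B σ hk hσ hA hB
    exact ⟨k, A, B, σ, le_rfl, by omega, hσ, hA, hB, fun _ _ => hk,
      hdone k A B σ hσ hA hB (by omega)⟩
  | succ j ih =>
    intro k A B σ hk hσ hA hB
    by_cases hc : liftReach n d (A k) < target n u v ∧ liftReach n d (B k) < target n v u ∧ k < n
    swap
    · exact ⟨k, A, B, σ, le_rfl, by omega, hσ, hA, hB, fun h1 h2 => by
        by_contra h3; exact hc ⟨h1, h2, by omega⟩, hdone k A B σ hσ hA hB hc⟩
    obtain ⟨σ₁, f1, hσ₁⟩ := saveStep_spec h hσ (by omega)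
    obtain ⟨A₁, B₁, σ₂, f2, hσ₂, hA₁, hB₁⟩ :=
      greedyStep_spec h hu hv hσ₁ hc.2.2 hA hB hc.1 hc.2.1
    obtain ⟨k', A', B', σ', h1, h2, hσ', hA', hB', hs, f3⟩ :=
      ih (k + 1) A₁ B₁ σ₂ (by omega) hσ₂ hA₁ hB₁
    refine ⟨k', A', B', σ', by omega, h2, hσ', hA', hB', hs, ?_⟩
    refine (Reaches.while_true ((eval_continueE h hu hv hσ hA hB).2 hc) (f1.seq f2) f3).mono ?_
    rw [← greedyCost, show k' - k + 1 = (k' - (k + 1) + 1) + 1 by omega]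
    exact le_of_eq (by ring)

/-- The time of one iteration of the forward report. -/
def forwardCost : ℕ := (Ex.lt (.reg 9) (.reg 6 + 1)).cost + forwardStep.bound + 1

theorem forwardProg_spec (h : Stores n w bits d) {u v k : ℕ} {A B : ℕ → ℕ} {σ : View}
    (hσ : PathState n w u v k (k + 1) A B σ) (hk : k ≤ n) :
    ∃ σ', Reaches w bits forwardProg σ σ' (forwardCost * (k + 2) + (Ex.reg 3).cost + 1) ∧
      σ'.out = (List.range (k + 1)).map (fun i => A i % n) ++ [v] := by
  have h2 := h.wide.size_lt
  have h4 := h.wide.sq_le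
  have h5 := h.wide.le_sq
  have h6 := h.wide.one_lt
  let P : ℕ → View → Prop := fun i τ => τ.reg 0 = n ∧ τ.reg 3 = v ∧ τ.reg 6 = k ∧ τ.reg 9 = i ∧
    τ.mem = σ.mem ∧ τ.out = (List.range i).map fun i => A i % n
  obtain ⟨σ₁, ⟨-, p3, -, -, -, po⟩, f1⟩ := Reaches.iterate_inv (w := w) (bits := bits) (k := k + 1)
    (p := forwardStep) (e := .lt (.reg 9) (.reg 6 + 1)) (t := forwardStep.bound) P (by
      rintro i hi τ ⟨q0, q3, q6, q9, qm, qo⟩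
      have e9 : (Ex.reg 9).eval w bits τ.reg = i := q9
      have e6 : (Ex.reg 6).eval w bits τ.reg = k := q6
      refine ⟨(Ex.eval_lt_ne_zero e9 (Ex.eval_add e6 (Ex.eval_one h.wide.pos) (by omega))).2 hi, ?_⟩
      have g1 := Reaches.fetch_eq (σ := τ) 8 (Ex.eval_add e9 e9 (by omega)) (y := A i)
        (by rw [qm, hσ.memA i hi])
      have g2 := Reaches.print_eq (σ := τ.set 8 (A i)) (w := w) (bits := bits)
        (e := .reg 8 % .reg 0) (Ex.eval_mod (x := A i) (y := n) (by simp [Ex.eval_reg])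
        (by simp [Ex.eval_reg, q0]))
      have g3 := Reaches.assign_eq 9 (w := w) (bits := bits) (e := .reg 9 + 1)
        (σ := ⟨(τ.set 8 (A i)).reg, τ.mem, τ.out ++ [A i % n]⟩)
        (Ex.eval_add (x := i) (by simp [Ex.eval_reg, q9]) (Ex.eval_one h.wide.pos) (by omega))
      refine ⟨_, (g1.seq (g2.seq g3)).to_bound loopFree_forwardStep, ?_, ?_, ?_, ?_, ?_, ?_⟩
      · simp [q0]
      · simp [q3]
      · simp [q6]
      · simp
      · simp [qm]
      · simp [qo, List.range_succ]) (by
      rintro τ ⟨q0, q3, q6, q9, qm, qo⟩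
      have e6 : (Ex.reg 6).eval w bits τ.reg = k := q6
      rw [Ex.eval_lt (a := .reg 9) q9 (Ex.eval_add e6 (Ex.eval_one h.wide.pos) (by omega)),
        if_neg (lt_irrefl _)]) (k + 1) 0 (by omega) σ
      ⟨hσ.reg0, hσ.reg3, hσ.reg6, hσ.reg9, rfl, by simp [hσ.out]⟩
  have f2 := Reaches.print_eq (w := w) (bits := bits) (σ := σ₁) (e := .reg 3) (x := v) p3
  exact ⟨_, f1.seq f2, by simp [po]⟩

/-- The time of one iteration of the backward report. -/
def backwardCost : ℕ := (Ex.reg 9).cost + backwardStep.bound + 1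

theorem backwardProg_spec (h : Stores n w bits d) {u v k : ℕ} {A B : ℕ → ℕ} {σ : View}
    (hσ : PathState n w u v k (k + 1) A B σ) (hk : k ≤ n) :
    ∃ σ', Reaches w bits backwardProg σ σ'
        ((Ex.reg 2).cost + 1 + ((Ex.reg 6 + 1).cost + 1) + backwardCost * (k + 2)) ∧
      σ'.out = ((List.range (k + 1)).map (fun i => B i % n) ++ [u]).reverse := by
  have h2 := h.wide.size_lt
  have h4 := h.wide.sq_le
  have h5 := h.wide.le_sq
  have h6 := h.wide.one_lt
  -- Register 9 counts down from `k + 1`, so the sequence saved at the odd addresses is read from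
  -- its last member to its first.
  let P : ℕ → View → Prop := fun i τ => τ.reg 0 = n ∧ τ.reg 9 = k + 1 - i ∧
    τ.mem = σ.mem ∧ τ.out = [u] ++ (List.range i).map fun i => B (k - i) % n
  have f1 := Reaches.print_eq (w := w) (bits := bits) (σ := σ) (e := .reg 2) (x := u) hσ.reg2
  have e6 : (Ex.reg 6).eval w bits σ.reg = k := hσ.reg6
  have f2 := Reaches.assign_eq 9 (w := w) (bits := bits) (σ := ⟨σ.reg, σ.mem, σ.out ++ [u]⟩)
    (e := .reg 6 + 1) (Ex.eval_add e6 (Ex.eval_one h.wide.pos) (by omega))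
  obtain ⟨σ₁, ⟨-, -, -, po⟩, f3⟩ := Reaches.iterate_inv (w := w) (bits := bits) (k := k + 1)
    (p := backwardStep) (e := .reg 9) (t := backwardStep.bound) P (by
      rintro i hi τ ⟨q0, q9, qm, qo⟩
      have e9 : (Ex.reg 9).eval w bits τ.reg = k + 1 - i := q9
      refine ⟨by rw [e9]; omega, ?_⟩
      have g1 := Reaches.assign_eq (σ := τ) 9 (Ex.eval_sub e9 (Ex.eval_one h.wide.pos) (by omega)
        (by omega))
      have e9' : (Ex.reg 9).eval w bits (τ.set 9 (k + 1 - i - 1)).reg = k - i := by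
        simp [Ex.eval_reg]; omega
      have g2 := Reaches.fetch_eq 8 (σ := τ.set 9 (k + 1 - i - 1)) (Ex.eval_add (Ex.eval_add e9' e9'
        (by omega)) (Ex.eval_one h.wide.pos) (by omega)) (y := B (k - i))
        (by rw [View.mem_set, qm, hσ.memB _ (by omega)])
      have g3 := Reaches.print_eq (w := w) (bits := bits)
        (σ := (τ.set 9 (k + 1 - i - 1)).set 8 (B (k - i)))
        (e := .reg 8 % .reg 0) (Ex.eval_mod (x := B (k - i)) (y := n) (by simp [Ex.eval_reg])
        (by simp [Ex.eval_reg, q0]))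
      refine ⟨_, (g1.seq (g2.seq g3)).to_bound loopFree_backwardStep, ?_, ?_, ?_, ?_⟩
      · simp [q0]
      · simp; omega
      · simp [qm]
      · simp [qo, List.range_succ]) (by
      rintro τ ⟨q0, q9, qm, qo⟩
      rw [Ex.eval_reg, q9, Nat.sub_self]) (k + 1) 0 (by omega)
      (View.set ⟨σ.reg, σ.mem, σ.out ++ [u]⟩ 9 (k + 1))
      ⟨by simp [hσ.reg0], by simp, rfl, by simp [hσ.out]⟩
  refine ⟨_, (f1.seq f2).seq f3, ?_⟩
  rw [po, List.reverse_append, List.reverse_singleton]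
  congr 1
  apply List.ext_getElem
  · simp
  · intro i h1 h2
    simp

/-- A bound for the time of a shortest path query, per vertex of the path. -/
def spathCost : ℕ :=
  (Ex.bin .eq (.reg 2) (.reg 3)).cost + (Ex.reg 2).cost + (Ex.reg 3).cost + greedyInit.bound +
    greedyCost + saveStep.bound +
    (Ex.lt (liftReachE (.reg 4)) (targetE (.reg 2) (.reg 3))).cost +
    (Ex.lt (liftReachE (.reg 5)) (targetE (.reg 3) (.reg 2))).cost + forwardCost + backwardCost +
    (Ex.reg 6 + 1).cost + 10

theorem greedyInit_spec (h : Stores n w bits d) {u v : ℕ} (hu : u < n) (hv : v < n) :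
    ∃ σ', Reaches w bits greedyInit (View.init [n, w, u, v]) σ' greedyInit.bound ∧
      PathState n w u v 0 0 (fun _ => u + n) (fun _ => v + n) σ' := by
  have h2 := h.wide.size_lt
  have f1 := Reaches.assign_eq 4 (w := w) (bits := bits) (σ := View.init [n, w, u, v])
    (e := .reg 2 + .reg 0) (Ex.eval_add (x := u) (y := n) rfl rfl (by omega))
  have f2 := Reaches.assign_eq 5 (w := w) (bits := bits)
    (σ := (View.init [n, w, u, v]).set 4 (u + n))
    (e := .reg 3 + .reg 0) (Ex.eval_add (x := v) (y := n) rfl rfl (by omega))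
  exact ⟨_, (f1.seq f2).to_bound (Cmd.loopFree_seq (Cmd.loopFree_assign _ _)
    (Cmd.loopFree_assign _ _)), rfl, rfl, rfl, rfl, rfl, rfl, rfl, rfl, by simp, by simp, rfl⟩

theorem Greedy.zero (n : ℕ) (d : ℕ → ℕ) (s t : ℕ) : Greedy n d (fun _ => s) s t 0 :=
  ⟨rfl, by simp, by simp⟩

/-- The shortest path program follows the two greedy sequences until one of them reaches its
target. -/
theorem spathProg_spec (h : Stores n w bits d) {u v : ℕ} (hu : u < n) (hv : v < n) (huv : u ≠ v) :
    ∃ (k : ℕ) (A B : ℕ → ℕ) (t : ℕ) (l : List ℕ), k ≤ n ∧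
      Greedy n d A (u + n) (target n u v) k ∧ Greedy n d B (v + n) (target n v u) k ∧
      Computes w bits spathProg [n, w, u, v] l t ∧ t ≤ spathCost * (k + 2) ∧
      ((k = n ∧ l = [] ∧ liftReach n d (A k) < target n u v ∧
          liftReach n d (B k) < target n v u) ∨
        (target n u v ≤ liftReach n d (A k) ∧
          l = (List.range (k + 1)).map (fun i => A i % n) ++ [v]) ∨
        (target n v u ≤ liftReach n d (B k) ∧
          l = ((List.range (k + 1)).map (fun i => B i % n) ++ [u]).reverse)) := by
  obtain ⟨σ₁, f1, hσ₁⟩ := greedyInit_spec h hu hv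
  obtain ⟨k, A, B, σ₂, -, hkn, hσ₂, hA, hB, hs, f2⟩ := greedyLoop_spec h hu hv n 0 _ _ σ₁
    (by omega) hσ₁ (.zero _ _ _ _) (.zero _ _ _ _)
  obtain ⟨σ₃, f3, hσ₃⟩ := saveStep_spec h hσ₂ hkn
  have c0 : (Ex.bin .eq (.reg 2) (.reg 3)).eval w bits (View.init [n, w, u, v]).reg = 0 :=
    if_neg huv
  have c1 := eval_lt_liftReachE h hu hv hσ₃ hA
  have c2 := eval_lt_liftReachE' h hu hv hσ₃ hB
  have hle : ∀ c, c ≤ c * (k + 2) := fun c => Nat.le_mul_of_pos_right c (by omega)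
  have l1 := hle (Ex.bin .eq (.reg 2) (.reg 3)).cost
  have l2 := hle greedyInit.bound
  have l3 := hle saveStep.bound
  have l4 := hle (Ex.lt (liftReachE (.reg 4)) (targetE (.reg 2) (.reg 3))).cost
  have l5 := hle (Ex.lt (liftReachE (.reg 5)) (targetE (.reg 3) (.reg 2))).cost
  have l6 := hle (Ex.reg 2).cost
  have l7 := hle (Ex.reg 3).cost
  have l8 := hle (Ex.reg 6 + 1).cost
  have l9 : greedyCost * (k - 0 + 1) ≤ greedyCost * (k + 2) := Nat.mul_le_mul_left _ (by omega)
  by_cases hlt : liftReach n d (A k) < target n u v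
  · by_cases hlt' : liftReach n d (B k) < target n v u
    · have f4 := Reaches.cond_true (q := forwardProg) (c1.2 hlt)
        (Reaches.cond_true (q := backwardProg) (c2.2 hlt') .skip)
      obtain ⟨t, ht, hc⟩ := (Reaches.cond_false (p := .print (.reg 2)) c0
        (f1.seq (f2.seq (f3.seq f4)))).computes
      rw [hσ₃.out] at hc
      refine ⟨k, A, B, t, _, hkn, hA, hB, hc, ht.trans ?_, Or.inl ⟨hs hlt hlt', rfl, hlt, hlt'⟩⟩
      simp only [spathCost, add_mul]
      omega
    · obtain ⟨σ₄, f5, ho⟩ := backwardProg_spec h hσ₃ hkn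
      have f4 := Reaches.cond_true (q := forwardProg) (c1.2 hlt)
        (Reaches.cond_false (p := .skip) (by by_contra hne; exact hlt' (c2.1 hne)) f5)
      obtain ⟨t, ht, hc⟩ := (Reaches.cond_false (p := .print (.reg 2)) c0
        (f1.seq (f2.seq (f3.seq f4)))).computes
      rw [ho] at hc
      refine ⟨k, A, B, t, _, hkn, hA, hB, hc, ht.trans ?_, Or.inr (Or.inr ⟨not_lt.1 hlt', rfl⟩)⟩
      simp only [spathCost, add_mul]
      omega
  · obtain ⟨σ₄, f5, ho⟩ := forwardProg_spec h hσ₃ hkn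
    have f4 := Reaches.cond_false
      (p := .cond (.lt (liftReachE (.reg 5)) (targetE (.reg 3) (.reg 2))) .skip backwardProg)
      (by by_contra hne; exact hlt (c1.1 hne)) f5
    obtain ⟨t, ht, hc⟩ := (Reaches.cond_false (p := .print (.reg 2)) c0
      (f1.seq (f2.seq (f3.seq f4)))).computes
    rw [ho] at hc
    refine ⟨k, A, B, t, _, hkn, hA, hB, hc, ht.trans ?_, Or.inr (Or.inl ⟨not_lt.1 hlt, rfl⟩)⟩
    simp only [spathCost, add_mul]
    omega

/-- When the loop stops after `k` steps, every walk has at least `k + 1` edges, and a greedy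
sequence that has arrived provides a walk with exactly `k + 1` edges. -/
theorem answersSpath {V : Type*} {G : SimpleGraph V} {e : V ≃ Fin n}
    (hG : IsCyclicModel G e d) (h : Stores n w bits d) {C : ℕ} (hC : spathCost ≤ C) :
    AnswersSpath G e w bits spathProg C := by
  intro u v
  have hu := (e u).2
  have hv := (e v).2
  by_cases huv : u = v
  · subst huv
    refine ⟨fun _ => ?_, fun hr => absurd (SimpleGraph.Reachable.refl u) hr⟩
    have f1 := Reaches.print_eq (w := w) (bits := bits) (σ := View.init [n, w, e u, e u])
      (e := .reg 2) (x := e u) rfl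
    have c0 : (Ex.bin .eq (.reg 2) (.reg 3)).eval w bits (View.init [n, w, e u, e u]).reg = 1 :=
      if_pos rfl
    obtain ⟨t, ht, hc⟩ := (Reaches.cond_true (by rw [c0]; exact one_ne_zero) f1).computes
    refine ⟨t, .nil, by simp, by simp, hc, ht.trans ?_⟩
    refine le_trans ?_ ((Nat.mul_le_mul_right _ hC))
    simp only [spathCost, SimpleGraph.Walk.length_nil]
    omega
  have huv' : (e u : ℕ) ≠ e v := fun h1 => huv (e.injective (Fin.ext h1))
  obtain ⟨k, A, B, t, l, hkn, hA, hB, hc, ht, hl⟩ := spathProg_spec h hu hv huv'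
  have hlow : ∀ p : G.Walk u v, k + 1 ≤ p.length := lt_walk_length hG huv hA hB
  have hdist : ∀ p : G.Walk u v, p.length = k + 1 → p.length = G.dist u v := by
    intro p hp
    obtain ⟨q, hq⟩ := p.reachable.exists_walk_length_eq_dist
    have := hlow q
    have := SimpleGraph.dist_le p
    omega
  have hans : ∀ p : G.Walk u v, p.length = k + 1 → p.support.map (fun x => (e x : ℕ)) = l →
      ∃ (t : ℕ) (P : G.Walk u v), P.IsPath ∧ P.length = G.dist u v ∧
        Computes w bits spathProg [n, w, e u, e v] (P.support.map fun x => (e x : ℕ)) t ∧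
        t ≤ C * (P.length + 1) := by
    intro p hp hs
    refine ⟨t, p, p.isPath_of_length_eq_dist (hdist p hp), hdist p hp, by rwa [hs], ht.trans ?_⟩
    rw [hp]
    exact Nat.mul_le_mul_right _ hC
  rcases hl with ⟨rfl, rfl, -, -⟩ | ⟨hr, rfl⟩ | ⟨hr, rfl⟩
  -- Every walk would have more than `n` edges, whereas a shortest path has fewer than `n`.
  · have hno : ¬ G.Reachable u v := by
      intro hr
      have : Fintype V := .ofEquiv _ e.symm
      obtain ⟨q, hq, -⟩ := hr.exists_path_of_dist
      have h1 := hq.length_lt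
      rw [Fintype.card_congr e, Fintype.card_fin] at h1
      have := hlow q
      omega
    exact ⟨fun hr => absurd hr hno, fun _ => ⟨t, hc⟩⟩
  · obtain ⟨p, hp, hs⟩ := hA.exists_walk hG hr
    exact ⟨fun _ => hans p hp hs, fun hno => absurd p.reachable hno⟩
  · obtain ⟨p, hp, hs⟩ := hB.exists_walk hG hr
    -- The second sequence yields a path from `v` to `u`; the program has output it in reverse.
    refine ⟨fun _ => hans p.reverse (by simpa using hp) ?_, fun hno => absurd p.reverse.reachable hno⟩
    rw [SimpleGraph.Walk.support_reverse, List.map_reverse, hs]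

end Spath

end ArcCode

/-! ## The size of the encoding -/

namespace ArcCode

open Filter Asymptotics

/-- An upper bound for the redundancy of the encoding. -/
def redundancy (n : ℕ) : ℕ :=
  2 * n + n * (subBits n * (subBits n + 2)) + (2 + (n / blockLen n + 1) * idxBits n) * recLen n

theorem clog_le_logb {n : ℕ} (hn : 0 < n) : (Nat.clog 2 n : ℝ) ≤ Real.logb 2 n + 1 := by
  rw [← Real.natCeil_logb_natCast]
  push_cast
  exact (Nat.ceil_lt_add_one (Real.logb_nonneg (by norm_num) (by exact_mod_cast hn))).le

/-- The summand `2 * n` of the redundancy comes from rounding up the logarithm and from the extra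
bit in `idxBits`. -/
theorem length_encode_le (n : ℕ) (d : ℕ → ℕ) :
    ((encode n d).length : ℝ) ≤ n * Real.logb 2 n + redundancy n := by
  have h1 : (encode n d).length = n * Nat.clog 2 n + n + n * (subBits n * (subBits n + 2)) +
      (2 + (n / blockLen n + 1) * idxBits n) * recLen n := by
    rw [length_encode, numRecs, recLen, idxBits]; ring
  rw [h1, redundancy]
  rcases Nat.eq_zero_or_pos n with rfl | hn
  · simp
  · have h2 := mul_le_mul_of_nonneg_left (clog_le_logb hn) (Nat.cast_nonneg (α := ℝ) n)
    push_cast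
    linarith

/-- With `idxBits n = m + 2` and `2 ^ m < n` this is a weak form of `mul_self_le_two_pow_add`. -/
theorem idxBits_sq_le {n : ℕ} (hn : 2 ≤ n) : idxBits n * idxBits n ≤ n + 200 := by
  have h1 : 0 < Nat.clog 2 n := Nat.clog_pos (by norm_num) hn
  obtain ⟨m, hm⟩ := Nat.exists_eq_succ_of_ne_zero h1.ne'
  have h2 : 2 ^ m < n := by
    have := Nat.pow_pred_clog_lt_self (b := 2) (by norm_num) (show 1 < n by omega)
    rwa [hm] at this
  have h3 := mul_self_le_two_pow_add m
  have h4 : idxBits n = m + 2 := by rw [idxBits, hm]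
  have h5 : (m + 2) * (m + 2) ≤ 4 * (m + 1) * (m + 2) := Nat.mul_le_mul_right _ (by omega)
  rw [h4]
  omega

/-- Write `k = idxBits n`. The header, the record of `n` and the block table cost at most `404 k +
202 n + 202 k²`, and `k ≤ k² ≤ n + 200`. With `2 n` this gives `810 n + 121200`, which is at most
`122010 n`. -/
theorem redundancy_le {n : ℕ} (hn : 2 ≤ n) :
    redundancy n ≤ n * (122010 + subBits n * (subBits n + 2)) := by
  have hk := idxBits_pos n
  have h1 := shorts_le_add n
  have h2 := idxBits_sq_le hn
  have h3 : recLen n ≤ 202 * idxBits n := by unfold recLen; omega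
  have h4 : n / blockLen n * (idxBits n * idxBits n) ≤ n :=
    (Nat.mul_le_mul_left _ (sq_idxBits_le_blockLen n)).trans (Nat.div_mul_le_self _ _)
  have h5 : (2 + (n / blockLen n + 1) * idxBits n) * recLen n ≤
      404 * idxBits n + 202 * (n / blockLen n * (idxBits n * idxBits n)) +
        202 * (idxBits n * idxBits n) :=
    (Nat.mul_le_mul_left _ h3).trans (le_of_eq (by ring))
  have h6 : idxBits n ≤ idxBits n * idxBits n := Nat.le_mul_of_pos_right _ hk
  rw [redundancy, Nat.mul_add n 122010]
  omega

theorem tendsto_logBits : Tendsto logBits atTop atTop := by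
  refine tendsto_atTop_atTop.2 fun b => ⟨2 ^ 2 ^ b, fun n hn => ?_⟩
  have h1 := (Nat.pow_lt_pow_iff_right (by norm_num)).1 (hn.trans_lt (lt_two_pow_idxBits n))
  exact ((Nat.pow_lt_pow_iff_right (by norm_num)).1 (h1.trans (idxBits_lt_two_pow n))).le

/-- In terms of `m = logBits n`, which tends to infinity, the left side is a quadratic polynomial,
while `2 ^ m` is at most a constant times `log n`. -/
theorem shorts_isLittleO :
    (fun n : ℕ => (122010 + subBits n * (subBits n + 2) : ℝ)) =o[atTop]
      fun n : ℕ => Real.logb 2 n := by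
  have h1 : (fun m : ℕ => (122010 + 4 * (m : ℝ) ^ 2 + 4 * (m : ℝ) ^ 1)) =o[atTop]
      fun m : ℕ => (2 : ℝ) ^ m := by
    refine (IsLittleO.add ?_ ?_).add ?_
    · refine isLittleO_const_left.2 (Or.inr ?_)
      exact tendsto_norm_atTop_atTop.comp (tendsto_pow_atTop_atTop_of_one_lt (by norm_num))
    · exact (isLittleO_pow_const_const_pow_of_one_lt 2 (by norm_num)).const_mul_left 4
    · exact (isLittleO_pow_const_const_pow_of_one_lt 1 (by norm_num)).const_mul_left 4
  have h2 := h1.comp_tendsto tendsto_logBits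
  have h3 : (fun n : ℕ => (122010 + subBits n * (subBits n + 2) : ℝ)) =
      (fun m : ℕ => (122010 + 4 * (m : ℝ) ^ 2 + 4 * (m : ℝ) ^ 1)) ∘ logBits := by
    funext n
    simp only [Function.comp, subBits]
    push_cast
    ring
  rw [h3]
  -- `2 ^ logBits n ≤ 2 * idxBits n ≤ 2 * (L + 2)` with `L = Real.logb 2 n`, and this is at most `6
  -- * L` once `1 ≤ L`.
  refine h2.trans_isBigO (IsBigO.of_bound 6 ?_)
  filter_upwards [eventually_ge_atTop 2] with n hn
  have hL : 1 ≤ Real.logb 2 n := by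
    rw [Real.le_logb_iff_rpow_le (by norm_num) (by positivity)]
    simpa using (Nat.cast_le (α := ℝ)).2 hn
  have h4 : (2 : ℝ) ^ logBits n ≤ 2 * idxBits n := by exact_mod_cast two_pow_logBits_le' n
  have h5 := clog_le_logb (show 0 < n by omega)
  have h6 : (idxBits n : ℝ) = Nat.clog 2 n + 1 := by simp [idxBits]
  rw [Function.comp, Real.norm_of_nonneg (by positivity), Real.norm_of_nonneg (by linarith)]
  linarith

theorem redundancy_isLittleO :
    (fun n : ℕ => (redundancy n : ℝ)) =o[atTop] fun n : ℕ => (n : ℝ) * Real.logb 2 n := by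
  refine IsBigO.trans_isLittleO ?_
    ((isBigO_refl (fun n : ℕ => (n : ℝ)) atTop).mul_isLittleO shorts_isLittleO)
  refine IsBigO.of_bound 1 ?_
  filter_upwards [eventually_ge_atTop 2] with n hn
  rw [Real.norm_of_nonneg (by positivity), Real.norm_of_nonneg (by positivity), one_mul]
  exact_mod_cast redundancy_le hn

open WordRAM in
/-- A bound for the constants in the time bounds. -/
def totalCost : ℕ :=
  adjacentE.cost + 1 + (degreeE.cost + 1) + neighborhoodCost + spathCost

open WordRAM in
theorem exists_representation {V : Type*} [Fintype V] {G : SimpleGraph V}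
    (hG : IsCircularArcGraph G) {n : ℕ} (hn : n = Fintype.card V) {w : ℕ}
    (hw : Nat.clog 2 n + 200 < w) :
    ∃ (e : V ≃ Fin n) (R D : List Bool), (R.length : ℝ) ≤ n * Real.logb 2 n + redundancy n ∧
      AnswersAdjacent G e w R (.print adjacentE) totalCost ∧
      AnswersNeighborhood G e w R neighborhoodProg totalCost ∧
      AnswersSpath G e w R spathProg totalCost ∧ D.length ≤ n * Nat.clog 2 n ∧
      AnswersAdjacent G e w (R ++ D) (.print adjacentE) totalCost ∧
      AnswersNeighborhood G e w (R ++ D) neighborhoodProg totalCost ∧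
      AnswersSpath G e w (R ++ D) spathProg totalCost ∧
      AnswersDegree G e w (R ++ D) (.print degreeE) totalCost := by
  obtain ⟨e, d, hmodel⟩ := hG.exists_isCyclicModel hn
  let f : ℕ → ℕ := fun i => if h : i < n then (G.neighborSet (e.symm ⟨i, h⟩)).ncard else 0
  have h1 : Stores n w (encode n d) d := ⟨⟨hw⟩, hmodel.1, fun p hp => getD_encode hp⟩
  -- Only the initial segment of the bit string is constrained, so the same programs remain correct
  -- when the degree table is appended.
  have h2 : Stores n w (encode n d ++ degreeTable n f) d := ⟨⟨hw⟩, hmodel.1, fun p hp => by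
    rw [List.getD_append _ _ _ _ (by rwa [length_encode]), getD_encode hp]⟩
  have hD : ∀ p < n * Nat.clog 2 n, (encode n d ++ degreeTable n f).getD
      (numRecs n * recLen n + p) false = (f (p / Nat.clog 2 n)).testBit (p % Nat.clog 2 n) := by
    intro p hp
    rw [List.getD_append_right _ _ _ _ (by rw [length_encode]; omega), length_encode,
      Nat.add_sub_cancel_left]
    simp [degreeTable, List.getD_eq_getElem?_getD, hp]
  have hC : totalCost = adjacentE.cost + 1 + (degreeE.cost + 1) + neighborhoodCost + spathCost :=
    rfl
  exact ⟨e, encode n d, degreeTable n f, length_encode_le n d,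
    answersAdjacent hmodel h1 (by omega), answersNeighborhood hmodel h1 (by omega),
    answersSpath hmodel h1 (by omega), by simp [degreeTable],
    answersAdjacent hmodel h2 (by omega), answersNeighborhood hmodel h2 (by omega),
    answersSpath hmodel h2 (by omega),
    answersDegree h2 (by omega) (f := f) (fun v => by simp [f]) hD⟩

end ArcCode

theorem corollary1 :
    ∃ (c C : ℕ) (f : ℕ → ℝ) (adjacent neighborhood spath degree : WordRAM.Cmd),
      f =o[Filter.atTop] (fun n : ℕ => (n : ℝ) * Real.logb 2 n) ∧
      ∀ (V : Type*) [Fintype V] (G : SimpleGraph V), IsCircularArcGraph G →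
      ∀ n : ℕ, n = Fintype.card V → ∀ w : ℕ, Nat.clog 2 n + c < w →
      ∃ (e : V ≃ Fin n) (R D : List Bool),
        (R.length : ℝ) ≤ n * Real.logb 2 n + f n ∧
        AnswersAdjacent G e w R adjacent C ∧
        AnswersNeighborhood G e w R neighborhood C ∧
        AnswersSpath G e w R spath C ∧
        D.length ≤ n * Nat.clog 2 n ∧
        AnswersAdjacent G e w (R ++ D) adjacent C ∧
        AnswersNeighborhood G e w (R ++ D) neighborhood C ∧
        AnswersSpath G e w (R ++ D) spath C ∧
        AnswersDegree G e w (R ++ D) degree C := by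
  exact ⟨200, ArcCode.totalCost, fun n => ArcCode.redundancy n, .print ArcCode.adjacentE,
    ArcCode.neighborhoodProg, ArcCode.spathProg, .print ArcCode.degreeE,
    ArcCode.redundancy_isLittleO, fun _ _ _ hG _ hn _ hw => ArcCode.exists_representation hG hn hw⟩
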